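/- Let $K\subset\mathbb{R}^2$ be a planar convex body (compact, convex, with nonempty interior), with area $|K|$ and boundary $\partial K$. Put $\vec u(\theta)=(\cos\theta,\sin\theta)$. For $0<\alpha<1$ and $\theta\in\mathbb{R}/2\pi\mathbb{Z}$, let $\Delta(\alpha,\theta)$ be the unique line oriented by $\vec u(\theta)$ such that the part of $K$ to its right has area $\alpha|K|$, and let $m(\alpha,\theta)$ be the midpoint of the chord $\Delta(\alpha,\theta)\cap K$; it has left and right derivatives $\vec m'_l,\vec m'_r$ with respect to $\theta$. Let $v_l=\langle\vec m'_l,\vec u(\theta)\rangle$, $v_r=\langle\vec m'_r,\vec u(\theta)\rangle$ (the left and right velocities of the envelope of the $\alpha$-sections), and let $V(\alpha,\theta)$ be the closed segment of $\mathbb{R}$ with endpoints $v_l$ and $v_r$. Define \begin{align*} I_F&=\{\alpha\in\,]0,1[\;:\ V(\alpha,\theta)\cap\,]0,+\infty[\,\neq\emptyset\text{ for some }\theta\},\\ I_B&=\{\alpha\in\,]0,1[\;:\ V(\alpha,\theta)\cap\,]-\infty,0[\,\neq\emptyset\text{ for some }\theta\},\\ I_Z&=\{\alpha\in\,]0,1[\;:\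 0\in V(\alpha,\theta)\text{ for some }\theta\}, \end{align*} and $\alpha_B=\inf I_B$, $\alpha_Z=\inf I_Z$. Segments are understood to be nondegenerate. Then: (a) $I_B=\,]\alpha_B,1[$ and $I_F=\,]0,1-\alpha_B[$. If $\partial K$ is $\mathcal{C}^1$, then $I_Z=[\alpha_Z,1-\alpha_Z]$; otherwise $I_Z$ is one of the intervals $[\alpha_Z,1-\alpha_Z]$ or $]\alpha_Z,1-\alpha_Z[$. (b) $\alpha_Z\le\alpha_B\le\frac12$. Moreover, if $\alpha_Z\ne\alpha_B$, then $\partial K$ contains two parallel segments lying on distinct lines. (c) i. $\alpha_B=\frac12$ if and only if $K$ is centrally symmetric. ii. $\alpha_Z=0$ if and only if $\partial K$ contains a segment whose endpoints admit two distinct parallel supporting lines to $K$ (one line at each endpoint). iii. $\alpha_B=0$ if and only if $\partial K$ contains a segment whose endpoints admit two distinct parallel supporting lines to $K$ (one line at each endpoint), at least one of which meets $\partial K$ at only one point. -/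

import Mathlib

open Set Topology MeasureTheory

noncomputable section

namespace AlphaSec

/-- The Euclidean plane. -/
abbrev Plane : Type := EuclideanSpace ℝ (Fin 2)

/-- The unit vector of direction `θ`. Points of the circle `ℝ / 2πℤ` are represented by real
numbers; everything below is `2π`-periodic in `θ`. -/
def dir (θ : ℝ) : Plane := !₂[Real.cos θ, Real.sin θ]

/-- The unit vector directly orthogonal to `dir θ`. -/
def nrm (θ : ℝ) : Plane := !₂[-Real.sin θ, Real.cos θ]

/-- The (support of the) line oriented by `dir θ` at signed distance `t` from the origin. -/
def line (θ t : ℝ) : Set Plane := {x | inner ℝ x (nrm θ) = t}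

/-- The closed half-plane on the left of the oriented line `(θ, t)`. -/
def leftHalf (θ t : ℝ) : Set Plane := {x | t ≤ inner ℝ x (nrm θ)}

/-- The closed half-plane on the right of the oriented line `(θ, t)`. -/
def rightHalf (θ t : ℝ) : Set Plane := {x | inner ℝ x (nrm θ) ≤ t}

/-- Planar convex bodies: compact convex sets with nonempty interior. -/
structure IsPlanarBody (K : Set Plane) : Prop where
  isCompact : IsCompact K
  convex : Convex ℝ K
  nonempty_interior : (interior K).Nonempty

/-- The oriented line `(θ, t)` is an `α`-section of `K`: the part of `K` on its right has
area `α |K|`. -/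
def IsSection (K : Set Plane) (α θ t : ℝ) : Prop :=
  volume.real (K ∩ rightHalf θ t) = α * volume.real K

/-- The signed distance to the origin of the `α`-section of `K` of direction `θ`. For a convex
body and `0 < α < 1` there is exactly one such section, so this is the infimum of a singleton. -/
def secOffset (K : Set Plane) (α θ : ℝ) : ℝ := sInf {t | IsSection K α θ t}

/-- The abscissae, along the `α`-section of direction `θ`, of the points of the chord that it
cuts in `K`. -/
def chordParams (K : Set Plane) (α θ : ℝ) : Set ℝ :=
  {s | s • dir θ + secOffset K α θ • nrm θ ∈ K}

/-- The first endpoint `b` of the chord. -/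
def chordB (K : Set Plane) (α θ : ℝ) : Plane :=
  sInf (chordParams K α θ) • dir θ + secOffset K α θ • nrm θ

/-- The last endpoint `c` of the chord. -/
def chordC (K : Set Plane) (α θ : ℝ) : Plane :=
  sSup (chordParams K α θ) • dir θ + secOffset K α θ • nrm θ

/-- The midpoint `m = (b + c) / 2` of the chord: the current point of the envelope. -/
def mid (K : Set Plane) (α θ : ℝ) : Plane := (1 / 2 : ℝ) • (chordB K α θ + chordC K α θ)

/-- The left velocity: the scalar product of the left derivative of `m` in `θ` with `dir θ`. -/
def velL (K : Set Plane) (α θ : ℝ) : ℝ :=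
  inner ℝ (derivWithin (fun τ => mid K α τ) (Iic θ) θ) (dir θ)

/-- The right velocity: the scalar product of the right derivative of `m` in `θ` with `dir θ`. -/
def velR (K : Set Plane) (α θ : ℝ) : ℝ :=
  inner ℝ (derivWithin (fun τ => mid K α τ) (Ici θ) θ) (dir θ)

/-- The segment with endpoints the left and the right velocity, in either order; it is reduced
to the velocity where the two agree. -/
def velSeg (K : Set Plane) (α θ : ℝ) : Set ℝ := uIcc (velL K α θ) (velR K α θ)

/-- The forwards set `F(α)`. -/
def forwards (K : Set Plane) (α : ℝ) : Set ℝ := {θ | (velSeg K α θ ∩ Ioi 0).Nonempty}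

/-- The backwards set `B(α)`. -/
def backwards (K : Set Plane) (α : ℝ) : Set ℝ := {θ | (velSeg K α θ ∩ Iio 0).Nonempty}

/-- The zero set `Z(α)`. -/
def zeros (K : Set Plane) (α : ℝ) : Set ℝ := {θ | (0 : ℝ) ∈ velSeg K α θ}

/-- `I_F`. -/
def setIF (K : Set Plane) : Set ℝ := {α | α ∈ Ioo (0 : ℝ) 1 ∧ (forwards K α).Nonempty}

/-- `I_B`. -/
def setIB (K : Set Plane) : Set ℝ := {α | α ∈ Ioo (0 : ℝ) 1 ∧ (backwards K α).Nonempty}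

/-- `I_Z`. -/
def setIZ (K : Set Plane) : Set ℝ := {α | α ∈ Ioo (0 : ℝ) 1 ∧ (zeros K α).Nonempty}

/-- `α_B = inf I_B`. -/
def alphaB (K : Set Plane) : ℝ := sInf (setIB K)

/-- `α_Z = inf I_Z`. -/
def alphaZ (K : Set Plane) : ℝ := sInf (setIZ K)

/-- `S` is a `C¹` curve without boundary points in the plane (a one-dimensional `C¹`
submanifold): near each of its points it is the image of a regular injective `C¹`
parametrization. -/
def IsC1Curve (S : Set Plane) : Prop :=
  ∀ p ∈ S, ∃ U : Set Plane, IsOpen U ∧ p ∈ U ∧ ∃ ε > (0 : ℝ), ∃ γ : ℝ → Plane,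
    ContDiffOn ℝ 1 γ (Ioo (-ε) ε) ∧ γ 0 = p ∧ (∀ s ∈ Ioo (-ε) ε, deriv γ s ≠ 0) ∧
    InjOn γ (Ioo (-ε) ε) ∧ γ '' Ioo (-ε) ε = S ∩ U

/-- `D` is a supporting line to `K` at the point `p` of `K`: a line through `p`, with `K`
contained in one of the closed half-planes that it bounds (on the left, for one of the two
orientations of `D`). -/
def IsSupportingLineAt (K D : Set Plane) (p : Plane) : Prop :=
  p ∈ K ∧ p ∈ D ∧ ∃ θ t : ℝ, D = line θ t ∧ K ⊆ leftHalf θ t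

/-- `D` and `D'` are two distinct parallel lines. -/
def AreDistinctParallel (D D' : Set Plane) : Prop :=
  D ≠ D' ∧ ∃ θ t t' : ℝ, D = line θ t ∧ D' = line θ t'

/-- `S` contains two parallel nondegenerate segments, lying on distinct lines. -/
def HasParallelSegments (S : Set Plane) : Prop :=
  ∃ a b c d : Plane, a ≠ b ∧ c ≠ d ∧ segment ℝ a b ⊆ S ∧ segment ℝ c d ⊆ S ∧
    ∃ D D' : Set Plane, AreDistinctParallel D D' ∧ a ∈ D ∧ b ∈ D ∧ c ∈ D' ∧ d ∈ D'

/-- `K` is centrally symmetric about some point. -/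
def IsCentrallySymmetric (K : Set Plane) : Prop :=
  ∃ p : Plane, ∀ x ∈ K, Equiv.pointReflection p x ∈ K

end AlphaSec

end

open AlphaSec

namespace AlphaSec

open Filter Real Asymptotics

variable {K : Set Plane}

/-! ### The moving frame -/

/-! In the frame `(dir θ, nrm θ)` the chord at height `t` ends at abscissa `hi K θ t`, a concave
function of `t` with one-sided derivatives `slopeR ≤ slopeL`. Reversing the orientation turns first
endpoints into last ones, so `lo` needs no theory of its own. Differentiating the area under a
moving line shows that the offset of the `α`-section varies at minus the abscissa of the chord's
midpoint (`IsPlanarBody.hasDerivAt_secOffset`). Hence the midpoint moves along the chord, and its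
right (left) velocity is a positive multiple of the difference of the right (left) slopes at the two
endpoints `c` and `b` (`velocityR`, `velocityL`).

Two facts then do most of the work. By concavity, when `α` grows the slope at `c` decreases and the
slope at `b` increases, so a negative velocity persists for larger `α`. By symmetry, `(α, θ)` and
`(1 - α, θ + π)` give the same chord reversed, with opposite velocities. So `I_B` is upward closed
and `I_F` is its mirror image. `I_B` omits its infimum because nonnegative velocities amount to
monotone components of the midpoint, a condition stable under limits in `α`. When `α` lies in
neither set, the envelope is a single point; comparing `θ` with `θ + π` then forces `α = 1/2`, and a
point that bisects every chord through it is a centre of symmetry.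

For `I_Z`, a Darboux property and connectedness show that outside `I_Z` the velocities are all
positive or all negative (`IsPlanarBody.notMem_setIZ_iff`). Being all positive (`IsForward`) passes
to smaller `α` and fails for `α ≥ 1/2`, so `I_Z` is an interval symmetric about `1/2`. If `α_Z <
α_B`, the slopes at two areas in between squeeze to one value, and both endpoints trace parallel
segments.

The cases `α_Z = 0` and `α_B = 0` come from limits. A nonpositive velocity puts the part of `K`
beyond the chord in a strip based on it; as `α → 0` compactness produces a boundary segment and a
strip containing `K` (`IsPlanarBody.exists_limit_strip`). Conversely, chords parallel to the base of
such a strip cannot grow (`IsPlanarBody.slopeL_le_of_base`). When the boundary is `C¹`, uniqueness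
of tangents excludes `α_Z = 0`, and a limit of zero velocities is again a zero velocity. -/

lemma inner_plane (x y : Plane) : inner ℝ x y = x 0 * y 0 + x 1 * y 1 := by
  simp [PiLp.inner_apply, Fin.sum_univ_two, mul_comm]

@[simp] lemma dir_zero_apply (θ : ℝ) : dir θ 0 = cos θ := rfl
@[simp] lemma dir_one_apply (θ : ℝ) : dir θ 1 = sin θ := rfl
@[simp] lemma nrm_zero_apply (θ : ℝ) : nrm θ 0 = -sin θ := rfl
@[simp] lemma nrm_one_apply (θ : ℝ) : nrm θ 1 = cos θ := rfl

lemma plane_ext {x y : Plane} (h0 : x 0 = y 0) (h1 : x 1 = y 1) : x = y := by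
  ext i; fin_cases i <;> assumption

lemma dir_add (θ τ : ℝ) : dir (θ + τ) = cos τ • dir θ + sin τ • nrm θ := by
  apply plane_ext <;> simp [cos_add, sin_add] <;> ring

lemma nrm_add (θ τ : ℝ) : nrm (θ + τ) = -sin τ • dir θ + cos τ • nrm θ := by
  apply plane_ext <;> simp [cos_add, sin_add] <;> ring

@[simp] lemma dir_add_pi (θ : ℝ) : dir (θ + π) = -dir θ := by simp [dir_add]
@[simp] lemma nrm_add_pi (θ : ℝ) : nrm (θ + π) = -nrm θ := by simp [nrm_add]

lemma inner_dir_dir (θ : ℝ) : inner ℝ (dir θ) (dir θ) = 1 := by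
  rw [inner_plane]; simp; nlinarith [sin_sq_add_cos_sq θ]
lemma inner_nrm_nrm (θ : ℝ) : inner ℝ (nrm θ) (nrm θ) = 1 := by
  rw [inner_plane]; simp; nlinarith [sin_sq_add_cos_sq θ]
@[simp] lemma inner_dir_nrm (θ : ℝ) : inner ℝ (dir θ) (nrm θ) = 0 := by
  rw [inner_plane]; simp; ring
@[simp] lemma inner_nrm_dir (θ : ℝ) : inner ℝ (nrm θ) (dir θ) = 0 := by
  rw [inner_plane]; simp; ring

@[simp] lemma norm_dir (θ : ℝ) : ‖dir θ‖ = 1 := by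
  rw [← sq_eq_sq₀ (norm_nonneg _) zero_le_one, ← real_inner_self_eq_norm_sq, inner_dir_dir]
  norm_num
@[simp] lemma norm_nrm (θ : ℝ) : ‖nrm θ‖ = 1 := by
  rw [← sq_eq_sq₀ (norm_nonneg _) zero_le_one, ← real_inner_self_eq_norm_sq, inner_nrm_nrm]
  norm_num

lemma inner_frame_dir (θ s t : ℝ) : inner ℝ (s • dir θ + t • nrm θ) (dir θ) = s := by
  simp [inner_add_left, inner_smul_left]

lemma inner_frame_nrm (θ s t : ℝ) : inner ℝ (s • dir θ + t • nrm θ) (nrm θ) = t := by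
  simp [inner_add_left, inner_smul_left]

lemma frame_expand (θ : ℝ) (x : Plane) :
    x = inner ℝ x (dir θ) • dir θ + inner ℝ x (nrm θ) • nrm θ := by
  have := sin_sq_add_cos_sq θ
  apply plane_ext <;> simp [inner_plane]
  · linear_combination (-x 0) * this
  · linear_combination (-x 1) * this

lemma frame_ext (θ : ℝ) {x y : Plane} (h : inner ℝ x (dir θ) = inner ℝ y (dir θ))
    (h' : inner ℝ x (nrm θ) = inner ℝ y (nrm θ)) : x = y := by
  rw [frame_expand θ x, frame_expand θ y, h, h']

lemma inner_frame (θ : ℝ) (x y : Plane) :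
    inner ℝ x y = inner ℝ x (dir θ) * inner ℝ y (dir θ) + inner ℝ x (nrm θ) * inner ℝ y (nrm θ) := by
  have := sin_sq_add_cos_sq θ
  simp only [inner_plane, dir_zero_apply, dir_one_apply, nrm_zero_apply, nrm_one_apply]
  linear_combination (-(x 0 * y 0) - x 1 * y 1) * this

@[fun_prop] lemma continuous_dir : Continuous dir := by
  have : dir = fun θ => WithLp.toLp 2 ![cos θ, sin θ] := rfl
  rw [this]
  apply (PiLp.continuous_toLp 2 _).comp
  refine continuous_pi fun i => ?_
  fin_cases i <;> simp <;> fun_prop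

lemma nrm_eq_dir (θ : ℝ) : nrm θ = dir (θ + π / 2) := by
  apply plane_ext <;> simp [cos_add, sin_add]

@[fun_prop] lemma continuous_nrm : Continuous nrm := by
  have : nrm = fun θ => dir (θ + π / 2) := funext nrm_eq_dir
  rw [this]; fun_prop

lemma dir_add_two_pi_mul (θ : ℝ) (k : ℤ) : dir (θ + k * (2 * π)) = dir θ := by
  apply plane_ext <;> simp
lemma nrm_add_two_pi_mul (θ : ℝ) (k : ℤ) : nrm (θ + k * (2 * π)) = nrm θ := by
  apply plane_ext <;> simp

lemma exists_eq_smul_dir (v : Plane) : ∃ θ, v = ‖v‖ • dir θ := by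
  refine ⟨Complex.arg ⟨v 0, v 1⟩, ?_⟩
  have hn : ‖v‖ = ‖(⟨v 0, v 1⟩ : ℂ)‖ := by
    rw [EuclideanSpace.norm_eq, Complex.norm_def, Complex.normSq_apply]
    simp [Fin.sum_univ_two, sq]
  rw [hn]
  apply plane_ext
  · simp
  · simp

lemma exists_eq_smul_nrm (v : Plane) : ∃ θ, v = ‖v‖ • nrm θ := by
  obtain ⟨θ, h⟩ := exists_eq_smul_dir v
  refine ⟨θ - π / 2, ?_⟩
  rw [nrm_eq_dir, sub_add_cancel]; exact h

/-- The orthonormal basis `(dir θ, nrm θ)` of the plane. -/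
noncomputable def frameBasis (θ : ℝ) : OrthonormalBasis (Fin 2) ℝ Plane :=
  OrthonormalBasis.mk (v := ![dir θ, nrm θ])
    (by
      rw [orthonormal_iff_ite]
      intro i j
      fin_cases i <;> fin_cases j <;> simp)
    (by
      intro x _
      rw [frame_expand θ x]
      refine Submodule.add_mem _ (Submodule.smul_mem _ _ (Submodule.subset_span ⟨0, by simp⟩))
        (Submodule.smul_mem _ _ (Submodule.subset_span ⟨1, by simp⟩)))

/-- Coordinates in the frame `(dir θ, nrm θ)`. -/
noncomputable def frameMap (θ : ℝ) (p : ℝ × ℝ) : Plane := p.1 • dir θ + p.2 • nrm θ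

@[fun_prop] lemma continuous_frameMap (θ : ℝ) : Continuous (frameMap θ) := by
  unfold frameMap; fun_prop

lemma measurePreserving_frameMap (θ : ℝ) : MeasurePreserving (frameMap θ) volume volume := by
  have h1 := (volume_preserving_finTwoArrow ℝ).symm
  have h2 := (EuclideanSpace.volume_preserving_symm_measurableEquiv_toLp (Fin 2)).symm
  have h3 := (frameBasis θ).measurePreserving_repr_symm
  have h := h3.comp (h2.comp h1)
  convert! h using 1
  ext1 p
  simp only [Function.comp, frameMap]
  rw [← OrthonormalBasis.sum_repr_symm]
  simp [frameBasis, Fin.sum_univ_two]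

/-! ### Chords -/

/-- The abscissae of the points of `K` on the line `(θ, t)`. -/
def lineParams (K : Set Plane) (θ t : ℝ) : Set ℝ := {s | s • dir θ + t • nrm θ ∈ K}

/-- The abscissa of the last point of `K` on the line `(θ, t)`. -/
noncomputable def hi (K : Set Plane) (θ t : ℝ) : ℝ := sSup (lineParams K θ t)

/-- The abscissa of the first point of `K` on the line `(θ, t)`. -/
noncomputable def lo (K : Set Plane) (θ t : ℝ) : ℝ := -hi K (θ + π) (-t)

/-- The line `(θ, t)` meets the interior of `K`. -/
def Crosses (K : Set Plane) (θ t : ℝ) : Prop := ∃ x ∈ interior K, inner ℝ x (nrm θ) = t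

/-- The projection of `K` on the direction orthogonal to `dir θ`. -/
def shadow (K : Set Plane) (θ : ℝ) : Set ℝ := (fun x => inner ℝ x (nrm θ)) '' K

/-- A half-turn reverses the chord. Through this identity every fact about `hi` yields one about
`lo`. -/
lemma lineParams_add_pi (K : Set Plane) (θ t : ℝ) :
    lineParams K (θ + π) (-t) = -lineParams K θ t := by
  ext s; simp [lineParams]

lemma lo_eq_sInf (K : Set Plane) (θ t : ℝ) : lo K θ t = sInf (lineParams K θ t) := by
  rw [lo, hi, lineParams_add_pi, Real.sInf_def]

lemma hi_add_two_pi_mul (K : Set Plane) (θ t : ℝ) (k : ℤ) :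
    hi K (θ + k * (2 * π)) t = hi K θ t := by
  simp [hi, lineParams, dir_add_two_pi_mul, nrm_add_two_pi_mul]

lemma hi_add_pi_add_pi (K : Set Plane) (θ t : ℝ) : hi K (θ + π + π) t = hi K θ t := by
  simp [hi, lineParams]

lemma hi_eq_neg_lo (K : Set Plane) (θ t : ℝ) : hi K θ t = -lo K (θ + π) (-t) := by
  rw [lo, hi_add_pi_add_pi]; simp

lemma hi_add_pi (K : Set Plane) (θ t : ℝ) : hi K (θ + π) (-t) = -lo K θ t := by simp [lo]

lemma mem_lineParams_of_mem (θ : ℝ) {x : Plane} (hx : x ∈ K) :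
    inner ℝ x (dir θ) ∈ lineParams K θ (inner ℝ x (nrm θ)) := by
  rw [lineParams, mem_ofPred_eq, ← frame_expand]; exact hx

lemma IsPlanarBody.isCompact_lineParams (hK : IsPlanarBody K) (θ t : ℝ) :
    IsCompact (lineParams K θ t) := by
  have : IsCompact ((fun x => inner ℝ x (dir θ)) '' (K ∩ {x | inner ℝ x (nrm θ) = t})) := by
    apply IsCompact.image
    · exact hK.isCompact.inter_right (isClosed_eq (by fun_prop) continuous_const)
    · fun_prop
  convert! this using 1
  ext s
  constructor
  · intro hs
    exact ⟨_, ⟨hs, inner_frame_nrm θ s t⟩, inner_frame_dir θ s t⟩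
  · rintro ⟨x, ⟨hx, rfl⟩, rfl⟩
    exact mem_lineParams_of_mem θ hx

lemma IsPlanarBody.ordConnected_lineParams (hK : IsPlanarBody K) (θ t : ℝ) :
    OrdConnected (lineParams K θ t) := by
  rw [← convex_iff_ordConnected]
  intro x hx y hy a b ha hb hab
  have := hK.convex hx hy ha hb hab
  rw [lineParams, mem_ofPred_eq]
  convert! this using 1
  have : b = 1 - a := by linarith
  subst this
  simp only [smul_eq_mul]
  module

lemma IsPlanarBody.le_hi (hK : IsPlanarBody K) {θ t s : ℝ} (hs : s • dir θ + t • nrm θ ∈ K) :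
    s ≤ hi K θ t := le_csSup (hK.isCompact_lineParams θ t).bddAbove hs

lemma IsPlanarBody.lo_le (hK : IsPlanarBody K) {θ t s : ℝ} (hs : s • dir θ + t • nrm θ ∈ K) :
    lo K θ t ≤ s := by
  rw [lo_eq_sInf]; exact csInf_le (hK.isCompact_lineParams θ t).bddBelow hs

lemma IsPlanarBody.inner_le_hi (hK : IsPlanarBody K) (θ : ℝ) {x : Plane} (hx : x ∈ K) :
    inner ℝ x (dir θ) ≤ hi K θ (inner ℝ x (nrm θ)) :=
  hK.le_hi (mem_lineParams_of_mem θ hx)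

lemma lineParams_nonempty {θ t : ℝ} (ht : t ∈ shadow K θ) : (lineParams K θ t).Nonempty := by
  obtain ⟨x, hx, rfl⟩ := ht
  exact ⟨_, mem_lineParams_of_mem θ hx⟩

lemma IsPlanarBody.hi_mem (hK : IsPlanarBody K) {θ t : ℝ} (ht : t ∈ shadow K θ) :
    hi K θ t • dir θ + t • nrm θ ∈ K :=
  (hK.isCompact_lineParams θ t).sSup_mem (lineParams_nonempty ht)

lemma IsPlanarBody.lo_mem (hK : IsPlanarBody K) {θ t : ℝ} (ht : t ∈ shadow K θ) :
    lo K θ t • dir θ + t • nrm θ ∈ K := by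
  rw [lo_eq_sInf]
  exact (hK.isCompact_lineParams θ t).sInf_mem (lineParams_nonempty ht)

lemma IsPlanarBody.mem_of_lo_le_of_le_hi (hK : IsPlanarBody K) {θ t s : ℝ} (ht : t ∈ shadow K θ)
    (h1 : lo K θ t ≤ s) (h2 : s ≤ hi K θ t) : s • dir θ + t • nrm θ ∈ K :=
  (hK.ordConnected_lineParams θ t).out (hK.lo_mem ht) (hK.hi_mem ht) ⟨h1, h2⟩

lemma Crosses.mem_shadow {θ t : ℝ} (h : Crosses K θ t) : t ∈ shadow K θ := by
  obtain ⟨x, hx, rfl⟩ := h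
  exact ⟨x, interior_subset hx, rfl⟩

lemma Crosses.add_pi {θ t : ℝ} (h : Crosses K θ t) : Crosses K (θ + π) (-t) := by
  obtain ⟨x, hx, rfl⟩ := h
  exact ⟨x, hx, by simp [inner_neg_right]⟩

lemma exists_add_smul_mem_interior {x : Plane} (hx : x ∈ interior K) (v : Plane) :
    ∃ ε > (0 : ℝ), ∀ r : ℝ, |r| ≤ ε → x + r • v ∈ interior K := by
  have hc : ContinuousAt (fun r : ℝ => x + r • v) 0 := by fun_prop
  have : ∀ᶠ r : ℝ in 𝓝 0, x + r • v ∈ interior K :=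
    hc.eventually (isOpen_interior.mem_nhds (by simpa using hx))
  obtain ⟨ε, hε, h⟩ := Metric.eventually_nhds_iff.1 this
  refine ⟨ε / 2, by positivity, fun r hr => h ?_⟩
  rw [Real.dist_0_eq_abs]; linarith

lemma IsPlanarBody.inner_lt_hi (hK : IsPlanarBody K) (θ : ℝ) {x : Plane} (hx : x ∈ interior K) :
    inner ℝ x (dir θ) < hi K θ (inner ℝ x (nrm θ)) := by
  obtain ⟨ε, hε, h⟩ := exists_add_smul_mem_interior hx (dir θ)
  have := hK.inner_le_hi θ (interior_subset (h ε (abs_of_pos hε).le))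
  simp [inner_add_left, inner_smul_left] at this
  linarith

lemma IsPlanarBody.lo_lt_inner (hK : IsPlanarBody K) (θ : ℝ) {x : Plane} (hx : x ∈ interior K) :
    lo K θ (inner ℝ x (nrm θ)) < inner ℝ x (dir θ) := by
  have := hK.inner_lt_hi (θ + π) hx
  simp only [dir_add_pi, nrm_add_pi, inner_neg_right] at this
  rw [lo]; linarith

lemma IsPlanarBody.lo_lt_hi (hK : IsPlanarBody K) {θ t : ℝ} (h : Crosses K θ t) :
    lo K θ t < hi K θ t := by
  obtain ⟨x, hx, rfl⟩ := h
  exact (hK.lo_lt_inner θ hx).trans (hK.inner_lt_hi θ hx)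

lemma IsPlanarBody.hi_notMem_interior (hK : IsPlanarBody K) (θ t : ℝ) :
    hi K θ t • dir θ + t • nrm θ ∉ interior K := fun h => by
  have := hK.inner_lt_hi θ h
  rw [inner_frame_dir, inner_frame_nrm] at this
  exact lt_irrefl _ this

lemma IsPlanarBody.mem_interior_of_lt (hK : IsPlanarBody K) {θ t s : ℝ} (h : Crosses K θ t)
    (h1 : lo K θ t < s) (h2 : s < hi K θ t) : s • dir θ + t • nrm θ ∈ interior K := by
  obtain ⟨x, hx, rfl⟩ := h
  have hs : inner ℝ x (nrm θ) ∈ shadow K θ := ⟨x, interior_subset hx, rfl⟩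
  set t := inner ℝ x (nrm θ)
  -- A point strictly inside the chord combines the interior point `x`, with positive weight, and
  -- the endpoint `r` on its side.
  have key : ∀ r : ℝ, r • dir θ + t • nrm θ ∈ K → (∃ a b : ℝ, 0 < a ∧ 0 ≤ b ∧ a + b = 1 ∧
      s = a * inner ℝ x (dir θ) + b * r) → s • dir θ + t • nrm θ ∈ interior K := by
    rintro r hr ⟨a, b, ha, hb, hab, rfl⟩
    have := hK.convex.combo_interior_self_mem_interior hx hr ha hb hab
    convert! this using 1
    conv_rhs => rw [frame_expand θ x]
    have : b = 1 - a := by linarith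
    subst this
    simp only [t]
    module
  rcases le_total s (inner ℝ x (dir θ)) with hle | hle
  · have hl := hK.lo_lt_inner θ hx
    refine key _ (hK.lo_mem hs) ⟨(s - lo K θ t) / (inner ℝ x (dir θ) - lo K θ t),
      (inner ℝ x (dir θ) - s) / (inner ℝ x (dir θ) - lo K θ t), ?_, ?_, ?_, ?_⟩
    · apply div_pos <;> linarith
    · apply div_nonneg <;> linarith
    · rw [← add_div, div_eq_one_iff_eq (by linarith)]; ring
    · have : inner ℝ x (dir θ) - lo K θ t ≠ 0 := by linarith
      field_simp; ring
  · have hl := hK.inner_lt_hi θ hx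
    refine key _ (hK.hi_mem hs) ⟨(hi K θ t - s) / (hi K θ t - inner ℝ x (dir θ)),
      (s - inner ℝ x (dir θ)) / (hi K θ t - inner ℝ x (dir θ)), ?_, ?_, ?_, ?_⟩
    · apply div_pos <;> linarith
    · apply div_nonneg <;> linarith
    · rw [← add_div, div_eq_one_iff_eq (by linarith)]; ring
    · have : hi K θ t - inner ℝ x (dir θ) ≠ 0 := by linarith
      field_simp; ring

lemma isOpen_crosses (K : Set Plane) : IsOpen {p : ℝ × ℝ | Crosses K p.1 p.2} := by
  rw [isOpen_iff_mem_nhds]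
  rintro ⟨θ, t⟩ ⟨x, hx, hxt⟩
  obtain rfl : inner ℝ x (nrm θ) = t := hxt
  have hc : ContinuousAt (fun p : ℝ × ℝ => inner ℝ x (dir θ) • dir p.1 + p.2 • nrm p.1)
      (θ, inner ℝ x (nrm θ)) := by fun_prop
  have : ∀ᶠ p : ℝ × ℝ in 𝓝 (θ, inner ℝ x (nrm θ)),
      inner ℝ x (dir θ) • dir p.1 + p.2 • nrm p.1 ∈ interior K :=
    hc.eventually (isOpen_interior.mem_nhds (by
      simp only
      rw [← frame_expand]; exact hx))
  filter_upwards [this] with p hp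
  exact ⟨_, hp, inner_frame_nrm _ _ _⟩

lemma Crosses.mem_interior_shadow {θ t : ℝ} (h : Crosses K θ t) : t ∈ interior (shadow K θ) := by
  rw [mem_interior_iff_mem_nhds]
  have hc : ContinuousAt (fun r : ℝ => (θ, r)) t := by fun_prop
  filter_upwards [hc.eventually ((isOpen_crosses K).mem_nhds h)] with r hr
  exact Crosses.mem_shadow hr

lemma IsPlanarBody.closure_interior (hK : IsPlanarBody K) : closure (interior K) = K := by
  rw [hK.convex.closure_interior_eq_closure_of_nonempty_interior hK.nonempty_interior,
    hK.isCompact.isClosed.closure_eq]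

lemma IsPlanarBody.exists_mem_interior_of_mem (hK : IsPlanarBody K) {U : Set Plane} (hU : IsOpen U)
    {x : Plane} (hx : x ∈ K) (hxU : x ∈ U) : ∃ y ∈ interior K, y ∈ U := by
  rw [← hK.closure_interior] at hx
  obtain ⟨y, hyU, hy⟩ := mem_closure_iff.1 hx U hU hxU
  exact ⟨y, hy, hyU⟩

lemma IsPlanarBody.crosses_of_lt_of_lt (hK : IsPlanarBody K) {θ t : ℝ} {x y : Plane} (hx : x ∈ K)
    (hy : y ∈ K) (hxt : inner ℝ x (nrm θ) < t) (hyt : t < inner ℝ y (nrm θ)) : Crosses K θ t := by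
  obtain ⟨x', hx', hxt'⟩ := hK.exists_mem_interior_of_mem
    (U := {x | inner ℝ x (nrm θ) < t}) (isOpen_lt (by fun_prop) continuous_const) hx hxt
  obtain ⟨y', hy', hyt'⟩ := hK.exists_mem_interior_of_mem
    (U := {x | t < inner ℝ x (nrm θ)}) (isOpen_lt continuous_const (by fun_prop)) hy hyt
  have hconv : Convex ℝ ((fun x : Plane => inner ℝ x (nrm θ)) '' interior K) := by
    have h := hK.convex.interior
    have := h.is_linear_image (f := fun x : Plane => inner ℝ x (nrm θ))
      ⟨fun a b => inner_add_left _ _ _, fun c a => by simp [inner_smul_left]⟩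
    exact this
  have := hconv.ordConnected.out ⟨x', hx', rfl⟩ ⟨y', hy', rfl⟩ ⟨le_of_lt hxt', le_of_lt hyt'⟩
  obtain ⟨z, hz, h⟩ := this
  exact ⟨z, hz, h⟩

lemma IsPlanarBody.concaveOn_hi (hK : IsPlanarBody K) (θ : ℝ) :
    ConcaveOn ℝ (shadow K θ) (hi K θ) := by
  refine ⟨hK.convex.is_linear_image (f := fun x : Plane => inner ℝ x (nrm θ))
      ⟨fun a b => inner_add_left _ _ _, fun c a => by simp [inner_smul_left]⟩, ?_⟩
  intro t ht t' ht' a b ha hb hab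
  apply hK.le_hi
  have := hK.convex (hK.hi_mem ht) (hK.hi_mem ht') ha hb hab
  convert! this using 1
  simp only [smul_eq_mul]
  module

/-- Interior points of the chord stay in `K` for nearby lines, which gives the lower bound. A point
just beyond the endpoint stays outside the closed set `K`, and a convex chord that still contains an
inner point cannot jump over it, which gives the upper bound. -/
lemma IsPlanarBody.continuousAt_hi (hK : IsPlanarBody K) {θ t : ℝ} (h : Crosses K θ t) :
    ContinuousAt (fun p : ℝ × ℝ => hi K p.1 p.2) (θ, t) := by
  have hlt := hK.lo_lt_hi h
  have hin : ∀ s, lo K θ t < s → s < hi K θ t →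
      ∀ᶠ p : ℝ × ℝ in 𝓝 (θ, t), s • dir p.1 + p.2 • nrm p.1 ∈ K := by
    intro s h1 h2
    have hc : ContinuousAt (fun p : ℝ × ℝ => s • dir p.1 + p.2 • nrm p.1) (θ, t) := by fun_prop
    filter_upwards [hc.eventually (isOpen_interior.mem_nhds (hK.mem_interior_of_lt h h1 h2))]
      with p hp using interior_subset hp
  apply tendsto_order.2 ⟨fun s hs => ?_, fun s hs => ?_⟩
  · obtain ⟨r, hr, hr'⟩ := exists_between (max_lt hs hlt)
    filter_upwards [hin r ((le_max_right _ _).trans_lt hr) hr'] with p hp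
    exact ((le_max_left _ _).trans_lt hr).trans_le (hK.le_hi hp)
  · obtain ⟨r, hr, hr'⟩ := exists_between hlt
    obtain ⟨q, hq, hq'⟩ := exists_between hs
    have hc : ContinuousAt (fun p : ℝ × ℝ => q • dir p.1 + p.2 • nrm p.1) (θ, t) := by fun_prop
    have hqK : q • dir θ + t • nrm θ ∈ Kᶜ := fun hmem => (hK.le_hi hmem).not_gt hq
    filter_upwards [hin r hr hr', hc.eventually (hK.isCompact.isClosed.isOpen_compl.mem_nhds hqK)]
      with p hp hp'
    refine lt_of_le_of_lt ?_ hq'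
    refine csSup_le ⟨r, hp⟩ fun x hx => ?_
    by_contra! hlt
    exact hp' ((hK.ordConnected_lineParams _ _).out hp hx ⟨(hr'.trans hq).le, hlt.le⟩)

lemma IsPlanarBody.continuousAt_lo (hK : IsPlanarBody K) {θ t : ℝ} (h : Crosses K θ t) :
    ContinuousAt (fun p : ℝ × ℝ => lo K p.1 p.2) (θ, t) := by
  have h1 := hK.continuousAt_hi h.add_pi
  have h2 : ContinuousAt (fun p : ℝ × ℝ => (p.1 + π, -p.2)) (θ, t) := by fun_prop
  exact (ContinuousAt.comp (f := fun p : ℝ × ℝ => (p.1 + π, -p.2)) (x := (θ, t)) h1 h2).neg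

/-! ### Slopes at the last endpoint of a chord -/

/-- The right slope at the last endpoint of the chord of `K` on the line `(θ, t)`. -/
noncomputable def slopeR (K : Set Plane) (θ t : ℝ) : ℝ := derivWithin (hi K θ) (Ioi t) t

/-- The left slope at the last endpoint of the chord of `K` on the line `(θ, t)`. -/
noncomputable def slopeL (K : Set Plane) (θ t : ℝ) : ℝ := derivWithin (hi K θ) (Iio t) t

lemma IsPlanarBody.hasDerivWithinAt_slopeR (hK : IsPlanarBody K) {θ t : ℝ} (h : Crosses K θ t) :
    HasDerivWithinAt (hi K θ) (slopeR K θ t) (Ioi t) t := by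
  have := ((hK.concaveOn_hi θ).neg.hasDerivWithinAt_rightDeriv_of_mem_interior
    h.mem_interior_shadow).neg
  rw [neg_neg] at this
  exact this.differentiableWithinAt.hasDerivWithinAt

lemma IsPlanarBody.hasDerivWithinAt_slopeL (hK : IsPlanarBody K) {θ t : ℝ} (h : Crosses K θ t) :
    HasDerivWithinAt (hi K θ) (slopeL K θ t) (Iio t) t := by
  have := ((hK.concaveOn_hi θ).neg.hasDerivWithinAt_leftDeriv_of_mem_interior
    h.mem_interior_shadow).neg
  rw [neg_neg] at this
  exact this.differentiableWithinAt.hasDerivWithinAt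

lemma slopeR_eq_neg (K : Set Plane) (θ t : ℝ) :
    slopeR K θ t = -derivWithin (-hi K θ) (Ioi t) t := by
  rw [derivWithin.neg, neg_neg]; rfl

lemma slopeL_eq_neg (K : Set Plane) (θ t : ℝ) :
    slopeL K θ t = -derivWithin (-hi K θ) (Iio t) t := by
  rw [derivWithin.neg, neg_neg]; rfl

lemma IsPlanarBody.slopeR_le_slopeL (hK : IsPlanarBody K) {θ t : ℝ} (h : Crosses K θ t) :
    slopeR K θ t ≤ slopeL K θ t := by
  rw [slopeR_eq_neg, slopeL_eq_neg]
  exact neg_le_neg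
    ((hK.concaveOn_hi θ).neg.leftDeriv_le_rightDeriv_of_mem_interior h.mem_interior_shadow)

/-- A concave graph lies below its tangents. The slack in `k` makes the bound available for every
supporting slope, not only the extreme one. -/
lemma IsPlanarBody.hi_le_of_slopeR_le (hK : IsPlanarBody K) {θ t t' k : ℝ} (h : Crosses K θ t)
    (ht' : t' ∈ shadow K θ) (hle : t ≤ t') (hk : slopeR K θ t ≤ k) :
    hi K θ t' ≤ hi K θ t + k * (t' - t) := by
  rcases hle.eq_or_lt with rfl | hlt
  · simp
  have := (hK.concaveOn_hi θ).slope_le_of_hasDerivWithinAt_Ioi h.mem_shadow ht' hlt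
    (hK.hasDerivWithinAt_slopeR h)
  rw [slope_def_field, div_le_iff₀ (by linarith)] at this
  nlinarith

lemma IsPlanarBody.hi_le_of_le_slopeL (hK : IsPlanarBody K) {θ t t' k : ℝ} (h : Crosses K θ t)
    (ht' : t' ∈ shadow K θ) (hle : t' ≤ t) (hk : k ≤ slopeL K θ t) :
    hi K θ t' ≤ hi K θ t + k * (t' - t) := by
  rcases hle.eq_or_lt with rfl | hlt
  · simp
  have := (hK.concaveOn_hi θ).le_slope_of_hasDerivWithinAt_Iio ht' h.mem_shadow hlt
    (hK.hasDerivWithinAt_slopeL h)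
  rw [slope_def_field, le_div_iff₀ (by linarith)] at this
  nlinarith

/-- Points of `K` on the left of a chord lie below the right tangent at its last endpoint. -/
lemma IsPlanarBody.inner_le_of_slopeR_le (hK : IsPlanarBody K) {θ t k : ℝ} (h : Crosses K θ t)
    (hk : slopeR K θ t ≤ k) {x : Plane} (hx : x ∈ K) (hxt : t ≤ inner ℝ x (nrm θ)) :
    inner ℝ x (dir θ) ≤ hi K θ t + k * (inner ℝ x (nrm θ) - t) :=
  (hK.inner_le_hi θ hx).trans (hK.hi_le_of_slopeR_le h ⟨x, hx, rfl⟩ hxt hk)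

lemma IsPlanarBody.inner_le_of_le_slopeL (hK : IsPlanarBody K) {θ t k : ℝ} (h : Crosses K θ t)
    (hk : k ≤ slopeL K θ t) {x : Plane} (hx : x ∈ K) (hxt : inner ℝ x (nrm θ) ≤ t) :
    inner ℝ x (dir θ) ≤ hi K θ t + k * (inner ℝ x (nrm θ) - t) :=
  (hK.inner_le_hi θ hx).trans (hK.hi_le_of_le_slopeL h ⟨x, hx, rfl⟩ hxt hk)

/-- Each of the two points of the graph lies below the tangent at the other; adding the two bounds
compares the slopes. -/
lemma IsPlanarBody.slopeL_le_slopeR (hK : IsPlanarBody K) {θ t t' : ℝ} (h : Crosses K θ t)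
    (h' : Crosses K θ t') (hlt : t < t') : slopeL K θ t' ≤ slopeR K θ t := by
  have h1 := hK.hi_le_of_slopeR_le h h'.mem_shadow hlt.le le_rfl
  have h2 := hK.hi_le_of_le_slopeL h' h.mem_shadow hlt.le le_rfl
  nlinarith

/-- Points of `K` on the left of a chord lie above the right tangent at its first endpoint. -/
lemma IsPlanarBody.le_inner_of_le_slopeL_add_pi (hK : IsPlanarBody K) {θ t k : ℝ}
    (h : Crosses K θ t) (hk : k ≤ slopeL K (θ + π) (-t)) {x : Plane} (hx : x ∈ K)
    (hxt : t ≤ inner ℝ x (nrm θ)) :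
    lo K θ t + k * (inner ℝ x (nrm θ) - t) ≤ inner ℝ x (dir θ) := by
  have := hK.inner_le_of_le_slopeL h.add_pi hk hx (by simp [inner_neg_right, hxt])
  simp only [dir_add_pi, nrm_add_pi, inner_neg_right, hi_add_pi] at this
  linarith

lemma IsPlanarBody.le_inner_of_slopeR_add_pi_le (hK : IsPlanarBody K) {θ t k : ℝ}
    (h : Crosses K θ t) (hk : slopeR K (θ + π) (-t) ≤ k) {x : Plane} (hx : x ∈ K)
    (hxt : inner ℝ x (nrm θ) ≤ t) :
    lo K θ t + k * (inner ℝ x (nrm θ) - t) ≤ inner ℝ x (dir θ) := by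
  have := hK.inner_le_of_slopeR_le h.add_pi hk hx (by simp [inner_neg_right, hxt])
  simp only [dir_add_pi, nrm_add_pi, inner_neg_right, hi_add_pi] at this
  linarith

/-! ### Areas and sections -/

/-- The area of the part of `K` on the right of the line `(θ, t)`. -/
noncomputable def area (K : Set Plane) (θ t : ℝ) : ℝ := volume.real (K ∩ rightHalf θ t)

lemma isClosed_rightHalf (θ t : ℝ) : IsClosed (rightHalf θ t) :=
  isClosed_le (by fun_prop) continuous_const

lemma IsPlanarBody.measurableSet (hK : IsPlanarBody K) : MeasurableSet K :=
  hK.isCompact.isClosed.measurableSet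

lemma IsPlanarBody.volume_ne_top (hK : IsPlanarBody K) : volume K ≠ ⊤ :=
  hK.isCompact.measure_lt_top.ne

lemma IsPlanarBody.volume_inter_ne_top (hK : IsPlanarBody K) (S : Set Plane) :
    volume (K ∩ S) ≠ ⊤ := measure_ne_top_of_subset inter_subset_left hK.volume_ne_top

lemma IsPlanarBody.volume_pos (hK : IsPlanarBody K) : 0 < volume.real K := by
  refine ENNReal.toReal_pos ?_ hK.volume_ne_top
  exact (Measure.measure_pos_of_nonempty_interior _ hK.nonempty_interior).ne'

lemma volume_line (θ t : ℝ) : volume (line θ t) = 0 := by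
  have hm : MeasurableSet (line θ t) :=
    (isClosed_eq (by fun_prop) continuous_const : IsClosed (line θ t)).measurableSet
  rw [← (measurePreserving_frameMap θ).measure_preimage hm.nullMeasurableSet]
  have : frameMap θ ⁻¹' line θ t = univ ×ˢ {t} := by
    ext p
    simp only [mem_preimage, line, mem_ofPred_eq, frameMap, mem_prod, mem_univ, mem_singleton_iff,
      true_and, inner_frame_nrm]
  rw [this, Measure.volume_eq_prod, Measure.prod_prod]
  simp

/-- The indicator of the moving half-plane converges off the limit line, which is null, and `K` has
finite measure. -/
lemma IsPlanarBody.continuous_area (hK : IsPlanarBody K) :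
    Continuous (fun p : ℝ × ℝ => area K p.1 p.2) := by
  rw [continuous_iff_continuousAt]
  rintro ⟨θ, t⟩
  refine (ENNReal.tendsto_toReal (hK.volume_inter_ne_top _)).comp ?_
  refine tendsto_measure_of_ae_tendsto_indicator (𝓝 (θ, t)) (B := K) ?_ ?_ hK.measurableSet
    hK.volume_ne_top (Eventually.of_forall fun p => inter_subset_left) ?_
  · exact hK.measurableSet.inter (isClosed_rightHalf _ _).measurableSet
  · exact fun p => hK.measurableSet.inter (isClosed_rightHalf _ _).measurableSet
  · have h0 : ∀ᵐ x : Plane, x ∉ line θ t := by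
      rw [ae_iff]; simpa using volume_line θ t
    filter_upwards [h0] with x hx
    have hc : Continuous (fun p : ℝ × ℝ => inner ℝ x (nrm p.1)) := by fun_prop
    rcases lt_or_gt_of_ne (hx : inner ℝ x (nrm θ) ≠ t) with h | h
    · filter_upwards [(hc.continuousAt (x := (θ, t))).eventually_lt continuous_snd.continuousAt h]
        with p hp
      simp [rightHalf, hp.le, h.le]
    · filter_upwards [continuous_snd.continuousAt.eventually_lt (hc.continuousAt (x := (θ, t))) h]
        with p hp
      simp [rightHalf, hp.not_ge, h.not_ge]

lemma IsPlanarBody.area_le_of_le (hK : IsPlanarBody K) {θ t t' : ℝ} (h : t ≤ t') :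
    area K θ t ≤ area K θ t' :=
  measureReal_mono (inter_subset_inter_right _ fun _ hx => le_trans (hx : _ ≤ t) h)
    (hK.volume_inter_ne_top _)

lemma IsPlanarBody.area_lt_of_mem_interior (hK : IsPlanarBody K) {θ t t' : ℝ} {x : Plane}
    (hx : x ∈ interior K) (h1 : t < inner ℝ x (nrm θ)) (h2 : inner ℝ x (nrm θ) < t') :
    area K θ t < area K θ t' := by
  have hsub : K ∩ rightHalf θ t ⊆ K ∩ rightHalf θ t' :=
    inter_subset_inter_right _ fun y hy => le_trans (hy : _ ≤ t) (h1.trans h2).le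
  have hd := measureReal_sdiff (μ := volume) hsub
    (hK.measurableSet.inter (isClosed_rightHalf θ t).measurableSet) (hK.volume_inter_ne_top _)
  have hpos : 0 < volume.real ((K ∩ rightHalf θ t') \ (K ∩ rightHalf θ t)) := by
    refine ENNReal.toReal_pos ?_
      (measure_ne_top_of_subset sdiff_subset (hK.volume_inter_ne_top _))
    have hopen : IsOpen (interior K ∩ {x | t < inner ℝ x (nrm θ)} ∩ {x | inner ℝ x (nrm θ) < t'}) :=
      (isOpen_interior.inter (isOpen_lt continuous_const (by fun_prop))).inter
        (isOpen_lt (by fun_prop) continuous_const)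
    refine ((hopen.measure_pos volume ⟨x, ⟨hx, h1⟩, h2⟩).trans_le (measure_mono ?_)).ne'
    rintro y ⟨⟨hy, hy1⟩, hy2⟩
    have h2' : inner ℝ y (nrm θ) < t' := hy2
    refine ⟨⟨interior_subset hy, h2'.le⟩, fun hy' => ?_⟩
    have h3 : t < inner ℝ y (nrm θ) := hy1
    have h4 : inner ℝ y (nrm θ) ≤ t := hy'.2
    exact absurd h4 (not_le.2 h3)
  unfold area
  linarith

lemma IsPlanarBody.area_lt_of_crosses (hK : IsPlanarBody K) {θ t t' : ℝ} (h : Crosses K θ t)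
    (hlt : t < t') : area K θ t < area K θ t' := by
  obtain ⟨x, hx, rfl⟩ := h
  obtain ⟨ε, hε, hx'⟩ := exists_add_smul_mem_interior hx (nrm θ)
  set δ := min ε ((t' - inner ℝ x (nrm θ)) / 2)
  have hδ : 0 < δ := lt_min hε (by linarith)
  have hδ' : δ ≤ (t' - inner ℝ x (nrm θ)) / 2 := min_le_right _ _
  have h1 : inner ℝ (x + δ • nrm θ) (nrm θ) = inner ℝ x (nrm θ) + δ := by
    rw [inner_add_left, inner_smul_left, inner_nrm_nrm]; simp
  apply hK.area_lt_of_mem_interior (hx' δ (by rw [abs_of_pos hδ]; exact min_le_left _ _)) <;>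
    rw [h1] <;> linarith

lemma IsPlanarBody.area_lt_of_crosses' (hK : IsPlanarBody K) {θ t t' : ℝ} (h : Crosses K θ t')
    (hlt : t < t') : area K θ t < area K θ t' := by
  obtain ⟨x, hx, rfl⟩ := h
  obtain ⟨ε, hε, hx'⟩ := exists_add_smul_mem_interior hx (nrm θ)
  set δ := min ε ((inner ℝ x (nrm θ) - t) / 2)
  have hδ : 0 < δ := lt_min hε (by linarith)
  have hδ' : δ ≤ (inner ℝ x (nrm θ) - t) / 2 := min_le_right _ _
  have h1 : inner ℝ (x + (-δ) • nrm θ) (nrm θ) = inner ℝ x (nrm θ) - δ := by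
    rw [inner_add_left, inner_smul_left, inner_nrm_nrm]; simp; ring
  apply hK.area_lt_of_mem_interior
      (hx' (-δ) (by rw [abs_neg, abs_of_pos hδ]; exact min_le_left _ _)) <;>
    rw [h1] <;> linarith

lemma IsPlanarBody.area_eq_zero (hK : IsPlanarBody K) {θ t : ℝ} (h : K ⊆ leftHalf θ t) :
    area K θ t = 0 := by
  rw [area, measureReal_eq_zero_iff (hK.volume_inter_ne_top _)]
  refine measure_mono_null ?_ (volume_line θ t)
  rintro x ⟨hx, hx'⟩
  exact le_antisymm hx' (h hx)

lemma IsPlanarBody.subset_leftHalf (hK : IsPlanarBody K) {θ t : ℝ} (h : area K θ t = 0) :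
    K ⊆ leftHalf θ t := by
  intro x hx
  by_contra hlt
  obtain ⟨y, hy, hyt⟩ := hK.exists_mem_interior_of_mem (U := {x | inner ℝ x (nrm θ) < t})
    (isOpen_lt (by fun_prop) continuous_const) hx
    (not_le.1 hlt : inner ℝ x (nrm θ) < t)
  have := hK.area_lt_of_mem_interior hy (sub_one_lt _) hyt
  rw [h] at this
  exact not_le_of_gt this measureReal_nonneg

lemma area_eq_volume {θ t : ℝ} (h : K ⊆ rightHalf θ t) : area K θ t = volume.real K := by
  rw [area, inter_eq_left.2 h]

lemma IsPlanarBody.area_add_pi (hK : IsPlanarBody K) (θ t : ℝ) :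
    area K (θ + π) (-t) = volume.real K - area K θ t := by
  have h1 : area K (θ + π) (-t) = volume.real (K \ rightHalf θ t) := by
    apply measureReal_congr
    have h0 : ∀ᵐ x : Plane, x ∉ line θ t := by
      rw [ae_iff]; simpa using volume_line θ t
    filter_upwards [h0] with x hx
    have hx : inner ℝ x (nrm θ) ≠ t := hx
    apply propext
    change x ∈ K ∩ rightHalf (θ + π) (-t) ↔ x ∈ K \ rightHalf θ t
    simp only [mem_inter_iff, Set.mem_sdiff, rightHalf, mem_ofPred_eq, nrm_add_pi, inner_neg_right,
      neg_le_neg_iff]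
    exact and_congr_right fun _ => ⟨fun h => not_le_of_gt (lt_of_le_of_ne h hx.symm), fun h => (not_le.1 h).le⟩
  have h2 := measureReal_inter_add_sdiff (μ := volume) (s := K) (t := rightHalf θ t)
    (isClosed_rightHalf θ t).measurableSet hK.volume_ne_top
  rw [h1, area]; linarith

lemma IsPlanarBody.exists_abs_inner_le (hK : IsPlanarBody K) :
    ∃ R > 0, ∀ θ, ∀ x ∈ K, |inner ℝ x (nrm θ)| ≤ R ∧ |inner ℝ x (dir θ)| ≤ R := by
  obtain ⟨R, hR, h⟩ := hK.isCompact.isBounded.exists_pos_norm_le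
  refine ⟨R, hR, fun θ x hx => ⟨?_, ?_⟩⟩
  · exact (abs_real_inner_le_norm _ _).trans (by simpa using h x hx)
  · exact (abs_real_inner_le_norm _ _).trans (by simpa using h x hx)

lemma IsPlanarBody.exists_isSection (hK : IsPlanarBody K) {α : ℝ} (hα : α ∈ Ioo (0 : ℝ) 1) (θ : ℝ) :
    ∃ t, IsSection K α θ t := by
  obtain ⟨R, hR, hb⟩ := hK.exists_abs_inner_le
  have hc : Continuous (fun t => area K θ t) :=
    hK.continuous_area.comp (g := fun p : ℝ × ℝ => area K p.1 p.2) (f := fun t => (θ, t))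
      (by fun_prop)
  have h1 : area K θ (-R) = 0 := hK.area_eq_zero fun x hx => (abs_le.1 (hb θ x hx).1).1
  have h2 : area K θ R = volume.real K := area_eq_volume fun x hx => (abs_le.1 (hb θ x hx).1).2
  have hpos := hK.volume_pos
  have hmem : α * volume.real K ∈ Icc (area K θ (-R)) (area K θ R) := by
    rw [h1, h2]
    exact ⟨mul_nonneg hα.1.le hpos.le, mul_le_of_le_one_left hpos.le hα.2.le⟩
  have hRR : -R ≤ R := by linarith
  obtain ⟨t, -, ht⟩ := intermediate_value_Icc hRR hc.continuousOn hmem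
  exact ⟨t, ht⟩

lemma IsPlanarBody.crosses_of_isSection (hK : IsPlanarBody K) {α θ t : ℝ} (hα : α ∈ Ioo (0 : ℝ) 1)
    (h : IsSection K α θ t) : Crosses K θ t := by
  have hpos := hK.volume_pos
  have h' : area K θ t = α * volume.real K := h
  have h1 : ∃ x ∈ K, inner ℝ x (nrm θ) < t := by
    by_contra! hcon
    have := hK.area_eq_zero (θ := θ) (t := t) hcon
    rw [h'] at this
    nlinarith [hα.1]
  have h2 : ∃ x ∈ K, t < inner ℝ x (nrm θ) := by
    by_contra! hcon
    have := area_eq_volume (θ := θ) (t := t) hcon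
    rw [h'] at this
    nlinarith [hα.2]
  obtain ⟨x, hx, hxt⟩ := h1
  obtain ⟨y, hy, hyt⟩ := h2
  exact hK.crosses_of_lt_of_lt hx hy hxt hyt

lemma IsPlanarBody.secOffset_eq (hK : IsPlanarBody K) {α θ t : ℝ} (hα : α ∈ Ioo (0 : ℝ) 1)
    (h : IsSection K α θ t) : secOffset K α θ = t := by
  have : {t | IsSection K α θ t} = {t} := by
    ext t'
    refine ⟨fun h' => ?_, fun h' => by rw [mem_singleton_iff.1 h']; exact h⟩
    have e : area K θ t' = area K θ t := h'.trans h.symm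
    rcases lt_trichotomy t' t with hlt | heq | hlt
    · exact absurd e (hK.area_lt_of_crosses (hK.crosses_of_isSection hα h') hlt).ne
    · exact heq
    · exact absurd e (hK.area_lt_of_crosses (hK.crosses_of_isSection hα h) hlt).ne'
  rw [secOffset, this, csInf_singleton]

lemma IsPlanarBody.area_secOffset (hK : IsPlanarBody K) {α : ℝ} (hα : α ∈ Ioo (0 : ℝ) 1) (θ : ℝ) :
    area K θ (secOffset K α θ) = α * volume.real K := by
  obtain ⟨t, ht⟩ := hK.exists_isSection hα θ
  rw [hK.secOffset_eq hα ht]; exact ht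

lemma IsPlanarBody.crosses_secOffset (hK : IsPlanarBody K) {α : ℝ} (hα : α ∈ Ioo (0 : ℝ) 1)
    (θ : ℝ) : Crosses K θ (secOffset K α θ) :=
  hK.crosses_of_isSection hα (hK.area_secOffset hα θ)

lemma one_sub_mem_Ioo {α : ℝ} (hα : α ∈ Ioo (0 : ℝ) 1) : 1 - α ∈ Ioo (0 : ℝ) 1 :=
  ⟨by linarith [hα.2], by linarith [hα.1]⟩

lemma IsPlanarBody.secOffset_one_sub (hK : IsPlanarBody K) {α : ℝ} (hα : α ∈ Ioo (0 : ℝ) 1)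
    (θ : ℝ) : secOffset K (1 - α) (θ + π) = -secOffset K α θ := by
  apply hK.secOffset_eq (one_sub_mem_Ioo hα)
  change area K (θ + π) (-secOffset K α θ) = _
  rw [hK.area_add_pi, hK.area_secOffset hα]; ring

lemma secOffset_add_two_pi_mul (K : Set Plane) (α θ : ℝ) (k : ℤ) :
    secOffset K α (θ + k * (2 * π)) = secOffset K α θ := by
  simp [secOffset, IsSection, rightHalf, nrm_add_two_pi_mul]

lemma IsPlanarBody.secOffset_lt (hK : IsPlanarBody K) {α β : ℝ} (hα : α ∈ Ioo (0 : ℝ) 1)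
    (hβ : β ∈ Ioo (0 : ℝ) 1) (h : α < β) (θ : ℝ) : secOffset K α θ < secOffset K β θ := by
  by_contra! hle
  have := hK.area_le_of_le (θ := θ) hle
  rw [hK.area_secOffset hα, hK.area_secOffset hβ] at this
  nlinarith [hK.volume_pos]

/-- For a fixed offset `r`, comparing the area cut at `r` with `α |K|` is an open condition on `(α,
θ)`, and monotonicity of the area turns it into a comparison of the section's offset with `r`. -/
lemma IsPlanarBody.continuousAt_secOffset (hK : IsPlanarBody K) {α : ℝ} (hα : α ∈ Ioo (0 : ℝ) 1)
    (θ : ℝ) : ContinuousAt (fun p : ℝ × ℝ => secOffset K p.1 p.2) (α, θ) := by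
  have hpos := hK.volume_pos
  have hev : ∀ᶠ p : ℝ × ℝ in 𝓝 (α, θ), p.1 ∈ Ioo (0 : ℝ) 1 :=
    continuous_fst.continuousAt.eventually (isOpen_Ioo.mem_nhds hα)
  have hcr := hK.crosses_secOffset hα θ
  have hA := hK.area_secOffset hα θ
  have hc : ∀ r : ℝ, ContinuousAt (fun p : ℝ × ℝ => area K p.2 r) (α, θ) := fun r =>
    (hK.continuous_area.comp (continuous_snd.prodMk continuous_const)).continuousAt
  have hc2 : ContinuousAt (fun p : ℝ × ℝ => p.1 * volume.real K) (α, θ) := by fun_prop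
  apply tendsto_order.2 ⟨fun r hr => ?_, fun r hr => ?_⟩
  · have h1 := hK.area_lt_of_crosses' hcr hr
    rw [hA] at h1
    filter_upwards [hev, (hc r).eventually_lt hc2 h1] with p hp hlt
    by_contra! hle
    have := hK.area_le_of_le (θ := p.2) hle
    rw [hK.area_secOffset hp] at this
    linarith
  · have h1 := hK.area_lt_of_crosses hcr hr
    rw [hA] at h1
    filter_upwards [hev, hc2.eventually_lt (hc r) h1] with p hp hlt
    by_contra! hle
    have := hK.area_le_of_le (θ := p.2) hle
    rw [hK.area_secOffset hp] at this
    linarith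

/-- Last abscissa of the chord cut by the section. -/
lemma IsPlanarBody.continuousAt_hi_secOffset (hK : IsPlanarBody K) {α : ℝ}
    (hα : α ∈ Ioo (0 : ℝ) 1) (θ : ℝ) :
    ContinuousAt (fun p : ℝ × ℝ => hi K p.2 (secOffset K p.1 p.2)) (α, θ) :=
  ContinuousAt.comp (g := fun p : ℝ × ℝ => hi K p.1 p.2)
    (f := fun p : ℝ × ℝ => (p.2, secOffset K p.1 p.2)) (x := (α, θ))
    (hK.continuousAt_hi (hK.crosses_secOffset hα θ))
    (continuous_snd.continuousAt.prodMk (hK.continuousAt_secOffset hα θ))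

lemma chordC_eq (K : Set Plane) (α θ : ℝ) :
    chordC K α θ = hi K θ (secOffset K α θ) • dir θ + secOffset K α θ • nrm θ := rfl

lemma chordB_eq (K : Set Plane) (α θ : ℝ) :
    chordB K α θ = lo K θ (secOffset K α θ) • dir θ + secOffset K α θ • nrm θ := by
  rw [lo_eq_sInf]; rfl

lemma IsPlanarBody.chordB_eq_chordC (hK : IsPlanarBody K) {α : ℝ} (hα : α ∈ Ioo (0 : ℝ) 1)
    (θ : ℝ) : chordB K α θ = chordC K (1 - α) (θ + π) := by
  rw [chordB_eq, chordC_eq, hK.secOffset_one_sub hα, hi_add_pi]; simp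

lemma IsPlanarBody.continuousAt_chordC (hK : IsPlanarBody K) {α : ℝ}
    (hα : α ∈ Ioo (0 : ℝ) 1) (θ : ℝ) :
    ContinuousAt (fun p : ℝ × ℝ => chordC K p.1 p.2) (α, θ) := by
  simp only [chordC_eq]
  have h1 := hK.continuousAt_secOffset hα θ
  have h2 := hK.continuousAt_hi_secOffset hα θ
  fun_prop

lemma IsPlanarBody.continuousAt_chordB (hK : IsPlanarBody K) {α : ℝ}
    (hα : α ∈ Ioo (0 : ℝ) 1) (θ : ℝ) :
    ContinuousAt (fun p : ℝ × ℝ => chordB K p.1 p.2) (α, θ) := by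
  have hev : ∀ᶠ p : ℝ × ℝ in 𝓝 (α, θ), p.1 ∈ Ioo (0 : ℝ) 1 :=
    continuous_fst.continuousAt.eventually (isOpen_Ioo.mem_nhds hα)
  have h : ContinuousAt (fun p : ℝ × ℝ => chordC K (1 - p.1) (p.2 + π)) (α, θ) :=
    ContinuousAt.comp (g := fun p : ℝ × ℝ => chordC K p.1 p.2)
      (f := fun p : ℝ × ℝ => (1 - p.1, p.2 + π)) (x := (α, θ))
      (hK.continuousAt_chordC (one_sub_mem_Ioo hα) (θ + π)) (by fun_prop)
  refine h.congr ?_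
  filter_upwards [hev] with p hp using (hK.chordB_eq_chordC hp _).symm

lemma IsPlanarBody.continuousAt_mid (hK : IsPlanarBody K) {α : ℝ}
    (hα : α ∈ Ioo (0 : ℝ) 1) (θ : ℝ) :
    ContinuousAt (fun p : ℝ × ℝ => mid K p.1 p.2) (α, θ) :=
  ((hK.continuousAt_chordB hα θ).add (hK.continuousAt_chordC hα θ)).const_smul (1 / 2 : ℝ)

lemma IsPlanarBody.chordC_mem (hK : IsPlanarBody K) {α : ℝ} (hα : α ∈ Ioo (0 : ℝ) 1) (θ : ℝ) :
    chordC K α θ ∈ K := hK.hi_mem (hK.crosses_secOffset hα θ).mem_shadow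

lemma IsPlanarBody.chordB_mem (hK : IsPlanarBody K) {α : ℝ} (hα : α ∈ Ioo (0 : ℝ) 1) (θ : ℝ) :
    chordB K α θ ∈ K := by
  rw [chordB_eq]; exact hK.lo_mem (hK.crosses_secOffset hα θ).mem_shadow

lemma mid_eq (K : Set Plane) (α θ : ℝ) :
    mid K α θ = ((lo K θ (secOffset K α θ) + hi K θ (secOffset K α θ)) / 2) • dir θ
      + secOffset K α θ • nrm θ := by
  rw [mid, chordB_eq, chordC_eq]; module

/-! ### The area under a line in a fixed frame and its derivative -/

/-- The part below `r` of the slice of `K` of abscissa `s` in the frame `(dir θ, nrm θ)`. -/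
def sliceBelow (K : Set Plane) (θ s r : ℝ) : Set ℝ := {t | frameMap θ (s, t) ∈ K ∧ t ≤ r}

/-- The length of `sliceBelow`. -/
noncomputable def sliceLength (K : Set Plane) (θ s r : ℝ) : ℝ := volume.real (sliceBelow K θ s r)

/-- The area of the part of `K` below the line of slope `p.1` and intercept `p.2` in the frame
`(dir θ, nrm θ)`. -/
noncomputable def areaBelow (K : Set Plane) (θ : ℝ) (p : ℝ × ℝ) : ℝ :=
  volume.real {q : ℝ × ℝ | frameMap θ q ∈ K ∧ q.2 ≤ p.1 * q.1 + p.2}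

lemma IsPlanarBody.sliceBelow_ne_top (hK : IsPlanarBody K) (θ s r : ℝ) :
    volume (sliceBelow K θ s r) ≠ ⊤ := by
  obtain ⟨R, hR, hb⟩ := hK.exists_abs_inner_le
  have hfin : volume (Icc (-R) R) ≠ ⊤ := isCompact_Icc.measure_lt_top.ne
  refine measure_ne_top_of_subset ?_ hfin
  rintro t ⟨ht, -⟩
  have := (hb θ _ ht).1
  rw [frameMap, inner_frame_nrm] at this
  exact abs_le.1 this

lemma IsPlanarBody.isClosed_slice (hK : IsPlanarBody K) (θ s : ℝ) :
    IsClosed {t | frameMap θ (s, t) ∈ K} :=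
  hK.isCompact.isClosed.preimage (by fun_prop)

lemma IsPlanarBody.sliceLength_eq_add (hK : IsPlanarBody K) (θ s : ℝ) {r r' : ℝ} (h : r ≤ r') :
    sliceLength K θ s r' =
      sliceLength K θ s r + volume.real ({t | frameMap θ (s, t) ∈ K} ∩ Ioc r r') := by
  have hu : sliceBelow K θ s r' = sliceBelow K θ s r ∪ ({t | frameMap θ (s, t) ∈ K} ∩ Ioc r r') := by
    ext t
    simp only [sliceBelow, mem_ofPred_eq, mem_union, mem_inter_iff, mem_Ioc]
    constructor
    · rintro ⟨h1, h2⟩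
      rcases le_or_gt t r with h3 | h3
      · exact Or.inl ⟨h1, h3⟩
      · exact Or.inr ⟨h1, h3, h2⟩
    · rintro (⟨h1, h2⟩ | ⟨h1, h2, h3⟩)
      · exact ⟨h1, h2.trans h⟩
      · exact ⟨h1, h3⟩
  rw [sliceLength, hu, measureReal_union _ _ (hK.sliceBelow_ne_top θ s r)
    (measure_ne_top_of_subset inter_subset_right (by simp))]
  · rfl
  · rw [Set.disjoint_left]
    rintro t ⟨-, h1⟩ ⟨-, h2, -⟩
    exact absurd h1 (not_le.2 h2)
  · exact (hK.isClosed_slice θ s).measurableSet.inter measurableSet_Ioc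

/-- This Lipschitz bound supplies the domination when differentiating the area under the integral
sign. -/
lemma IsPlanarBody.abs_sliceLength_sub_le (hK : IsPlanarBody K) (θ s r r' : ℝ) :
    |sliceLength K θ s r - sliceLength K θ s r'| ≤ |r - r'| := by
  wlog h : r' ≤ r generalizing r r'
  · rw [abs_sub_comm, abs_sub_comm r]; exact this r' r (le_of_not_ge h)
  rw [hK.sliceLength_eq_add θ s h, add_sub_cancel_left, abs_of_nonneg measureReal_nonneg,
    abs_of_nonneg (by linarith)]
  calc _ ≤ volume.real (Ioc r' r) := measureReal_mono inter_subset_right (by simp)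
    _ = r - r' := by rw [Real.volume_real_Ioc_of_le h]

lemma IsPlanarBody.sliceLength_eq_add_of_subset (hK : IsPlanarBody K) (θ s : ℝ) {r r' : ℝ}
    (h : ∀ t ∈ uIcc r r', frameMap θ (s, t) ∈ K) :
    sliceLength K θ s r' = sliceLength K θ s r + (r' - r) := by
  wlog hle : r ≤ r' generalizing r r'
  · have := this (r := r') (r' := r) (by rwa [uIcc_comm]) (le_of_not_ge hle)
    linarith
  rw [hK.sliceLength_eq_add θ s hle, inter_eq_right.2, Real.volume_real_Ioc_of_le hle]
  intro t ht
  exact h t (by rw [uIcc_of_le hle]; exact ⟨ht.1.le, ht.2⟩)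

lemma IsPlanarBody.sliceLength_eq_of_disjoint (hK : IsPlanarBody K) (θ s : ℝ) {r r' : ℝ}
    (h : ∀ t ∈ uIcc r r', frameMap θ (s, t) ∉ K) :
    sliceLength K θ s r' = sliceLength K θ s r := by
  wlog hle : r ≤ r' generalizing r r'
  · exact (this (r := r') (r' := r) (by rwa [uIcc_comm]) (le_of_not_ge hle)).symm
  have : {t | frameMap θ (s, t) ∈ K} ∩ Ioc r r' = ∅ := by
    rw [eq_empty_iff_forall_notMem]
    rintro t ⟨h1, h2⟩
    exact h t (by rw [uIcc_of_le hle]; exact ⟨h2.1.le, h2.2⟩) h1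
  rw [hK.sliceLength_eq_add θ s hle, this, measureReal_empty, add_zero]

lemma IsPlanarBody.measurableSet_areaBelow (hK : IsPlanarBody K) (θ : ℝ) (p : ℝ × ℝ) :
    MeasurableSet {q : ℝ × ℝ | frameMap θ q ∈ K ∧ q.2 ≤ p.1 * q.1 + p.2} :=
  (hK.isCompact.isClosed.preimage (continuous_frameMap θ)).measurableSet.inter
    (isClosed_le (f := fun q : ℝ × ℝ => q.2) (g := fun q : ℝ × ℝ => p.1 * q.1 + p.2)
      (by fun_prop) (by fun_prop)).measurableSet

lemma prodMk_preimage_areaBelow (K : Set Plane) (θ : ℝ) (p : ℝ × ℝ) (s : ℝ) :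
    Prod.mk s ⁻¹' {q : ℝ × ℝ | frameMap θ q ∈ K ∧ q.2 ≤ p.1 * q.1 + p.2} =
      sliceBelow K θ s (p.1 * s + p.2) := rfl

lemma IsPlanarBody.measurable_sliceLength (hK : IsPlanarBody K) (θ : ℝ) (p : ℝ × ℝ) :
    Measurable (fun s => sliceLength K θ s (p.1 * s + p.2)) :=
  (measurable_measure_prodMk_left (ν := (volume : Measure ℝ))
    (hK.measurableSet_areaBelow θ p)).ennreal_toReal

lemma IsPlanarBody.areaBelow_eq_integral (hK : IsPlanarBody K) (θ : ℝ) (p : ℝ × ℝ) :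
    areaBelow K θ p = ∫ s, sliceLength K θ s (p.1 * s + p.2) := by
  have h := integral_toReal (μ := (volume : Measure ℝ))
    (measurable_measure_prodMk_left (ν := (volume : Measure ℝ))
      (hK.measurableSet_areaBelow θ p)).aemeasurable
    (Eventually.of_forall fun s => by
      rw [prodMk_preimage_areaBelow]; exact (hK.sliceBelow_ne_top θ s _).lt_top)
  rw [← Measure.prod_apply (hK.measurableSet_areaBelow θ p)] at h
  exact h.symm

/-- Strictly inside the chord the moving line stays in `K`, so the slice grows with the height of
the line; strictly outside, it stays in the complement and nothing changes. The two excluded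
abscissae form a null set. -/
lemma IsPlanarBody.hasFDerivAt_sliceLength (hK : IsPlanarBody K) {θ t s : ℝ} (h : Crosses K θ t)
    (h1 : s ≠ lo K θ t) (h2 : s ≠ hi K θ t) :
    HasFDerivAt (fun p : ℝ × ℝ => sliceLength K θ s (p.1 * s + p.2))
      ((Ioo (lo K θ t) (hi K θ t)).indicator
        (fun s => s • ContinuousLinearMap.fst ℝ ℝ ℝ + ContinuousLinearMap.snd ℝ ℝ ℝ) s) (0, t) := by
  have hc : ContinuousAt (fun p : ℝ × ℝ => p.1 * s + p.2) (0, t) := by fun_prop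
  have hc0 : (fun p : ℝ × ℝ => p.1 * s + p.2) (0, t) = t := by simp
  have hfc : Continuous fun r => frameMap θ (s, r) := by fun_prop
  have hnear : ∀ U : Set Plane, IsOpen U → frameMap θ (s, t) ∈ U →
      ∀ᶠ p : ℝ × ℝ in 𝓝 (0, t), ∀ r ∈ uIcc t (p.1 * s + p.2), frameMap θ (s, r) ∈ U := by
    intro U hU hmem
    obtain ⟨ε, hε, hb⟩ := Metric.mem_nhds_iff.1 ((hU.preimage hfc).mem_nhds hmem)
    have : ∀ᶠ p : ℝ × ℝ in 𝓝 (0, t), p.1 * s + p.2 ∈ Metric.ball t ε := by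
      apply hc.eventually
      rw [hc0]; exact Metric.ball_mem_nhds _ hε
    filter_upwards [this] with p hp r hr
    have hsub := (convex_ball t ε).ordConnected.uIcc_subset (Metric.mem_ball_self hε) hp
    exact hb (hsub hr)
  by_cases hs : s ∈ Ioo (lo K θ t) (hi K θ t)
  · rw [indicator_of_mem hs]
    have hd : HasFDerivAt (fun p : ℝ × ℝ => sliceLength K θ s t + ((p.1 * s + p.2) - t))
        (s • ContinuousLinearMap.fst ℝ ℝ ℝ + ContinuousLinearMap.snd ℝ ℝ ℝ) (0, t) := by
      have hf := ((hasFDerivAt_fst (𝕜 := ℝ) (E := ℝ) (F := ℝ) (p := ((0 : ℝ), t))).mul_const s).add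
        (hasFDerivAt_snd (𝕜 := ℝ) (E := ℝ) (F := ℝ) (p := ((0 : ℝ), t)))
      exact (hf.sub_const t).const_add _
    refine hd.congr_of_eventuallyEq ?_
    filter_upwards [hnear _ isOpen_interior (hK.mem_interior_of_lt h hs.1 hs.2)] with p hp
    exact hK.sliceLength_eq_add_of_subset θ s fun r hr => interior_subset (hp r hr)
  · rw [indicator_of_notMem hs]
    have hout : frameMap θ (s, t) ∈ Kᶜ := by
      intro hmem
      exact hs ⟨lt_of_le_of_ne (hK.lo_le hmem) h1.symm, lt_of_le_of_ne (hK.le_hi hmem) h2⟩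
    refine (hasFDerivAt_const (sliceLength K θ s t) _).congr_of_eventuallyEq ?_
    filter_upwards [hnear _ hK.isCompact.isClosed.isOpen_compl hout] with p hp
    exact hK.sliceLength_eq_of_disjoint θ s hp

/-- The coefficients are the integrals of `s` and of `1` over the chord; their ratio is the abscissa
of its midpoint. -/
lemma IsPlanarBody.hasFDerivAt_areaBelow (hK : IsPlanarBody K) {θ t : ℝ} (h : Crosses K θ t) :
    HasFDerivAt (areaBelow K θ)
      (((hi K θ t ^ 2 - lo K θ t ^ 2) / 2) • ContinuousLinearMap.fst ℝ ℝ ℝ +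
        (hi K θ t - lo K θ t) • ContinuousLinearMap.snd ℝ ℝ ℝ) (0, t) := by
  obtain ⟨R, hR, hb⟩ := hK.exists_abs_inner_le
  have hlt := hK.lo_lt_hi h
  have hzero : ∀ s r, s ∉ Icc (-R) R → sliceLength K θ s r = 0 := by
    intro s r hs
    have : sliceBelow K θ s r = ∅ := by
      rw [eq_empty_iff_forall_notMem]
      rintro t ⟨h1, -⟩
      have := (hb θ _ h1).2
      rw [frameMap, inner_frame_dir] at this
      exact hs (abs_le.1 this)
    rw [sliceLength, this, measureReal_empty]
  have hF'meas : Measurable (fun s : ℝ => s • ContinuousLinearMap.fst ℝ ℝ ℝ +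
      ContinuousLinearMap.snd ℝ ℝ ℝ) :=
    Continuous.measurable (by fun_prop)
  -- The constant `R + 1` comes from `|a s + b| ≤ (R + 1) ‖(a, b)‖` for `|s| ≤ R`; outside this
  -- range the slices are empty.
  have hle : ∀ (s : ℝ) (p : ℝ × ℝ), ‖sliceLength K θ s (p.1 * s + p.2) -
      sliceLength K θ s (((0, t) : ℝ × ℝ).1 * s + ((0, t) : ℝ × ℝ).2)‖ ≤
        (Icc (-R) R).indicator (fun _ => R + 1) s * ‖p - (0, t)‖ := by
    intro s p
    by_cases hs : s ∈ Icc (-R) R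
    · rw [indicator_of_mem hs, Real.norm_eq_abs]
      refine (hK.abs_sliceLength_sub_le θ s _ _).trans ?_
      have e : p.1 * s + p.2 - (((0, t) : ℝ × ℝ).1 * s + ((0, t) : ℝ × ℝ).2) =
        (p - (0, t)).1 * s + (p - (0, t)).2 := by simp; ring
      rw [e]
      have h1 := norm_fst_le (p - (0, t))
      have h2 := norm_snd_le (p - (0, t))
      rw [Real.norm_eq_abs] at h1 h2
      calc _ ≤ |(p - (0, t)).1| * |s| + |(p - (0, t)).2| := by
            rw [← abs_mul]; exact abs_add_le _ _
        _ ≤ ‖p - (0, t)‖ * R + ‖p - (0, t)‖ := by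
            have := abs_le.2 hs
            gcongr
        _ = _ := by ring
    · rw [hzero _ _ hs, hzero _ _ hs, indicator_of_notMem hs]; simp
  have hint : Integrable (fun s => sliceLength K θ s (((0, t) : ℝ × ℝ).1 * s + ((0, t) : ℝ × ℝ).2)) := by
    refine Integrable.mono' (g := (Icc (-R) R).indicator fun _ => 2 * R) ?_
      (hK.measurable_sliceLength θ (0, t)).aestronglyMeasurable (Eventually.of_forall fun s => ?_)
    · exact (integrable_indicator_iff measurableSet_Icc).2 (integrableOn_const (by simp))
    · by_cases hs : s ∈ Icc (-R) R
      · rw [indicator_of_mem hs, Real.norm_eq_abs, sliceLength, abs_of_nonneg measureReal_nonneg]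
        have : sliceBelow K θ s (((0, t) : ℝ × ℝ).1 * s + ((0, t) : ℝ × ℝ).2) ⊆ Icc (-R) R := by
          rintro t ⟨h1, -⟩
          have := (hb θ _ h1).1
          rw [frameMap, inner_frame_nrm] at this
          exact abs_le.1 this
        refine (measureReal_mono this (by simp)).trans ?_
        rw [Real.volume_real_Icc_of_le (by linarith)]; linarith
      · rw [hzero _ _ hs, indicator_of_notMem hs]; simp
  have key := hasFDerivAt_integral_of_dominated_loc_of_lip' (𝕜 := ℝ) (μ := (volume : Measure ℝ))
    (F := fun (p : ℝ × ℝ) s => sliceLength K θ s (p.1 * s + p.2)) (x₀ := ((0 : ℝ), t))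
    (bound := (Icc (-R) R).indicator fun _ => R + 1)
    (F' := (Ioo (lo K θ t) (hi K θ t)).indicator
      (fun s => s • ContinuousLinearMap.fst ℝ ℝ ℝ + ContinuousLinearMap.snd ℝ ℝ ℝ))
    univ_mem (fun p _ => (hK.measurable_sliceLength θ p).aestronglyMeasurable) hint
    (hF'meas.indicator measurableSet_Ioo).aestronglyMeasurable
    (Eventually.of_forall fun s p _ => hle s p)
    ((integrable_indicator_iff measurableSet_Icc).2 (integrableOn_const (by simp)))
    (by
      have h1 : ∀ᵐ s : ℝ, s ≠ lo K θ t := by rw [ae_iff]; simp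
      have h2 : ∀ᵐ s : ℝ, s ≠ hi K θ t := by rw [ae_iff]; simp
      filter_upwards [h1, h2] with s h1 h2 using hK.hasFDerivAt_sliceLength h h1 h2)
  have hfun : areaBelow K θ = fun p => ∫ s, sliceLength K θ s (p.1 * s + p.2) :=
    funext (hK.areaBelow_eq_integral θ)
  rw [hfun]
  convert! key.2 using 1
  rw [integral_indicator measurableSet_Ioo, ← integral_Ioc_eq_integral_Ioo,
    ← intervalIntegral.integral_of_le hlt.le, intervalIntegral.integral_add
      (Continuous.intervalIntegrable (by fun_prop) _ _)
      (Continuous.intervalIntegrable (by fun_prop) _ _),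
    intervalIntegral.integral_smul_const, intervalIntegral.integral_const, integral_id]

/-- Dividing the equation of the rotated line by `cos τ > 0` makes it a graph in the fixed frame and
preserves the side. -/
lemma area_add_eq_areaBelow (K : Set Plane) (hK : IsPlanarBody K) (θ T : ℝ) {τ : ℝ}
    (hτ : 0 < cos τ) : area K (θ + τ) T = areaBelow K θ (tan τ, T / cos τ) := by
  rw [area, measureReal_def, ← (measurePreserving_frameMap θ).measure_preimage
    (hK.measurableSet.inter (isClosed_rightHalf _ _).measurableSet).nullMeasurableSet]
  rw [areaBelow, measureReal_def]
  congr 2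
  ext q
  simp only [mem_preimage, mem_inter_iff, rightHalf, mem_ofPred_eq]
  refine and_congr_right fun _ => ?_
  have : inner ℝ (frameMap θ q) (nrm (θ + τ)) = -sin τ * q.1 + cos τ * q.2 := by
    rw [nrm_add, inner_add_right, inner_smul_right, inner_smul_right, frameMap, inner_frame_dir,
      inner_frame_nrm]
  rw [this, tan_eq_sin_div_cos, div_mul_eq_mul_div, ← add_div, le_div_iff₀ hτ]
  constructor <;> intro h <;> linarith

/-! ### One-sided derivatives of the midpoint -/

/-- If `F (a, y)` is constant along a curve and `F` has differential `w (y + m a)` with `w ≠ 0`,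
then `y + m a` is negligible. -/
lemma isLittleO_of_hasFDerivAt_of_const {F : ℝ × ℝ → ℝ} {t w m : ℝ} (hw : w ≠ 0)
    (hF : HasFDerivAt F ((w * m) • ContinuousLinearMap.fst ℝ ℝ ℝ +
      w • ContinuousLinearMap.snd ℝ ℝ ℝ) (0, t))
    {a e : ℝ → ℝ} (ha : Tendsto a (𝓝 0) (𝓝 0)) (he : Tendsto e (𝓝 0) (𝓝 t))
    (hconst : ∀ᶠ τ in 𝓝 0, F (a τ, e τ) = F (0, t)) :
    (fun τ => e τ - t + m * a τ) =o[𝓝 0] a := by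
  have h1 := hF.isLittleO.comp_tendsto (ha.prodMk_nhds he)
  set C := 1 + |m|
  have hC : 0 < C := by positivity
  rw [isLittleO_iff] at h1 ⊢
  intro c hc
  -- The bound `1 / 2` allows `|z|` to be absorbed from the right-hand side; the other bound brings
  -- the remaining constant below `c`.
  have hε : 0 < min (1 / 2) (c / (2 * C)) := by positivity
  set ε := min (1 / 2) (c / (2 * C))
  have hε1 : ε ≤ 1 / 2 := min_le_left _ _
  have hε2 : 2 * ε * C ≤ c := by
    have : ε ≤ c / (2 * C) := min_le_right _ _
    rw [le_div_iff₀ (by positivity)] at this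
    linarith
  filter_upwards [h1 (show 0 < |w| * ε by positivity), hconst] with τ h h'
  simp only [Function.comp] at h
  rw [h'] at h
  set z := e τ - t + m * a τ
  have e1 : F (0, t) - F (0, t) - ((w * m) • ContinuousLinearMap.fst ℝ ℝ ℝ +
      w • ContinuousLinearMap.snd ℝ ℝ ℝ) ((a τ, e τ) - (0, t)) = -(w * z) := by
    simp [z]; ring
  rw [e1, norm_neg, norm_mul, Real.norm_eq_abs, Real.norm_eq_abs, mul_assoc] at h
  have h := le_of_mul_le_mul_left h (abs_pos.2 hw)
  have e2 : ‖((a τ, e τ) : ℝ × ℝ) - (0, t)‖ ≤ C * |a τ| + |z| := by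
    have hy : e τ - t = z - m * a τ := by simp only [z]; ring
    rw [Prod.mk_sub_mk, Prod.norm_def, sub_zero, hy]
    simp only [Real.norm_eq_abs]
    have h3 := abs_nonneg (a τ)
    have h4 := abs_nonneg z
    have h5 := abs_nonneg m
    refine max_le (by nlinarith [mul_nonneg h5 h3]) ((abs_sub _ _).trans ?_)
    rw [abs_mul]; simp only [C]; nlinarith
  rw [Real.norm_eq_abs, Real.norm_eq_abs]
  have h3 := abs_nonneg (a τ)
  have h4 := abs_nonneg z
  have h6 : |z| ≤ ε * (C * |a τ| + |z|) := h.trans (by gcongr)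
  have h7 : |z| ≤ 2 * ε * C * |a τ| := by nlinarith
  exact h7.trans (by gcongr)

/-- The area cut off is constant in `θ`. In the fixed frame the section has slope `tan τ` and
intercept `T / cos τ`, so the preceding lemma gives the intercept derivative `-m` at `τ = 0`.
Multiplying back by `cos τ`, whose derivative vanishes there, changes nothing. -/
lemma IsPlanarBody.hasDerivAt_secOffset (hK : IsPlanarBody K) {α : ℝ} (hα : α ∈ Ioo (0 : ℝ) 1)
    (θ : ℝ) : HasDerivAt (secOffset K α)
      (-((lo K θ (secOffset K α θ) + hi K θ (secOffset K α θ)) / 2)) θ := by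
  set t := secOffset K α θ with ht
  have hcr : Crosses K θ t := hK.crosses_secOffset hα θ
  have hlt := hK.lo_lt_hi hcr
  set w := hi K θ t - lo K θ t with hw
  set m := (lo K θ t + hi K θ t) / 2 with hm
  have hTc : ContinuousAt (fun τ => secOffset K α (θ + τ)) 0 :=
    ContinuousAt.comp (g := fun p : ℝ × ℝ => secOffset K p.1 p.2) (f := fun τ : ℝ => (α, θ + τ))
      (x := 0) (by simpa using hK.continuousAt_secOffset hα θ) (by fun_prop)
  have hcos : ∀ᶠ τ : ℝ in 𝓝 0, 0 < cos τ :=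
    continuous_cos.continuousAt.eventually (isOpen_Ioi.mem_nhds (by simp))
  have hec : Tendsto (fun τ => secOffset K α (θ + τ) / cos τ) (𝓝 0) (𝓝 t) := by
    have : Tendsto (fun τ => secOffset K α (θ + τ) / cos τ) (𝓝 0)
        (𝓝 (secOffset K α (θ + 0) / cos 0)) := hTc.div continuous_cos.continuousAt (by simp)
    simpa [ht] using this
  have htan : HasDerivAt tan 1 0 := by simpa using hasDerivAt_tan (x := 0) (by simp)
  have hF : HasFDerivAt (areaBelow K θ) ((w * m) • ContinuousLinearMap.fst ℝ ℝ ℝ +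
      w • ContinuousLinearMap.snd ℝ ℝ ℝ) (0, t) := by
    convert! hK.hasFDerivAt_areaBelow hcr using 3
    rw [hw, hm]; ring
  have ho := isLittleO_of_hasFDerivAt_of_const (a := tan)
    (e := fun τ => secOffset K α (θ + τ) / cos τ) (by linarith : w ≠ 0) hF
    (by simpa using htan.continuousAt.tendsto) hec (by
      filter_upwards [hcos] with τ hτ
      rw [← area_add_eq_areaBelow K hK θ _ hτ, hK.area_secOffset hα]
      have := area_add_eq_areaBelow K hK θ t (τ := 0) (by simp)
      rw [add_zero, tan_zero, cos_zero, div_one] at this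
      rw [← this, ht, hK.area_secOffset hα])
  have htanO : tan =O[𝓝 0] (fun τ : ℝ => τ) := by simpa using htan.isBigO_sub
  have hz : HasDerivAt (fun τ => secOffset K α (θ + τ) / cos τ - t + m * tan τ) 0 0 := by
    rw [hasDerivAt_iff_isLittleO]
    simpa [ht] using ho.trans_isBigO htanO
  have he : HasDerivAt (fun τ => secOffset K α (θ + τ) / cos τ) (-m) 0 := by
    have := (hz.sub (htan.const_mul m)).add_const t
    convert! this using 1
    · ext τ; simp
    · ring
  have hT : HasDerivAt (fun τ => secOffset K α (θ + τ)) (-m) 0 := by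
    have := he.mul (hasDerivAt_cos 0)
    simp only [cos_zero, sin_zero, mul_one, neg_zero, mul_zero, add_zero] at this
    refine this.congr_of_eventuallyEq ?_
    filter_upwards [hcos] with τ hτ
    simp [hτ.ne']
  have := HasDerivAt.comp_sub_const (f := fun τ => secOffset K α (θ + τ)) θ θ (by simpa using hT)
  simpa using this

/-- The vanishing of `g` at `x` is what makes mere continuity of `f` enough. It is applied with `f`
the end abscissa along the sections and `g` a sine. -/
lemma hasDerivAt_mul_of_continuousAt {f g : ℝ → ℝ} {g' x : ℝ} (hf : ContinuousAt f x)
    (hg : HasDerivAt g g' x) (hg0 : g x = 0) : HasDerivAt (fun y => f y * g y) (f x * g') x := by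
  rw [hasDerivAt_iff_tendsto_slope] at hg ⊢
  refine ((hf.tendsto.mono_left nhdsWithin_le_nhds).mul hg).congr fun y => ?_
  simp only [slope_def_field, hg0, mul_zero, sub_zero]; ring

lemma eventually_mul_nonneg_of_hasDerivAt {f : ℝ → ℝ} {f' x : ℝ} (hf : HasDerivAt f f' x)
    (h : 0 < f') : ∀ᶠ y in 𝓝 x, 0 ≤ (f y - f x) * (y - x) := by
  rw [hasDerivAt_iff_tendsto_slope] at hf
  have h1 := eventually_nhdsWithin_iff.1 (hf.eventually (lt_mem_nhds h))
  filter_upwards [h1] with y hy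
  rcases eq_or_ne y x with rfl | hne
  · simp
  · have h2 := hy hne
    rw [slope_def_field] at h2
    have h3 : (f y - f x) * (y - x) = (f y - f x) / (y - x) * (y - x) ^ 2 := by
      have : y - x ≠ 0 := sub_ne_zero.2 hne
      field_simp
    rw [h3]; positivity

lemma inner_chordC_nrm (K : Set Plane) (α θ τ : ℝ) : inner ℝ (chordC K α τ) (nrm θ) =
    hi K τ (secOffset K α τ) * sin (τ - θ) + secOffset K α τ * cos (τ - θ) := by
  rw [chordC_eq, inner_add_left, inner_smul_left, inner_smul_left, inner_plane, inner_plane]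
  simp [sin_sub, cos_sub]; ring

/-- The half-length of the chord cut by the section. -/
noncomputable def halfLen (K : Set Plane) (α θ : ℝ) : ℝ :=
  (hi K θ (secOffset K α θ) - lo K θ (secOffset K α θ)) / 2

lemma IsPlanarBody.halfLen_pos (hK : IsPlanarBody K) {α : ℝ} (hα : α ∈ Ioo (0 : ℝ) 1) (θ : ℝ) :
    0 < halfLen K α θ := by
  have := hK.lo_lt_hi (hK.crosses_secOffset hα θ)
  unfold halfLen; linarith

lemma IsPlanarBody.halfLen_one_sub (hK : IsPlanarBody K) {α : ℝ} (hα : α ∈ Ioo (0 : ℝ) 1)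
    (θ : ℝ) : halfLen K (1 - α) (θ + π) = halfLen K α θ := by
  rw [halfLen, halfLen, hK.secOffset_one_sub hα, hi_add_pi, hi_eq_neg_lo K θ]; ring

lemma IsPlanarBody.continuousAt_chordC_right (hK : IsPlanarBody K) {α : ℝ}
    (hα : α ∈ Ioo (0 : ℝ) 1) (θ : ℝ) : ContinuousAt (chordC K α) θ :=
  ContinuousAt.comp (g := fun p : ℝ × ℝ => chordC K p.1 p.2) (f := fun τ : ℝ => (α, τ))
    (hK.continuousAt_chordC hα θ) (by fun_prop)

/-- The derivative is the end abscissa minus the midpoint abscissa. Its positivity means that, as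
`θ` increases, `c` moves to the left of the section; this decides which one-sided slope governs
which one-sided velocity. -/
lemma IsPlanarBody.hasDerivAt_inner_chordC_nrm (hK : IsPlanarBody K) {α : ℝ}
    (hα : α ∈ Ioo (0 : ℝ) 1) (θ : ℝ) :
    HasDerivAt (fun τ => inner ℝ (chordC K α τ) (nrm θ)) (halfLen K α θ) θ := by
  simp only [inner_chordC_nrm]
  have h1 : ContinuousAt (fun τ => hi K τ (secOffset K α τ)) θ :=
    ContinuousAt.comp (g := fun p : ℝ × ℝ => hi K p.2 (secOffset K p.1 p.2))
      (f := fun τ : ℝ => (α, τ)) (hK.continuousAt_hi_secOffset hα θ) (by fun_prop)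
  have hs : HasDerivAt (fun τ => sin (τ - θ)) 1 θ := by
    simpa using (HasDerivAt.comp_sub_const θ θ (f := sin) (hasDerivAt_sin _))
  have hc : HasDerivAt (fun τ => cos (τ - θ)) 0 θ := by
    simpa using (HasDerivAt.comp_sub_const θ θ (f := cos) (hasDerivAt_cos _))
  have h2 := hasDerivAt_mul_of_continuousAt h1 hs (by simp)
  have h3 := (hK.hasDerivAt_secOffset hα θ).mul hc
  convert! h2.add h3 using 1
  simp [halfLen]; ring

/-- For `τ` near `θ` the endpoint lies beyond the first end of the chord in direction `θ` through
it. Were it also before the last end, it would be interior to `K`; so it runs along the graph of `hi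
K θ`. -/
lemma IsPlanarBody.eventually_inner_chordC_dir (hK : IsPlanarBody K) {α : ℝ}
    (hα : α ∈ Ioo (0 : ℝ) 1) (θ : ℝ) :
    ∀ᶠ τ in 𝓝 θ, inner ℝ (chordC K α τ) (dir θ) = hi K θ (inner ℝ (chordC K α τ) (nrm θ)) := by
  have hcr := hK.crosses_secOffset hα θ
  have hlt := hK.lo_lt_hi hcr
  have hcc := hK.continuousAt_chordC_right hα θ
  have e1 : inner ℝ (chordC K α θ) (nrm θ) = secOffset K α θ := inner_frame_nrm _ _ _
  have e2 : inner ℝ (chordC K α θ) (dir θ) = hi K θ (secOffset K α θ) := inner_frame_dir _ _ _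
  have hy : ContinuousAt (fun τ => inner ℝ (chordC K α τ) (nrm θ)) θ :=
    hcc.inner continuousAt_const
  have hx : ContinuousAt (fun τ => inner ℝ (chordC K α τ) (dir θ)) θ :=
    hcc.inner continuousAt_const
  have hp : ContinuousAt (fun τ => (θ, inner ℝ (chordC K α τ) (nrm θ))) θ :=
    continuousAt_const.prodMk hy
  have hcr' : ∀ᶠ τ in 𝓝 θ, Crosses K θ (inner ℝ (chordC K α τ) (nrm θ)) :=
    hp.eventually ((isOpen_crosses K).mem_nhds (by
      change Crosses K θ (inner ℝ (chordC K α θ) (nrm θ)); rw [e1]; exact hcr))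
  have hlo : ContinuousAt (fun τ => lo K θ (inner ℝ (chordC K α τ) (nrm θ))) θ :=
    ContinuousAt.comp (g := fun p : ℝ × ℝ => lo K p.1 p.2)
      (f := fun τ => (θ, inner ℝ (chordC K α τ) (nrm θ)))
      (by simp only [e1]; exact hK.continuousAt_lo hcr) hp
  have hlt' := hlo.eventually_lt hx (by rw [e1, e2]; exact hlt)
  filter_upwards [hcr', hlt'] with τ h1 h2
  refine le_antisymm (hK.inner_le_hi θ (hK.chordC_mem hα τ)) (not_lt.1 fun h3 => ?_)
  have := hK.mem_interior_of_lt h1 h2 h3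
  rw [← frame_expand] at this
  exact hK.hi_notMem_interior _ _ this

/-- Chain rule along the graph of `hi K θ` in the fixed frame; `J` is the side from which the
heights arrive when `τ` stays in `I`. -/
lemma IsPlanarBody.hasDerivWithinAt_chordC (hK : IsPlanarBody K) {α : ℝ} (hα : α ∈ Ioo (0 : ℝ) 1)
    {θ k : ℝ} {I J : Set ℝ} (hg : HasDerivWithinAt (hi K θ) k J (secOffset K α θ))
    (hIJ : ∀ᶠ τ in 𝓝[I] θ, inner ℝ (chordC K α τ) (nrm θ) ∈ J) :
    HasDerivWithinAt (chordC K α) (halfLen K α θ • (k • dir θ + nrm θ)) I θ := by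
  have hy := hK.hasDerivAt_inner_chordC_nrm hα θ
  have e1 : inner ℝ (chordC K α θ) (nrm θ) = secOffset K α θ := inner_frame_nrm _ _ _
  have hx : HasDerivWithinAt (fun τ => inner ℝ (chordC K α τ) (dir θ)) (k * halfLen K α θ) I θ := by
    have h1 : HasDerivWithinAt (hi K θ ∘ fun τ => inner ℝ (chordC K α τ) (nrm θ))
        (k * halfLen K α θ) (I ∩ {τ | inner ℝ (chordC K α τ) (nrm θ) ∈ J}) θ := by
      refine HasDerivWithinAt.comp θ (h₂ := hi K θ) (s' := J) ?_ hy.hasDerivWithinAt fun τ hτ => hτ.2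
      rw [e1]; exact hg
    have h2 := h1.mono_of_mem_nhdsWithin (s := I) (inter_mem self_mem_nhdsWithin hIJ)
    refine h2.congr_of_eventuallyEq
      ((hK.eventually_inner_chordC_dir hα θ).filter_mono nhdsWithin_le_nhds) ?_
    exact (hK.eventually_inner_chordC_dir hα θ).self_of_nhds
  have h := (hx.smul_const (dir θ)).add (hy.hasDerivWithinAt.smul_const (nrm θ))
  convert! h using 1
  · ext1 τ; exact frame_expand θ _
  · module

lemma IsPlanarBody.hasDerivWithinAt_chordC_Ici (hK : IsPlanarBody K) {α : ℝ}
    (hα : α ∈ Ioo (0 : ℝ) 1) (θ : ℝ) : HasDerivWithinAt (chordC K α)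
      (halfLen K α θ • (slopeR K θ (secOffset K α θ) • dir θ + nrm θ)) (Ici θ) θ := by
  refine hK.hasDerivWithinAt_chordC hα (J := Ici (secOffset K α θ))
    (hK.hasDerivWithinAt_slopeR (hK.crosses_secOffset hα θ)).Ici_of_Ioi ?_
  have h := eventually_mul_nonneg_of_hasDerivAt (hK.hasDerivAt_inner_chordC_nrm hα θ)
    (hK.halfLen_pos hα θ)
  have e1 : inner ℝ (chordC K α θ) (nrm θ) = secOffset K α θ := inner_frame_nrm _ _ _
  rw [e1] at h
  filter_upwards [h.filter_mono nhdsWithin_le_nhds, self_mem_nhdsWithin] with τ h1 h2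
  rcases (mem_Ici.1 h2).eq_or_lt with rfl | h2
  · exact e1.ge
  · exact sub_nonneg.1 (nonneg_of_mul_nonneg_left h1 (sub_pos.2 h2))

lemma IsPlanarBody.hasDerivWithinAt_chordC_Iic (hK : IsPlanarBody K) {α : ℝ}
    (hα : α ∈ Ioo (0 : ℝ) 1) (θ : ℝ) : HasDerivWithinAt (chordC K α)
      (halfLen K α θ • (slopeL K θ (secOffset K α θ) • dir θ + nrm θ)) (Iic θ) θ := by
  refine hK.hasDerivWithinAt_chordC hα (J := Iic (secOffset K α θ))
    (hK.hasDerivWithinAt_slopeL (hK.crosses_secOffset hα θ)).Iic_of_Iio ?_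
  have h := eventually_mul_nonneg_of_hasDerivAt (hK.hasDerivAt_inner_chordC_nrm hα θ)
    (hK.halfLen_pos hα θ)
  have e1 : inner ℝ (chordC K α θ) (nrm θ) = secOffset K α θ := inner_frame_nrm _ _ _
  rw [e1] at h
  filter_upwards [h.filter_mono nhdsWithin_le_nhds, self_mem_nhdsWithin] with τ h1 h2
  rcases (mem_Iic.1 h2).eq_or_lt with rfl | h2
  · exact e1.le
  · exact sub_nonpos.1 (nonpos_of_mul_nonneg_left h1 (sub_neg.2 h2))

lemma hasDerivWithinAt_chordB_of_chordC (hK : IsPlanarBody K) {α : ℝ} (hα : α ∈ Ioo (0 : ℝ) 1)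
    {θ : ℝ} {v : Plane} {I J : Set ℝ} (hIJ : ∀ τ ∈ I, τ + π ∈ J)
    (h : HasDerivWithinAt (chordC K (1 - α)) v J (θ + π)) :
    HasDerivWithinAt (chordB K α) v I θ := by
  have h1 : HasDerivWithinAt (fun τ => τ + π) 1 I θ := ((hasDerivAt_id θ).add_const π).hasDerivWithinAt
  have h2 := HasDerivWithinAt.scomp (h := fun τ => τ + π) θ h h1 hIJ
  rw [one_smul] at h2
  convert! h2 using 1
  ext1 τ; exact hK.chordB_eq_chordC hα τ

/-- The right velocity, as a multiple of a difference of slopes. -/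
noncomputable def velocityR (K : Set Plane) (α θ : ℝ) : ℝ :=
  halfLen K α θ / 2 * (slopeR K θ (secOffset K α θ) - slopeR K (θ + π) (-secOffset K α θ))

/-- The left velocity, as a multiple of a difference of slopes. -/
noncomputable def velocityL (K : Set Plane) (α θ : ℝ) : ℝ :=
  halfLen K α θ / 2 * (slopeL K θ (secOffset K α θ) - slopeL K (θ + π) (-secOffset K α θ))

/-- Seen from the reversed chord, `b` is also a last endpoint turning in the positive sense, so a
right slope appears at both ends. The normal components of the two derivatives cancel because the
half-lengths agree. -/
lemma IsPlanarBody.hasDerivWithinAt_mid_Ici (hK : IsPlanarBody K) {α : ℝ}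
    (hα : α ∈ Ioo (0 : ℝ) 1) (θ : ℝ) :
    HasDerivWithinAt (fun τ => mid K α τ) (velocityR K α θ • dir θ) (Ici θ) θ := by
  have hb := hK.hasDerivWithinAt_chordC_Ici (one_sub_mem_Ioo hα) (θ + π)
  rw [hK.halfLen_one_sub hα, hK.secOffset_one_sub hα, dir_add_pi, nrm_add_pi] at hb
  have hb := hasDerivWithinAt_chordB_of_chordC hK hα (I := Ici θ)
    (fun τ hτ => by simpa using hτ) hb
  convert! (hb.add (hK.hasDerivWithinAt_chordC_Ici hα θ)).const_smul (1 / 2 : ℝ) using 1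
  rw [velocityR]; module

lemma IsPlanarBody.hasDerivWithinAt_mid_Iic (hK : IsPlanarBody K) {α : ℝ}
    (hα : α ∈ Ioo (0 : ℝ) 1) (θ : ℝ) :
    HasDerivWithinAt (fun τ => mid K α τ) (velocityL K α θ • dir θ) (Iic θ) θ := by
  have hb := hK.hasDerivWithinAt_chordC_Iic (one_sub_mem_Ioo hα) (θ + π)
  rw [hK.halfLen_one_sub hα, hK.secOffset_one_sub hα, dir_add_pi, nrm_add_pi] at hb
  have hb := hasDerivWithinAt_chordB_of_chordC hK hα (I := Iic θ)
    (fun τ hτ => by simpa using hτ) hb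
  convert! (hb.add (hK.hasDerivWithinAt_chordC_Iic hα θ)).const_smul (1 / 2 : ℝ) using 1
  rw [velocityL]; module

lemma IsPlanarBody.velR_eq (hK : IsPlanarBody K) {α : ℝ} (hα : α ∈ Ioo (0 : ℝ) 1) (θ : ℝ) :
    velR K α θ = velocityR K α θ := by
  rw [velR, (hK.hasDerivWithinAt_mid_Ici hα θ).derivWithin (uniqueDiffWithinAt_Ici θ),
    inner_smul_left, inner_dir_dir]
  simp

lemma IsPlanarBody.velL_eq (hK : IsPlanarBody K) {α : ℝ} (hα : α ∈ Ioo (0 : ℝ) 1) (θ : ℝ) :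
    velL K α θ = velocityL K α θ := by
  rw [velL, (hK.hasDerivWithinAt_mid_Iic hα θ).derivWithin (uniqueDiffWithinAt_Iic θ),
    inner_smul_left, inner_dir_dir]
  simp

/-! ### Signs of the velocities -/

lemma uIcc_inter_Iio_nonempty {a b c : ℝ} : (uIcc a b ∩ Iio c).Nonempty ↔ a < c ∨ b < c := by
  constructor
  · rintro ⟨x, ⟨hx, -⟩, hc⟩
    exact inf_lt_iff.1 (lt_of_le_of_lt hx hc)
  · rintro (h | h)
    · exact ⟨a, left_mem_uIcc, h⟩
    · exact ⟨b, right_mem_uIcc, h⟩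

lemma uIcc_inter_Ioi_nonempty {a b c : ℝ} : (uIcc a b ∩ Ioi c).Nonempty ↔ c < a ∨ c < b := by
  constructor
  · rintro ⟨x, ⟨-, hx⟩, hc⟩
    exact lt_sup_iff.1 (lt_of_lt_of_le hc hx)
  · rintro (h | h)
    · exact ⟨a, left_mem_uIcc, h⟩
    · exact ⟨b, right_mem_uIcc, h⟩

lemma mem_backwards_iff (K : Set Plane) (α θ : ℝ) :
    θ ∈ backwards K α ↔ velL K α θ < 0 ∨ velR K α θ < 0 := uIcc_inter_Iio_nonempty

lemma mem_forwards_iff (K : Set Plane) (α θ : ℝ) :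
    θ ∈ forwards K α ↔ 0 < velL K α θ ∨ 0 < velR K α θ := uIcc_inter_Ioi_nonempty

lemma mem_zeros_iff (K : Set Plane) (α θ : ℝ) :
    θ ∈ zeros K α ↔ (velL K α θ ≤ 0 ∨ velR K α θ ≤ 0) ∧ (0 ≤ velL K α θ ∨ 0 ≤ velR K α θ) := by
  rw [← inf_le_iff, ← le_sup_iff]
  rfl

lemma IsPlanarBody.velR_neg_iff (hK : IsPlanarBody K) {α : ℝ} (hα : α ∈ Ioo (0 : ℝ) 1) (θ : ℝ) :
    velR K α θ < 0 ↔
      slopeR K θ (secOffset K α θ) < slopeR K (θ + π) (-secOffset K α θ) := by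
  have := hK.halfLen_pos hα θ
  rw [hK.velR_eq hα, velocityR, mul_neg_iff, sub_neg]
  have h2 : 0 < halfLen K α θ / 2 := by positivity
  simp [h2, h2.not_gt]

lemma IsPlanarBody.velR_pos_iff (hK : IsPlanarBody K) {α : ℝ} (hα : α ∈ Ioo (0 : ℝ) 1) (θ : ℝ) :
    0 < velR K α θ ↔
      slopeR K (θ + π) (-secOffset K α θ) < slopeR K θ (secOffset K α θ) := by
  have := hK.halfLen_pos hα θ
  rw [hK.velR_eq hα, velocityR, mul_pos_iff_of_pos_left (by positivity), sub_pos]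

lemma IsPlanarBody.velL_neg_iff (hK : IsPlanarBody K) {α : ℝ} (hα : α ∈ Ioo (0 : ℝ) 1) (θ : ℝ) :
    velL K α θ < 0 ↔
      slopeL K θ (secOffset K α θ) < slopeL K (θ + π) (-secOffset K α θ) := by
  have := hK.halfLen_pos hα θ
  rw [hK.velL_eq hα, velocityL, mul_neg_iff, sub_neg]
  have h2 : 0 < halfLen K α θ / 2 := by positivity
  simp [h2, h2.not_gt]

lemma IsPlanarBody.velL_pos_iff (hK : IsPlanarBody K) {α : ℝ} (hα : α ∈ Ioo (0 : ℝ) 1) (θ : ℝ) :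
    0 < velL K α θ ↔
      slopeL K (θ + π) (-secOffset K α θ) < slopeL K θ (secOffset K α θ) := by
  have := hK.halfLen_pos hα θ
  rw [hK.velL_eq hα, velocityL, mul_pos_iff_of_pos_left (by positivity), sub_pos]

lemma slopeR_add_pi_add_pi (K : Set Plane) (θ t : ℝ) : slopeR K (θ + π + π) t = slopeR K θ t := by
  have : hi K (θ + π + π) = hi K θ := funext (hi_add_pi_add_pi K θ)
  rw [slopeR, this]; rfl

lemma slopeL_add_pi_add_pi (K : Set Plane) (θ t : ℝ) : slopeL K (θ + π + π) t = slopeL K θ t := by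
  have : hi K (θ + π + π) = hi K θ := funext (hi_add_pi_add_pi K θ)
  rw [slopeL, this]; rfl

lemma IsPlanarBody.velR_one_sub (hK : IsPlanarBody K) {α : ℝ} (hα : α ∈ Ioo (0 : ℝ) 1) (θ : ℝ) :
    velR K (1 - α) (θ + π) = -velR K α θ := by
  rw [hK.velR_eq hα, hK.velR_eq (one_sub_mem_Ioo hα), velocityR, velocityR, hK.halfLen_one_sub hα,
    hK.secOffset_one_sub hα, slopeR_add_pi_add_pi, neg_neg]
  ring

lemma IsPlanarBody.velL_one_sub (hK : IsPlanarBody K) {α : ℝ} (hα : α ∈ Ioo (0 : ℝ) 1) (θ : ℝ) :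
    velL K (1 - α) (θ + π) = -velL K α θ := by
  rw [hK.velL_eq hα, hK.velL_eq (one_sub_mem_Ioo hα), velocityL, velocityL, hK.halfLen_one_sub hα,
    hK.secOffset_one_sub hα, slopeL_add_pi_add_pi, neg_neg]
  ring

lemma IsPlanarBody.velR_add_two_pi_mul (hK : IsPlanarBody K) {α : ℝ} (hα : α ∈ Ioo (0 : ℝ) 1)
    (θ : ℝ) (k : ℤ) : velR K α (θ + k * (2 * π)) = velR K α θ := by
  have h1 : hi K (θ + k * (2 * π)) = hi K θ := funext fun t => hi_add_two_pi_mul K θ t k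
  have h2 : hi K (θ + k * (2 * π) + π) = hi K (θ + π) := by
    rw [add_right_comm]; exact funext fun t => hi_add_two_pi_mul K _ t k
  rw [hK.velR_eq hα, hK.velR_eq hα]
  simp only [velocityR, halfLen, slopeR, lo, secOffset_add_two_pi_mul, h1, h2]

lemma IsPlanarBody.velL_add_two_pi_mul (hK : IsPlanarBody K) {α : ℝ} (hα : α ∈ Ioo (0 : ℝ) 1)
    (θ : ℝ) (k : ℤ) : velL K α (θ + k * (2 * π)) = velL K α θ := by
  have h1 : hi K (θ + k * (2 * π)) = hi K θ := funext fun t => hi_add_two_pi_mul K θ t k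
  have h2 : hi K (θ + k * (2 * π) + π) = hi K (θ + π) := by
    rw [add_right_comm]; exact funext fun t => hi_add_two_pi_mul K _ t k
  rw [hK.velL_eq hα, hK.velL_eq hα]
  simp only [velocityL, halfLen, slopeL, lo, secOffset_add_two_pi_mul, h1, h2]

lemma exists_mem_Icc_add_two_pi_mul (θ : ℝ) : ∃ k : ℤ, θ + k * (2 * π) ∈ Icc 0 (2 * π) := by
  obtain ⟨k, hk, -⟩ := existsUnique_add_zsmul_mem_Ico two_pi_pos θ 0
  refine ⟨k, ?_⟩
  rw [zsmul_eq_mul, zero_add] at hk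
  exact ⟨hk.1, hk.2.le⟩

/-! ### Monotonicity in the area parameter -/

/-- Going from the `α`-section to the `β`-section with `α < β`, slopes decrease at the last
endpoint. -/
lemma IsPlanarBody.slopeL_le_slopeR_secOffset (hK : IsPlanarBody K) {α β : ℝ}
    (hα : α ∈ Ioo (0 : ℝ) 1) (hβ : β ∈ Ioo (0 : ℝ) 1) (h : α < β) (θ : ℝ) :
    slopeL K θ (secOffset K β θ) ≤ slopeR K θ (secOffset K α θ) :=
  hK.slopeL_le_slopeR (hK.crosses_secOffset hα θ) (hK.crosses_secOffset hβ θ)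
    (hK.secOffset_lt hα hβ h θ)

/-- Going from the `α`-section to the `β`-section with `α < β`, slopes increase at the first
endpoint. -/
lemma IsPlanarBody.slopeL_le_slopeR_secOffset_add_pi (hK : IsPlanarBody K) {α β : ℝ}
    (hα : α ∈ Ioo (0 : ℝ) 1) (hβ : β ∈ Ioo (0 : ℝ) 1) (h : α < β) (θ : ℝ) :
    slopeL K (θ + π) (-secOffset K α θ) ≤ slopeR K (θ + π) (-secOffset K β θ) :=
  hK.slopeL_le_slopeR (hK.crosses_secOffset hβ θ).add_pi (hK.crosses_secOffset hα θ).add_pi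
    (neg_lt_neg (hK.secOffset_lt hα hβ h θ))

lemma IsPlanarBody.slopeR_le_slopeL_secOffset (hK : IsPlanarBody K) {α : ℝ}
    (hα : α ∈ Ioo (0 : ℝ) 1) (θ : ℝ) :
    slopeR K θ (secOffset K α θ) ≤ slopeL K θ (secOffset K α θ) :=
  hK.slopeR_le_slopeL (hK.crosses_secOffset hα θ)

lemma IsPlanarBody.slopeR_le_slopeL_secOffset_add_pi (hK : IsPlanarBody K) {α : ℝ}
    (hα : α ∈ Ioo (0 : ℝ) 1) (θ : ℝ) :
    slopeR K (θ + π) (-secOffset K α θ) ≤ slopeL K (θ + π) (-secOffset K α θ) :=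
  hK.slopeR_le_slopeL (hK.crosses_secOffset hα θ).add_pi

/-- From `α` to `β` the slope at `c` can only drop and the slope at `b` can only rise, so a strict
inequality between them survives. -/
lemma IsPlanarBody.velR_neg_of_lt (hK : IsPlanarBody K) {α β : ℝ} (hα : α ∈ Ioo (0 : ℝ) 1)
    (hβ : β ∈ Ioo (0 : ℝ) 1) (h : α < β) {θ : ℝ} (hv : velR K α θ < 0) : velR K β θ < 0 := by
  rw [hK.velR_neg_iff hα] at hv
  rw [hK.velR_neg_iff hβ]
  linarith [hK.slopeL_le_slopeR_secOffset hα hβ h θ, hK.slopeR_le_slopeL_secOffset hβ θ,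
    hK.slopeL_le_slopeR_secOffset_add_pi hα hβ h θ, hK.slopeR_le_slopeL_secOffset_add_pi hα θ]

lemma IsPlanarBody.velL_neg_of_lt (hK : IsPlanarBody K) {α β : ℝ} (hα : α ∈ Ioo (0 : ℝ) 1)
    (hβ : β ∈ Ioo (0 : ℝ) 1) (h : α < β) {θ : ℝ} (hv : velL K α θ < 0) : velL K β θ < 0 := by
  rw [hK.velL_neg_iff hα] at hv
  rw [hK.velL_neg_iff hβ]
  linarith [hK.slopeL_le_slopeR_secOffset hα hβ h θ, hK.slopeR_le_slopeL_secOffset hα θ,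
    hK.slopeL_le_slopeR_secOffset_add_pi hα hβ h θ, hK.slopeR_le_slopeL_secOffset_add_pi hβ θ]

lemma IsPlanarBody.velR_pos_of_lt (hK : IsPlanarBody K) {α β : ℝ} (hα : α ∈ Ioo (0 : ℝ) 1)
    (hβ : β ∈ Ioo (0 : ℝ) 1) (h : α < β) {θ : ℝ} (hv : 0 < velR K β θ) : 0 < velR K α θ := by
  rw [hK.velR_pos_iff hβ] at hv
  rw [hK.velR_pos_iff hα]
  linarith [hK.slopeL_le_slopeR_secOffset hα hβ h θ, hK.slopeR_le_slopeL_secOffset hβ θ,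
    hK.slopeL_le_slopeR_secOffset_add_pi hα hβ h θ, hK.slopeR_le_slopeL_secOffset_add_pi hα θ]

lemma IsPlanarBody.velL_pos_of_lt (hK : IsPlanarBody K) {α β : ℝ} (hα : α ∈ Ioo (0 : ℝ) 1)
    (hβ : β ∈ Ioo (0 : ℝ) 1) (h : α < β) {θ : ℝ} (hv : 0 < velL K β θ) : 0 < velL K α θ := by
  rw [hK.velL_pos_iff hβ] at hv
  rw [hK.velL_pos_iff hα]
  linarith [hK.slopeL_le_slopeR_secOffset hα hβ h θ, hK.slopeR_le_slopeL_secOffset hα θ,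
    hK.slopeL_le_slopeR_secOffset_add_pi hα hβ h θ, hK.slopeR_le_slopeL_secOffset_add_pi hβ θ]

lemma IsPlanarBody.setIB_upward (hK : IsPlanarBody K) {α β : ℝ} (hα : α ∈ setIB K)
    (h : α ≤ β) (hβ : β < 1) : β ∈ setIB K := by
  rcases h.eq_or_lt with rfl | h
  · exact hα
  obtain ⟨hα, θ, hθ⟩ := hα
  have hβ' : β ∈ Ioo (0 : ℝ) 1 := ⟨hα.1.trans h, hβ⟩
  refine ⟨hβ', θ, ?_⟩
  rw [mem_backwards_iff] at hθ ⊢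
  exact hθ.imp (hK.velL_neg_of_lt hα hβ' h) (hK.velR_neg_of_lt hα hβ' h)

lemma IsPlanarBody.one_sub_mem_setIF (hK : IsPlanarBody K) {α : ℝ} (h : α ∈ setIB K) :
    1 - α ∈ setIF K := by
  obtain ⟨hα, θ, hθ⟩ := h
  refine ⟨one_sub_mem_Ioo hα, θ + π, ?_⟩
  rw [mem_backwards_iff] at hθ
  rw [mem_forwards_iff, hK.velL_one_sub hα, hK.velR_one_sub hα, neg_pos, neg_pos]
  exact hθ

lemma IsPlanarBody.one_sub_mem_setIB (hK : IsPlanarBody K) {α : ℝ} (h : α ∈ setIF K) :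
    1 - α ∈ setIB K := by
  obtain ⟨hα, θ, hθ⟩ := h
  refine ⟨one_sub_mem_Ioo hα, θ + π, ?_⟩
  rw [mem_forwards_iff] at hθ
  rw [mem_backwards_iff, hK.velL_one_sub hα, hK.velR_one_sub hα, neg_lt_zero, neg_lt_zero]
  exact hθ

lemma IsPlanarBody.one_sub_mem_setIZ (hK : IsPlanarBody K) {α : ℝ} (h : α ∈ setIZ K) :
    1 - α ∈ setIZ K := by
  obtain ⟨hα, θ, hθ⟩ := h
  refine ⟨one_sub_mem_Ioo hα, θ + π, ?_⟩
  rw [mem_zeros_iff] at hθ ⊢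
  rw [hK.velL_one_sub hα, hK.velR_one_sub hα]
  simp only [neg_nonneg, neg_nonpos]
  exact hθ.symm

/-! ### Components of the midpoint -/

lemma inner_dir_dir_eq_cos (θ τ : ℝ) : inner ℝ (dir τ) (dir θ) = cos (τ - θ) := by
  rw [inner_plane, cos_sub]; rfl

lemma IsPlanarBody.continuous_mid (hK : IsPlanarBody K) {α : ℝ} (hα : α ∈ Ioo (0 : ℝ) 1) :
    Continuous (fun τ => mid K α τ) :=
  continuous_iff_continuousAt.2 fun θ =>
    ContinuousAt.comp (g := fun p : ℝ × ℝ => mid K p.1 p.2) (f := fun τ : ℝ => (α, τ))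
      (hK.continuousAt_mid hα θ) (by fun_prop)

lemma IsPlanarBody.hasDerivWithinAt_inner_mid_Ici (hK : IsPlanarBody K) {α : ℝ}
    (hα : α ∈ Ioo (0 : ℝ) 1) (θ τ : ℝ) :
    HasDerivWithinAt (fun τ => inner ℝ (mid K α τ) (dir θ)) (velR K α τ * cos (τ - θ)) (Ici τ) τ := by
  have := (hK.hasDerivWithinAt_mid_Ici hα τ).inner ℝ (hasDerivWithinAt_const τ (Ici τ) (dir θ))
  rw [inner_zero_right, zero_add, inner_smul_left, inner_dir_dir_eq_cos, ← hK.velR_eq hα] at this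
  exact this

lemma IsPlanarBody.hasDerivWithinAt_inner_mid_Iic (hK : IsPlanarBody K) {α : ℝ}
    (hα : α ∈ Ioo (0 : ℝ) 1) (θ τ : ℝ) :
    HasDerivWithinAt (fun τ => inner ℝ (mid K α τ) (dir θ)) (velL K α τ * cos (τ - θ)) (Iic τ) τ := by
  have := (hK.hasDerivWithinAt_mid_Iic hα τ).inner ℝ (hasDerivWithinAt_const τ (Iic τ) (dir θ))
  rw [inner_zero_right, zero_add, inner_smul_left, inner_dir_dir_eq_cos, ← hK.velL_eq hα] at this
  exact this

lemma cos_sub_pos_of_abs_le_one {θ τ : ℝ} (h : |τ - θ| ≤ 1) : 0 < cos (τ - θ) := by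
  have := abs_le.1 h
  exact cos_pos_of_mem_Ioo ⟨by linarith [pi_gt_three], by linarith [pi_gt_three]⟩

/-- The midpoint moves along `dir τ`, so its component on `dir θ` has right derivative `velR * cos
(τ - θ)`, and the cosine is positive within distance `1`. This recasts nonnegative velocities as a
closed condition. -/
lemma IsPlanarBody.monotoneOn_inner_mid (hK : IsPlanarBody K) {α : ℝ} (hα : α ∈ Ioo (0 : ℝ) 1)
    (h : ∀ θ, 0 ≤ velR K α θ) (θ : ℝ) :
    MonotoneOn (fun τ => inner ℝ (mid K α τ) (dir θ)) (Icc (θ - 1) (θ + 1)) := by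
  intro a ha b hb hab
  have hc : Continuous (fun τ => inner ℝ (mid K α τ) (dir θ)) :=
    (hK.continuous_mid hα).inner continuous_const
  refine image_le_of_deriv_right_le_deriv_boundary (f := fun _ => inner ℝ (mid K α a) (dir θ))
    (f' := fun _ => 0) (a := a) (b := b) (B := fun τ => inner ℝ (mid K α τ) (dir θ))
    (B' := fun τ => velR K α τ * cos (τ - θ)) continuousOn_const
    (fun x _ => hasDerivWithinAt_const _ _ _) le_rfl hc.continuousOn
    (fun x _ => hK.hasDerivWithinAt_inner_mid_Ici hα θ x) (fun x hx => ?_) (right_mem_Icc.2 hab)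
  exact mul_nonneg (h x) (cos_sub_pos_of_abs_le_one
    (abs_le.2 ⟨by linarith [hx.1, ha.1], by linarith [hx.2, hb.2]⟩)).le

lemma IsPlanarBody.velR_nonneg_of_monotoneOn (hK : IsPlanarBody K) {α : ℝ}
    (hα : α ∈ Ioo (0 : ℝ) 1) {θ : ℝ}
    (h : MonotoneOn (fun τ => inner ℝ (mid K α τ) (dir θ)) (Icc (θ - 1) (θ + 1))) :
    0 ≤ velR K α θ := by
  have h1 := (hK.hasDerivWithinAt_inner_mid_Ici hα θ θ).mono (Icc_subset_Ici_self : Icc θ (θ + 1) ⊆ Ici θ)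
  have h2 := (h.mono (Icc_subset_Icc_left (by linarith : θ - 1 ≤ θ))).derivWithin_nonneg (x := θ)
  rw [h1.derivWithin (uniqueDiffOn_Icc (by linarith) θ (left_mem_Icc.2 (by linarith)))] at h2
  simpa using h2

lemma IsPlanarBody.velL_nonneg_of_monotoneOn (hK : IsPlanarBody K) {α : ℝ}
    (hα : α ∈ Ioo (0 : ℝ) 1) {θ : ℝ}
    (h : MonotoneOn (fun τ => inner ℝ (mid K α τ) (dir θ)) (Icc (θ - 1) (θ + 1))) :
    0 ≤ velL K α θ := by
  have h1 := (hK.hasDerivWithinAt_inner_mid_Iic hα θ θ).mono (Icc_subset_Iic_self : Icc (θ - 1) θ ⊆ Iic θ)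
  have h2 := (h.mono (Icc_subset_Icc_right (by linarith : θ ≤ θ + 1))).derivWithin_nonneg (x := θ)
  rw [h1.derivWithin (uniqueDiffOn_Icc (by linarith) θ (right_mem_Icc.2 (by linarith)))] at h2
  simpa using h2

lemma notMem_setIB_iff {α : ℝ} (hα : α ∈ Ioo (0 : ℝ) 1) :
    α ∉ setIB K ↔ ∀ θ, 0 ≤ velL K α θ ∧ 0 ≤ velR K α θ := by
  simp only [setIB, mem_ofPred_eq, hα, true_and, not_nonempty_iff_eq_empty, eq_empty_iff_forall_notMem,
    mem_backwards_iff, not_or, not_lt]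

lemma notMem_setIF_iff {α : ℝ} (hα : α ∈ Ioo (0 : ℝ) 1) :
    α ∉ setIF K ↔ ∀ θ, velL K α θ ≤ 0 ∧ velR K α θ ≤ 0 := by
  simp only [setIF, mem_ofPred_eq, hα, true_and, not_nonempty_iff_eq_empty, eq_empty_iff_forall_notMem,
    mem_forwards_iff, not_or, not_lt]

/-- The midpoint, unlike its velocities, is known to be continuous in `α`. If no smaller parameter
moved backwards, monotonicity of the components would pass to the limit from below, and all
velocities at `α` would be nonnegative. -/
lemma IsPlanarBody.exists_lt_mem_setIB (hK : IsPlanarBody K) {α : ℝ} (h : α ∈ setIB K) :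
    ∃ β < α, β ∈ setIB K := by
  by_contra! hcon
  have hα := h.1
  refine (notMem_setIB_iff hα).2 (fun θ => ?_) h
  have hmono : MonotoneOn (fun τ => inner ℝ (mid K α τ) (dir θ)) (Icc (θ - 1) (θ + 1)) := by
    intro a ha b hb hab
    have hc : ∀ τ, Tendsto (fun β => inner ℝ (mid K β τ) (dir θ)) (𝓝[<] α)
        (𝓝 (inner ℝ (mid K α τ) (dir θ))) := fun τ => by
      have h1 : ContinuousAt (fun β => mid K β τ) α :=
        ContinuousAt.comp (g := fun p : ℝ × ℝ => mid K p.1 p.2) (f := fun β : ℝ => (β, τ))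
          (hK.continuousAt_mid hα τ) (by fun_prop)
      exact ((h1.inner continuousAt_const).tendsto).mono_left nhdsWithin_le_nhds
    refine le_of_tendsto_of_tendsto (hc a) (hc b) ?_
    filter_upwards [Ioo_mem_nhdsLT hα.1] with β hβ
    have hβ' : β ∈ Ioo (0 : ℝ) 1 := ⟨hβ.1, hβ.2.trans hα.2⟩
    exact hK.monotoneOn_inner_mid hβ'
      (fun θ => ((notMem_setIB_iff hβ').1 (hcon β hβ.2) θ).2) θ ha hb hab
  exact ⟨hK.velL_nonneg_of_monotoneOn hα hmono, hK.velR_nonneg_of_monotoneOn hα hmono⟩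

/-- If the envelope moves neither forwards nor backwards, it is reduced to a point. -/
lemma IsPlanarBody.mid_eq_mid (hK : IsPlanarBody K) {α : ℝ} (hα : α ∈ Ioo (0 : ℝ) 1)
    (hB : α ∉ setIB K) (hF : α ∉ setIF K) (θ τ : ℝ) : mid K α θ = mid K α τ := by
  rw [notMem_setIB_iff hα] at hB
  rw [notMem_setIF_iff hα] at hF
  have hd : ∀ x, HasDerivAt (fun τ => mid K α τ) 0 x := fun x => by
    have hl := hK.hasDerivWithinAt_mid_Iic hα x
    have hr := hK.hasDerivWithinAt_mid_Ici hα x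
    rw [← hK.velL_eq hα, le_antisymm (hF x).1 (hB x).1, zero_smul] at hl
    rw [← hK.velR_eq hα, le_antisymm (hF x).2 (hB x).2, zero_smul] at hr
    have := hl.union hr
    rwa [Iic_union_Ici, hasDerivWithinAt_univ] at this
  exact is_const_of_deriv_eq_zero (fun x => (hd x).differentiableAt) (fun x => (hd x).deriv) θ τ

lemma inner_mid_nrm (K : Set Plane) (α θ : ℝ) :
    inner ℝ (mid K α θ) (nrm θ) = secOffset K α θ := by
  rw [mid_eq, inner_frame_nrm]

lemma inner_mid_dir (K : Set Plane) (α θ : ℝ) : inner ℝ (mid K α θ) (dir θ) =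
    (lo K θ (secOffset K α θ) + hi K θ (secOffset K α θ)) / 2 := by
  rw [mid_eq, inner_frame_dir]

/-- Otherwise the envelope is reduced to a point. The `α`-sections of directions `0` and `π` pass
through it, hence are the same line reversed, and `α = 1 - α`. -/
lemma IsPlanarBody.mem_setIB_of_half_lt (hK : IsPlanarBody K) {α : ℝ} (h : 1 / 2 < α) (h1 : α < 1) :
    α ∈ setIB K := by
  by_contra hB
  have hα : α ∈ Ioo (0 : ℝ) 1 := ⟨by linarith, h1⟩
  have hF : α ∉ setIF K := fun hF =>
    hB (hK.setIB_upward (hK.one_sub_mem_setIB hF) (by linarith) h1)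
  have hc := hK.mid_eq_mid hα hB hF
  have h2 : secOffset K α (0 + π) = -secOffset K α 0 := by
    rw [← inner_mid_nrm, ← inner_mid_nrm, hc (0 + π) 0, nrm_add_pi, inner_neg_right]
  have h3 := hK.area_add_pi 0 (secOffset K α 0)
  rw [← h2, hK.area_secOffset hα, hK.area_secOffset hα] at h3
  nlinarith [hK.volume_pos]

lemma bddBelow_setIB (K : Set Plane) : BddBelow (setIB K) := ⟨0, fun _ h => h.1.1.le⟩
lemma bddBelow_setIZ (K : Set Plane) : BddBelow (setIZ K) := ⟨0, fun _ h => h.1.1.le⟩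

lemma IsPlanarBody.setIB_nonempty (hK : IsPlanarBody K) : (setIB K).Nonempty :=
  ⟨3 / 4, hK.mem_setIB_of_half_lt (by norm_num) (by norm_num)⟩

lemma alphaB_nonneg (K : Set Plane) : 0 ≤ alphaB K := Real.sInf_nonneg fun _ h => h.1.1.le
lemma alphaZ_nonneg (K : Set Plane) : 0 ≤ alphaZ K := Real.sInf_nonneg fun _ h => h.1.1.le

lemma IsPlanarBody.setIB_eq (hK : IsPlanarBody K) : setIB K = Ioo (alphaB K) 1 := by
  ext α
  constructor
  · intro h
    obtain ⟨β, hβ, hβ'⟩ := hK.exists_lt_mem_setIB h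
    exact ⟨(csInf_le (bddBelow_setIB K) hβ').trans_lt hβ, h.1.2⟩
  · rintro ⟨h, h1⟩
    obtain ⟨β, hβ, hlt⟩ := exists_lt_of_csInf_lt hK.setIB_nonempty h
    exact hK.setIB_upward hβ hlt.le h1

lemma IsPlanarBody.setIF_eq (hK : IsPlanarBody K) : setIF K = Ioo 0 (1 - alphaB K) := by
  ext α
  have h1 : α ∈ setIF K ↔ 1 - α ∈ setIB K :=
    ⟨hK.one_sub_mem_setIB, fun h => by simpa using hK.one_sub_mem_setIF h⟩
  rw [h1, hK.setIB_eq, mem_Ioo, mem_Ioo]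
  constructor <;> rintro ⟨h2, h3⟩ <;> constructor <;> linarith

lemma IsPlanarBody.alphaB_le_half (hK : IsPlanarBody K) : alphaB K ≤ 1 / 2 := by
  by_contra! h
  obtain ⟨α, h1, h2⟩ := exists_between (lt_min h (by norm_num : (1 / 2 : ℝ) < 1))
  have := hK.mem_setIB_of_half_lt h1 (h2.trans_le (min_le_right _ _))
  rw [hK.setIB_eq] at this
  exact absurd this.1 (not_lt.2 (h2.trans_le (min_le_left _ _)).le)

/-! ### Central symmetry -/

lemma IsPlanarBody.half_notMem_setIB_iff (hK : IsPlanarBody K) :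
    (1 / 2 : ℝ) ∉ setIB K ↔ alphaB K = 1 / 2 := by
  rw [hK.setIB_eq, mem_Ioo]
  have := hK.alphaB_le_half
  constructor
  · intro h
    by_contra hne
    exact h ⟨lt_of_le_of_ne this hne, by norm_num⟩
  · intro h
    rw [h]; simp

lemma half_mem_Ioo : (1 / 2 : ℝ) ∈ Ioo (0 : ℝ) 1 := by norm_num

/-- All halving chords have the same midpoint `p`. The one in the direction of `x - p` contains `x`,
hence also the reflection of `x`. -/
lemma IsPlanarBody.isCentrallySymmetric_of_alphaB_eq (hK : IsPlanarBody K) (h : alphaB K = 1 / 2) :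
    IsCentrallySymmetric K := by
  have hB := hK.half_notMem_setIB_iff.2 h
  have hF : (1 / 2 : ℝ) ∉ setIF K := fun hF => hB (by
    have := hK.one_sub_mem_setIB hF
    norm_num at this ⊢
    exact this)
  have hc := hK.mid_eq_mid half_mem_Ioo hB hF
  refine ⟨mid K (1 / 2) 0, fun x hx => ?_⟩
  set p := mid K (1 / 2) 0
  obtain ⟨θ, hθ⟩ := exists_eq_smul_dir (x - p)
  have hp : mid K (1 / 2) θ = p := hc θ 0
  have hT : secOffset K (1 / 2) θ = inner ℝ p (nrm θ) := by rw [← hp, inner_mid_nrm]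
  have hcr := hK.crosses_secOffset half_mem_Ioo θ
  have hm := inner_mid_dir K (1 / 2) θ
  rw [hp] at hm
  have hx' : x = p + ‖x - p‖ • dir θ := by rw [← hθ]; abel
  have hxn : inner ℝ x (nrm θ) = secOffset K (1 / 2) θ := by
    rw [hx', hT, inner_add_left, inner_smul_left, inner_dir_nrm]; simp
  have hxd : inner ℝ x (dir θ) = inner ℝ p (dir θ) + ‖x - p‖ := by
    conv_lhs => rw [hx', inner_add_left, inner_smul_left, inner_dir_dir]
    simp
  have h1 := hK.inner_le_hi θ hx
  have h2 := norm_nonneg (x - p)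
  rw [hxn, hxd] at h1
  have hmem := hK.mem_of_lo_le_of_le_hi (s := inner ℝ p (dir θ) - ‖x - p‖) hcr.mem_shadow
    (by linarith) (by linarith [hK.lo_lt_hi hcr])
  have hr : Equiv.pointReflection p x = p - ‖x - p‖ • dir θ := by
    rw [← hθ, Equiv.pointReflection_apply, vsub_eq_sub, vadd_eq_add]; abel
  convert! hmem using 1
  rw [hr]
  apply frame_ext θ
  · rw [inner_frame_dir, inner_sub_left, inner_smul_left, inner_dir_dir]; simp
  · rw [inner_frame_nrm, inner_sub_left, inner_smul_left, inner_dir_nrm, hT]; simp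

/-- Reflection in `p` exchanges the two sides of any line through `p`, so that line halves the area,
and it reverses the chord, so `p` is the midpoint. The envelope is constant and has zero velocity.
-/
lemma IsPlanarBody.alphaB_eq_of_isCentrallySymmetric (hK : IsPlanarBody K)
    (h : IsCentrallySymmetric K) : alphaB K = 1 / 2 := by
  obtain ⟨p, hp⟩ := h
  have hrefl : ∀ x : Plane, Equiv.pointReflection p x = p + p - x := fun x => by
    rw [Equiv.pointReflection_apply, vsub_eq_sub, vadd_eq_add]; abel
  have hp' : ∀ x, p + p - x ∈ K ↔ x ∈ K := fun x =>
    ⟨fun h => by have := hp _ h; rw [hrefl] at this; simpa using this,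
      fun h => by have := hp _ h; rwa [hrefl] at this⟩
  have hsec : ∀ θ, secOffset K (1 / 2) θ = inner ℝ p (nrm θ) := fun θ => by
    apply hK.secOffset_eq half_mem_Ioo
    change area K θ _ = _
    have h1 := hK.area_add_pi θ (inner ℝ p (nrm θ))
    have h2 : area K (θ + π) (-inner ℝ p (nrm θ)) = area K θ (inner ℝ p (nrm θ)) := by
      have hpres : MeasurePreserving (fun x : Plane => p + p - x) volume volume :=
        Measure.measurePreserving_sub_left volume (p + p)
      rw [area, area, measureReal_def, measureReal_def, ← hpres.measure_preimage
        (hK.measurableSet.inter (isClosed_rightHalf θ _).measurableSet).nullMeasurableSet]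
      congr 2
      ext x
      simp only [mem_inter_iff, rightHalf, mem_ofPred_eq, mem_preimage, hp', nrm_add_pi,
        inner_neg_right, inner_sub_left, inner_add_left]
      refine and_congr_right fun _ => ?_
      constructor <;> intro h <;> linarith
    linarith
  have hmid : ∀ θ, mid K (1 / 2) θ = p := fun θ => by
    have hcr := hK.crosses_secOffset half_mem_Ioo θ
    apply frame_ext θ
    · rw [inner_mid_dir]
      have key : ∀ s, s • dir θ + secOffset K (1 / 2) θ • nrm θ ∈ K →
          (2 * inner ℝ p (dir θ) - s) • dir θ + secOffset K (1 / 2) θ • nrm θ ∈ K := fun s hs => by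
        rw [← hp'] at hs
        convert! hs using 1
        conv_rhs => rw [frame_expand θ p, hsec]
        rw [hsec]
        module
      have h1 := hK.le_hi (key _ (hK.lo_mem hcr.mem_shadow))
      have h2 := hK.lo_le (key _ (hK.hi_mem hcr.mem_shadow))
      linarith
    · rw [inner_mid_nrm, hsec]
  rw [← hK.half_notMem_setIB_iff, notMem_setIB_iff half_mem_Ioo]
  intro θ
  have hconst : (fun τ => mid K (1 / 2) τ) = fun _ => p := funext hmid
  rw [velL, velR, hconst]
  simp

lemma IsPlanarBody.alphaB_eq_half_iff (hK : IsPlanarBody K) :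
    alphaB K = 1 / 2 ↔ IsCentrallySymmetric K :=
  ⟨hK.isCentrallySymmetric_of_alphaB_eq, hK.alphaB_eq_of_isCentrallySymmetric⟩

/-! ### The set `I_Z` -/

lemma nonpos_of_hasDerivWithinAt_Ici_of_le {f : ℝ → ℝ} {f' a b : ℝ} (hab : a < b)
    (hf : HasDerivWithinAt f f' (Ici a) a) (h : ∀ x ∈ Icc a b, f x ≤ f a) : f' ≤ 0 := by
  have h1 := (hasDerivWithinAt_iff_tendsto_slope' self_notMem_Ioi).1 hf.Ioi_of_Ici
  refine le_of_tendsto h1 ?_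
  filter_upwards [Ioo_mem_nhdsGT hab] with x hx
  rw [slope_def_field]
  exact div_nonpos_of_nonpos_of_nonneg (sub_nonpos.2 (h x ⟨hx.1.le, hx.2.le⟩)) (sub_pos.2 hx.1).le

lemma nonneg_of_hasDerivWithinAt_Iic_of_le {f : ℝ → ℝ} {f' a b : ℝ} (hab : a < b)
    (hf : HasDerivWithinAt f f' (Iic b) b) (h : ∀ x ∈ Icc a b, f x ≤ f b) : 0 ≤ f' := by
  have h1 := (hasDerivWithinAt_iff_tendsto_slope' self_notMem_Iio).1 hf.Iio_of_Iic
  refine ge_of_tendsto h1 ?_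
  filter_upwards [Ioo_mem_nhdsLT hab] with x hx
  rw [slope_def_field]
  exact div_nonneg_of_nonpos (sub_nonpos.2 (h x ⟨hx.1.le, hx.2.le⟩)) (sub_neg.2 hx.2).le

/-- Darboux property of the velocity. -/
lemma IsPlanarBody.exists_mem_zeros (hK : IsPlanarBody K) {α : ℝ} (hα : α ∈ Ioo (0 : ℝ) 1)
    {a b : ℝ} (hab : a ≤ b) (hab1 : b ≤ a + 1) (ha : 0 < velL K α a ∧ 0 < velR K α a)
    (hb : velL K α b < 0 ∧ velR K α b < 0) : ∃ θ, θ ∈ zeros K α := by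
  by_contra! hcon
  have hlt : a < b := by
    rcases hab.eq_or_lt with rfl | h
    · exact absurd ha.1 hb.1.not_gt
    · exact h
  have hc : Continuous (fun τ => inner ℝ (mid K α τ) (dir a)) :=
    (hK.continuous_mid hα).inner continuous_const
  -- At an interior maximum the left derivative is nonnegative and the right one nonpositive, so `0`
  -- lies between the velocities. The signs at `a` and `b` keep the maximum away from the ends.
  obtain ⟨s, hs, hmax⟩ := isCompact_Icc.exists_isMaxOn (nonempty_Icc.2 hab) hc.continuousOn
  have hcos : 0 < cos (s - a) :=
    cos_sub_pos_of_abs_le_one (abs_le.2 ⟨by linarith [hs.1], by linarith [hs.2]⟩)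
  have hR : s < b → velR K α s ≤ 0 := fun h => by
    have := nonpos_of_hasDerivWithinAt_Ici_of_le h (hK.hasDerivWithinAt_inner_mid_Ici hα a s)
      fun x hx => hmax ⟨hs.1.trans hx.1, hx.2⟩
    exact nonpos_of_mul_nonpos_left this hcos
  have hL : a < s → 0 ≤ velL K α s := fun h => by
    have := nonneg_of_hasDerivWithinAt_Iic_of_le h (hK.hasDerivWithinAt_inner_mid_Iic hα a s)
      fun x hx => hmax ⟨hx.1, hx.2.trans hs.2⟩
    exact nonneg_of_mul_nonneg_left this hcos
  rcases hs.1.eq_or_lt with rfl | has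
  · exact absurd ha.2 (hR hlt).not_gt
  rcases hs.2.eq_or_lt with rfl | hsb
  · exact absurd hb.1 (hL hlt).not_gt
  exact hcon s ((mem_zeros_iff K α s).2 ⟨Or.inr (hR hsb), Or.inl (hL has)⟩)

lemma IsPlanarBody.exists_mem_zeros_of_abs (hK : IsPlanarBody K) {α : ℝ} (hα : α ∈ Ioo (0 : ℝ) 1)
    {a b : ℝ} (hab : |a - b| ≤ 1) (ha : 0 < velL K α a ∧ 0 < velR K α a)
    (hb : velL K α b < 0 ∧ velR K α b < 0) : ∃ θ, θ ∈ zeros K α := by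
  have h1 := abs_le.1 hab
  rcases le_total a b with h | h
  · exact hK.exists_mem_zeros hα h (by linarith) ha hb
  -- When the negative direction comes first, reversing the chords swaps the signs and reduces to
  -- the other case.
  · obtain ⟨θ, hθ⟩ := hK.exists_mem_zeros (one_sub_mem_Ioo hα) (a := b + π) (b := a + π)
      (by linarith) (by linarith)
      (by rw [hK.velL_one_sub hα, hK.velR_one_sub hα]; simpa using hb)
      (by rw [hK.velL_one_sub hα, hK.velR_one_sub hα]; simpa using ha)
    have : 1 - α ∈ setIZ K := ⟨one_sub_mem_Ioo hα, θ, hθ⟩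
    have := hK.one_sub_mem_setIZ this
    rw [sub_sub_cancel] at this
    exact this.2

/-- The envelope of the `α`-sections moves strictly forwards in all directions. -/
def IsForward (K : Set Plane) (α : ℝ) : Prop := ∀ θ, 0 < velL K α θ ∧ 0 < velR K α θ

lemma notMem_zeros_iff {α θ : ℝ} : θ ∉ zeros K α ↔
    (0 < velL K α θ ∧ 0 < velR K α θ) ∨ (velL K α θ < 0 ∧ velR K α θ < 0) := by
  rw [mem_zeros_iff, not_and_or, not_or, not_or]
  simp only [not_le]

lemma IsPlanarBody.isForward_one_sub_iff (hK : IsPlanarBody K) {α : ℝ} (hα : α ∈ Ioo (0 : ℝ) 1) :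
    IsForward K (1 - α) ↔ ∀ θ, velL K α θ < 0 ∧ velR K α θ < 0 := by
  constructor
  · intro h θ
    have := h (θ + π)
    rw [hK.velL_one_sub hα, hK.velR_one_sub hα] at this
    simpa using this
  · intro h θ
    have := h (θ - π)
    rw [← neg_pos, ← neg_pos (a := velR K α _), ← hK.velL_one_sub hα, ← hK.velR_one_sub hα,
      sub_add_cancel] at this
    exact this

/-- Without zeros, every direction has both velocities positive or both negative. By the Darboux
property the sign cannot change within distance `1`, so each class is open and connectedness of `ℝ`
leaves only one. -/
lemma IsPlanarBody.notMem_setIZ_iff (hK : IsPlanarBody K) {α : ℝ} (hα : α ∈ Ioo (0 : ℝ) 1) :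
    α ∉ setIZ K ↔ IsForward K α ∨ IsForward K (1 - α) := by
  have h0 : α ∉ setIZ K ↔ ∀ θ, θ ∉ zeros K α := by
    simp only [setIZ, mem_ofPred_eq, hα, true_and, not_nonempty_iff_eq_empty,
      eq_empty_iff_forall_notMem]
  rw [h0, hK.isForward_one_sub_iff hα]
  constructor
  · intro h
    set P : Set ℝ := {θ | 0 < velL K α θ ∧ 0 < velR K α θ}
    have hPc : ∀ θ, θ ∉ P → velL K α θ < 0 ∧ velR K α θ < 0 := fun θ hθ =>
      (notMem_zeros_iff.1 (h θ)).resolve_left hθ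
    have hP : IsOpen P := by
      rw [Metric.isOpen_iff]
      refine fun θ hθ => ⟨1, one_pos, fun τ hτ => ?_⟩
      by_contra hcon
      rw [Metric.mem_ball, Real.dist_eq, abs_sub_comm] at hτ
      obtain ⟨x, hx⟩ := hK.exists_mem_zeros_of_abs hα hτ.le hθ (hPc τ hcon)
      exact h x hx
    have hPo : IsOpen Pᶜ := by
      rw [Metric.isOpen_iff]
      refine fun θ hθ => ⟨1, one_pos, fun τ hτ hcon => ?_⟩
      rw [Metric.mem_ball, Real.dist_eq] at hτ
      obtain ⟨x, hx⟩ := hK.exists_mem_zeros_of_abs hα hτ.le hcon (hPc θ hθ)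
      exact h x hx
    rcases isClopen_iff.1 ⟨isOpen_compl_iff.1 hPo, hP⟩ with h1 | h1
    · exact Or.inr fun θ => hPc θ (by rw [h1]; exact notMem_empty θ)
    · exact Or.inl fun θ => by
        have : θ ∈ P := by rw [h1]; trivial
        exact this
  · rintro (h | h) θ
    · exact notMem_zeros_iff.2 (Or.inl (h θ))
    · exact notMem_zeros_iff.2 (Or.inr (h θ))

lemma IsPlanarBody.isForward_of_le (hK : IsPlanarBody K) {α β : ℝ} (hα : α ∈ Ioo (0 : ℝ) 1)
    (hβ : β ∈ Ioo (0 : ℝ) 1) (h : α ≤ β) (hf : IsForward K β) : IsForward K α := by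
  rcases h.eq_or_lt with rfl | h
  · exact hf
  · exact fun θ => ⟨hK.velL_pos_of_lt hα hβ h (hf θ).1, hK.velR_pos_of_lt hα hβ h (hf θ).2⟩

/-- Otherwise the halving sections would move forwards in every direction, which reversal of the
chords contradicts. -/
lemma IsPlanarBody.lt_half_of_isForward (hK : IsPlanarBody K) {α : ℝ} (hα : α ∈ Ioo (0 : ℝ) 1)
    (hf : IsForward K α) : α < 1 / 2 := by
  by_contra! hle
  have h := hK.isForward_of_le half_mem_Ioo hα hle hf
  have h2 : IsForward K (1 - 1 / 2) := by norm_num; norm_num at h; exact h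
  exact absurd (h 0).1 (((hK.isForward_one_sub_iff half_mem_Ioo).1 h2) 0).1.not_gt

lemma IsPlanarBody.mem_setIZ_of_le_half (hK : IsPlanarBody K) {α : ℝ} (hα : α ∈ Ioo (0 : ℝ) 1)
    (h : α ≤ 1 / 2) (hf : ¬ IsForward K α) : α ∈ setIZ K := by
  by_contra hZ
  rcases (hK.notMem_setIZ_iff hα).1 hZ with h1 | h1
  · exact hf h1
  · linarith [hK.lt_half_of_isForward (one_sub_mem_Ioo hα) h1]

lemma IsPlanarBody.half_mem_setIZ (hK : IsPlanarBody K) : (1 / 2 : ℝ) ∈ setIZ K :=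
  hK.mem_setIZ_of_le_half half_mem_Ioo le_rfl fun h =>
    lt_irrefl _ (hK.lt_half_of_isForward half_mem_Ioo h)

lemma IsPlanarBody.not_isForward (hK : IsPlanarBody K) {α : ℝ} (h : α ∈ setIZ K) :
    ¬ IsForward K α := fun hf => (hK.notMem_setIZ_iff h.1).2 (Or.inl hf) h

lemma IsPlanarBody.alphaZ_le_half (hK : IsPlanarBody K) : alphaZ K ≤ 1 / 2 :=
  csInf_le (bddBelow_setIZ K) hK.half_mem_setIZ

lemma alphaZ_le_of_mem {α : ℝ} (h : α ∈ setIZ K) : alphaZ K ≤ α := csInf_le (bddBelow_setIZ K) h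

/-- By symmetry `β ≤ 1/2` may be assumed. There only `IsForward` could exclude `β`, and it would
pass to smaller members of `I_Z`. -/
lemma IsPlanarBody.mem_setIZ_of_lt (hK : IsPlanarBody K) {β : ℝ} (h : alphaZ K < β)
    (h1 : β < 1 - alphaZ K) : β ∈ setIZ K := by
  wlog hle : β ≤ 1 / 2 generalizing β
  · have := hK.one_sub_mem_setIZ (this (β := 1 - β) (by linarith) (by linarith) (by linarith))
    rwa [sub_sub_cancel] at this
  obtain ⟨α, hα, hlt⟩ := exists_lt_of_csInf_lt ⟨_, hK.half_mem_setIZ⟩ h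
  have hβ : β ∈ Ioo (0 : ℝ) 1 := ⟨hα.1.1.trans hlt, by linarith⟩
  exact hK.mem_setIZ_of_le_half hβ hle fun hf =>
    hK.not_isForward hα (hK.isForward_of_le hα.1 hβ hlt.le hf)

lemma IsPlanarBody.setIZ_eq_Icc (hK : IsPlanarBody K) (h : alphaZ K ∈ setIZ K) :
    setIZ K = Icc (alphaZ K) (1 - alphaZ K) := by
  ext β
  constructor
  · intro hβ
    exact ⟨alphaZ_le_of_mem hβ, by linarith [alphaZ_le_of_mem (hK.one_sub_mem_setIZ hβ)]⟩
  · rintro ⟨h1, h2⟩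
    rcases h1.eq_or_lt with rfl | h1
    · exact h
    rcases h2.eq_or_lt with rfl | h2
    · exact hK.one_sub_mem_setIZ h
    · exact hK.mem_setIZ_of_lt h1 h2

lemma IsPlanarBody.setIZ_eq_Ioo (hK : IsPlanarBody K) (h : alphaZ K ∉ setIZ K) :
    setIZ K = Ioo (alphaZ K) (1 - alphaZ K) := by
  ext β
  constructor
  · intro hβ
    have h1 := alphaZ_le_of_mem hβ
    have h2 := alphaZ_le_of_mem (hK.one_sub_mem_setIZ hβ)
    refine ⟨lt_of_le_of_ne h1 fun e => h (e ▸ hβ), ?_⟩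
    have : alphaZ K ≠ 1 - β := fun e => h (e ▸ hK.one_sub_mem_setIZ hβ)
    have := lt_of_le_of_ne h2 this
    linarith
  · rintro ⟨h1, h2⟩
    exact hK.mem_setIZ_of_lt h1 h2

lemma IsPlanarBody.alphaZ_le_alphaB (hK : IsPlanarBody K) : alphaZ K ≤ alphaB K := by
  refine le_csInf hK.setIB_nonempty fun β hβ => ?_
  rcases le_total β (1 / 2) with h | h
  · refine alphaZ_le_of_mem (hK.mem_setIZ_of_le_half hβ.1 h fun hf => ?_)
    refine (notMem_setIB_iff hβ.1).2 (fun θ => ⟨(hf θ).1.le, (hf θ).2.le⟩) hβ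
  · exact hK.alphaZ_le_half.trans h

lemma IsPlanarBody.alphaZ_eq_zero_iff (hK : IsPlanarBody K) :
    alphaZ K = 0 ↔ ∀ α ∈ Ioo (0 : ℝ) 1, ¬ IsForward K α := by
  constructor
  · intro h α hα hf
    have hlt := hK.lt_half_of_isForward hα hf
    have : α ∈ setIZ K := hK.mem_setIZ_of_lt (by rw [h]; exact hα.1) (by rw [h]; linarith)
    exact hK.not_isForward this hf
  · intro h
    refine le_antisymm (le_of_forall_gt_imp_ge_of_dense fun ε hε => ?_) (alphaZ_nonneg K)
    have h1 : 0 < min ε (1 / 2) := by positivity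
    have h2 : min ε (1 / 2) ≤ 1 / 2 := min_le_right _ _
    have h3 : min ε (1 / 2) ∈ Ioo (0 : ℝ) 1 := ⟨h1, by linarith⟩
    exact (alphaZ_le_of_mem (hK.mem_setIZ_of_le_half h3 h2 (h _ h3))).trans (min_le_left _ _)

/-! ### Parallel segments -/

lemma mem_frontier_of_mem_of_le {v p : Plane} (hv : v ≠ 0) (hp : p ∈ K)
    (h : ∀ x ∈ K, inner ℝ p v ≤ inner ℝ x v) : p ∈ frontier K := by
  refine ⟨subset_closure hp, fun hpi => ?_⟩
  obtain ⟨ε, hε, hx⟩ := exists_add_smul_mem_interior hpi v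
  have := h _ (interior_subset (hx (-ε) (by rw [abs_neg, abs_of_pos hε])))
  rw [inner_add_left, inner_smul_left, real_inner_self_eq_norm_sq] at this
  simp at this
  have h1 : 0 < ε * ‖v‖ ^ 2 := by positivity
  linarith

lemma IsPlanarBody.frontier_subset (hK : IsPlanarBody K) : frontier K ⊆ K :=
  hK.isCompact.isClosed.frontier_subset

lemma segment_subset_frontier (hK : IsPlanarBody K) {v a b : Plane} {r : ℝ} (hv : v ≠ 0)
    (ha : a ∈ K) (hb : b ∈ K) (hav : inner ℝ a v = r) (hbv : inner ℝ b v = r)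
    (h : ∀ x ∈ K, r ≤ inner ℝ x v) : segment ℝ a b ⊆ frontier K := by
  intro x hx
  refine mem_frontier_of_mem_of_le hv (hK.convex.segment_subset ha hb hx) fun y hy => ?_
  obtain ⟨s, t, hs, ht, hst, rfl⟩ := hx
  rw [inner_add_left, inner_smul_left, inner_smul_left, hav, hbv]
  have := h y hy
  simp only [conj_trivial]
  rwa [← add_mul, hst, one_mul]

/-- The line of points having a given scalar product with a nonzero vector. -/
lemma setOf_inner_eq_line {v : Plane} (hv : v ≠ 0) {θ : ℝ} (hθ : v = ‖v‖ • nrm θ) (r : ℝ) :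
    {x : Plane | inner ℝ x v = r} = line θ (r / ‖v‖) := by
  have h0 : 0 < ‖v‖ := norm_pos_iff.2 hv
  ext x
  rw [line, mem_ofPred_eq, mem_ofPred_eq, eq_div_iff h0.ne']
  conv_lhs => rw [hθ, inner_smul_right, mul_comm]

lemma areDistinctParallel_setOf {v : Plane} {r r' : ℝ} (hv : v ≠ 0) (h : r ≠ r') :
    AreDistinctParallel {x : Plane | inner ℝ x v = r} {x : Plane | inner ℝ x v = r'} := by
  obtain ⟨θ, hθ⟩ := exists_eq_smul_nrm v
  refine ⟨fun he => h ?_, θ, r / ‖v‖, r' / ‖v‖, setOf_inner_eq_line hv hθ r,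
    setOf_inner_eq_line hv hθ r'⟩
  have hmem : (r / ‖v‖ ^ 2) • v ∈ {x : Plane | inner ℝ x v = r} := by
    have h0 : 0 < ‖v‖ := norm_pos_iff.2 hv
    rw [mem_ofPred_eq, inner_smul_left, real_inner_self_eq_norm_sq]
    simp only [conj_trivial]
    field_simp
  have h1 : inner ℝ ((r / ‖v‖ ^ 2) • v) v = r := hmem
  rw [he] at hmem
  exact h1.symm.trans hmem

/-- At each end the tangents at `t` and at `t'` have the same slope `k`, so the endpoint stays on
one line of slope `k` between these heights. The two lines bound a strip containing `K`, so the
traced segments lie on its boundary. -/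
lemma IsPlanarBody.hasParallelSegments (hK : IsPlanarBody K) {θ t t' k : ℝ} (hlt : t < t')
    (h : Crosses K θ t) (h' : Crosses K θ t') (h1 : slopeR K θ t = k)
    (h2 : slopeL K θ t' = k) (h3 : slopeL K (θ + π) (-t) = k) (h4 : slopeR K (θ + π) (-t') = k)
    (h5 : k ≤ slopeL K θ t) (h6 : slopeR K (θ + π) (-t) ≤ k) :
    HasParallelSegments (frontier K) := by
  set v : Plane := dir θ - k • nrm θ with hv
  have hvin : ∀ x : Plane, inner ℝ x v = inner ℝ x (dir θ) - k * inner ℝ x (nrm θ) := fun x => by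
    rw [hv, inner_sub_right, inner_smul_right]
  have hv0 : v ≠ 0 := fun h0 => by
    have := hvin (dir θ)
    rw [h0, inner_zero_right, inner_dir_dir, inner_dir_nrm] at this
    norm_num at this
  have hval : ∀ s r, inner ℝ (s • dir θ + r • nrm θ) v = s - k * r := fun s r => by
    rw [hvin, inner_frame_dir, inner_frame_nrm]
  have hhi : hi K θ t' - k * t' = hi K θ t - k * t := by
    have e1 := hK.hi_le_of_slopeR_le h h'.mem_shadow hlt.le h1.le
    have e2 := hK.hi_le_of_le_slopeL h' h.mem_shadow hlt.le h2.ge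
    linarith
  have hlo : lo K θ t' - k * t' = lo K θ t - k * t := by
    have e1 := hK.hi_le_of_le_slopeL h.add_pi h'.add_pi.mem_shadow (by linarith) h3.ge
    have e2 := hK.hi_le_of_slopeR_le h'.add_pi h.add_pi.mem_shadow (by linarith) h4.le
    rw [hi_add_pi, hi_add_pi] at e1 e2
    linarith
  have hle : ∀ x ∈ K, inner ℝ x v ≤ hi K θ t - k * t := fun x hx => by
    rw [hvin]
    rcases le_total t (inner ℝ x (nrm θ)) with hxt | hxt
    · linarith [hK.inner_le_of_slopeR_le h h1.le hx hxt]
    · linarith [hK.inner_le_of_le_slopeL h h5 hx hxt]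
  have hge : ∀ x ∈ K, lo K θ t - k * t ≤ inner ℝ x v := fun x hx => by
    rw [hvin]
    rcases le_total t (inner ℝ x (nrm θ)) with hxt | hxt
    · linarith [hK.le_inner_of_le_slopeL_add_pi h h3.ge hx hxt]
    · linarith [hK.le_inner_of_slopeR_add_pi_le h h6 hx hxt]
  have hne : ∀ s s' : ℝ, s • dir θ + t • nrm θ ≠ s' • dir θ + t' • nrm θ := fun s s' he => by
    have := congrArg (fun x : Plane => inner ℝ x (nrm θ)) he
    simp only [inner_frame_nrm] at this
    exact hlt.ne this
  refine ⟨lo K θ t • dir θ + t • nrm θ, lo K θ t' • dir θ + t' • nrm θ,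
    hi K θ t • dir θ + t • nrm θ, hi K θ t' • dir θ + t' • nrm θ, hne _ _, hne _ _, ?_, ?_,
    {x : Plane | inner ℝ x v = lo K θ t - k * t}, {x : Plane | inner ℝ x v = hi K θ t - k * t},
    areDistinctParallel_setOf hv0 (by linarith [hK.lo_lt_hi h]), ?_, ?_, ?_, ?_⟩
  · exact segment_subset_frontier hK hv0 (hK.lo_mem h.mem_shadow) (hK.lo_mem h'.mem_shadow)
      (hval _ _) ((hval _ _).trans hlo) hge
  · refine segment_subset_frontier hK (v := -v) (r := -(hi K θ t - k * t)) (neg_ne_zero.2 hv0)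
      (hK.hi_mem h.mem_shadow) (hK.hi_mem h'.mem_shadow) ?_ ?_ fun x hx => ?_
    · rw [inner_neg_right, hval]
    · rw [inner_neg_right, hval, hhi]
    · rw [inner_neg_right]; exact neg_le_neg (hle x hx)
  · exact hval _ _
  · exact (hval _ _).trans hlo
  · exact hval _ _
  · exact (hval _ _).trans hhi

lemma IsPlanarBody.hasParallelSegments_of_alphaZ_ne (hK : IsPlanarBody K)
    (h : alphaZ K ≠ alphaB K) : HasParallelSegments (frontier K) := by
  have hlt := lt_of_le_of_ne hK.alphaZ_le_alphaB h
  have hhalf := hK.alphaB_le_half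
  obtain ⟨α, h1, h2⟩ := exists_between hlt
  obtain ⟨β, h3, h4⟩ := exists_between h2
  have hαZ : α ∈ setIZ K := hK.mem_setIZ_of_lt h1 (by linarith)
  have hα := hαZ.1
  have hβ : β ∈ Ioo (0 : ℝ) 1 := ⟨hα.1.trans h3, by linarith⟩
  have hnB : ∀ γ, γ < alphaB K → γ ∉ setIB K := fun γ hγ hB => by
    rw [hK.setIB_eq] at hB
    exact absurd hB.1 hγ.not_gt
  obtain ⟨-, θ, hθ⟩ := hαZ
  rw [mem_zeros_iff] at hθ
  have hbα := (notMem_setIB_iff hα).1 (hnB α h2) θ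
  have hbβ := (notMem_setIB_iff hβ).1 (hnB β h4) θ
  rw [← not_lt, ← not_lt, hK.velL_neg_iff hβ, hK.velR_neg_iff hβ, not_lt, not_lt] at hbβ
  rw [← not_lt, ← not_lt, hK.velL_neg_iff hα, hK.velR_neg_iff hα, not_lt, not_lt] at hbα
  have hz := hθ.1
  rw [← not_lt, ← not_lt, hK.velL_pos_iff hα, hK.velR_pos_iff hα, not_lt, not_lt] at hz
  have a1 := hK.slopeL_le_slopeR_secOffset hα hβ h3 θ
  have a2 := hK.slopeL_le_slopeR_secOffset_add_pi hα hβ h3 θ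
  have a3 := hK.slopeR_le_slopeL_secOffset hα θ
  have a4 := hK.slopeR_le_slopeL_secOffset hβ θ
  have a5 := hK.slopeR_le_slopeL_secOffset_add_pi hα θ
  have a6 := hK.slopeR_le_slopeL_secOffset_add_pi hβ θ
  -- The slopes satisfy (`b` at `α`) ≤ (`b` at `β`) ≤ (`c` at `β`) ≤ (`c` at `α`); the zero at `α`
  -- closes the cycle, so all are equal.
  have e1 : slopeL K (θ + π) (-secOffset K α θ) = slopeR K θ (secOffset K α θ) := by
    rcases hz with hz | hz <;> apply le_antisymm <;> linarith
  refine hK.hasParallelSegments (hK.secOffset_lt hα hβ h3 θ) (hK.crosses_secOffset hα θ)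
    (hK.crosses_secOffset hβ θ) rfl ?_ e1 ?_ a3 ?_
  · rcases hz with hz | hz <;> apply le_antisymm <;> linarith
  · rcases hz with hz | hz <;> apply le_antisymm <;> linarith
  · linarith

/-! ### Strips -/

lemma IsPlanarBody.exists_inner_ne (hK : IsPlanarBody K) {v : Plane} (hv : v ≠ 0) (r : ℝ) :
    ∃ x ∈ K, inner ℝ x v ≠ r := by
  by_contra! hcon
  obtain ⟨x, hx⟩ := hK.nonempty_interior
  obtain ⟨ε, hε, h⟩ := exists_add_smul_mem_interior hx v
  have h1 := hcon _ (interior_subset (h ε (abs_of_pos hε).le))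
  rw [inner_add_left, hcon x (interior_subset hx), inner_smul_left,
    real_inner_self_eq_norm_sq] at h1
  have h2 : 0 < ε * ‖v‖ ^ 2 := by positivity
  simp only [conj_trivial] at h1
  linarith

lemma IsPlanarBody.inner_lt_inner_of_strip (hK : IsPlanarBody K) {b c N : Plane} (hN : N ≠ 0)
    (h : ∀ x ∈ K, inner ℝ b N ≤ inner ℝ x N ∧ inner ℝ x N ≤ inner ℝ c N) :
    inner ℝ b N < inner ℝ c N := by
  obtain ⟨x, hx, hne⟩ := hK.exists_inner_ne hN (inner ℝ b N)
  exact (lt_of_le_of_ne (h x hx).1 hne.symm).trans_le (h x hx).2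

lemma isSupportingLineAt_setOf {p v : Plane} (hv : v ≠ 0) (hp : p ∈ K)
    (h : ∀ x ∈ K, inner ℝ p v ≤ inner ℝ x v) :
    IsSupportingLineAt K {x | inner ℝ x v = inner ℝ p v} p := by
  obtain ⟨θ, hθ⟩ := exists_eq_smul_nrm v
  refine ⟨hp, rfl, θ, _, setOf_inner_eq_line hv hθ _, fun x hx => ?_⟩
  have h0 : 0 < ‖v‖ := norm_pos_iff.2 hv
  rw [leftHalf, mem_ofPred_eq, div_le_iff₀ h0]
  have := h x hx
  conv_rhs at this => rw [hθ, inner_smul_right]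
  linarith

lemma isSupportingLineAt_setOf' {p v : Plane} (hv : v ≠ 0) (hp : p ∈ K)
    (h : ∀ x ∈ K, inner ℝ x v ≤ inner ℝ p v) :
    IsSupportingLineAt K {x | inner ℝ x v = inner ℝ p v} p := by
  have := isSupportingLineAt_setOf (v := -v) (neg_ne_zero.2 hv) hp fun x hx => by
    rw [inner_neg_right, inner_neg_right]; exact neg_le_neg (h x hx)
  simpa only [inner_neg_right, neg_inj] using this

/-- The normal, in the frame of direction `θ`, of the lines of slope `k`. -/
noncomputable def slopeNormal (θ k : ℝ) : Plane := dir θ - k • nrm θ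

lemma inner_slopeNormal (θ k : ℝ) (x : Plane) :
    inner ℝ x (slopeNormal θ k) = inner ℝ x (dir θ) - k * inner ℝ x (nrm θ) := by
  rw [slopeNormal, inner_sub_right, inner_smul_right]

lemma slopeNormal_ne_zero (θ k : ℝ) : slopeNormal θ k ≠ 0 := fun h => by
  have := inner_slopeNormal θ k (dir θ)
  rw [h, inner_zero_right, inner_dir_dir, inner_dir_nrm] at this
  norm_num at this

lemma inner_chordC_slopeNormal (K : Set Plane) (α θ k : ℝ) :
    inner ℝ (chordC K α θ) (slopeNormal θ k) =
      hi K θ (secOffset K α θ) - k * secOffset K α θ := by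
  rw [inner_slopeNormal, chordC_eq, inner_frame_dir, inner_frame_nrm]

lemma inner_chordB_slopeNormal (K : Set Plane) (α θ k : ℝ) :
    inner ℝ (chordB K α θ) (slopeNormal θ k) =
      lo K θ (secOffset K α θ) - k * secOffset K α θ := by
  rw [inner_slopeNormal, chordB_eq, inner_frame_dir, inner_frame_nrm]

lemma IsPlanarBody.inner_slopeNormal_le_chordC (hK : IsPlanarBody K) {α : ℝ}
    (hα : α ∈ Ioo (0 : ℝ) 1) {θ k : ℝ} (h1 : slopeR K θ (secOffset K α θ) ≤ k)
    (h2 : k ≤ slopeL K θ (secOffset K α θ)) {x : Plane} (hx : x ∈ K) :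
    inner ℝ x (slopeNormal θ k) ≤ inner ℝ (chordC K α θ) (slopeNormal θ k) := by
  rw [inner_chordC_slopeNormal, inner_slopeNormal]
  have hcr := hK.crosses_secOffset hα θ
  rcases le_total (secOffset K α θ) (inner ℝ x (nrm θ)) with h | h
  · linarith [hK.inner_le_of_slopeR_le hcr h1 hx h]
  · linarith [hK.inner_le_of_le_slopeL hcr h2 hx h]

lemma IsPlanarBody.chordB_le_inner_slopeNormal (hK : IsPlanarBody K) {α : ℝ}
    (hα : α ∈ Ioo (0 : ℝ) 1) {θ k : ℝ} (h1 : slopeR K (θ + π) (-secOffset K α θ) ≤ k)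
    (h2 : k ≤ slopeL K (θ + π) (-secOffset K α θ)) {x : Plane} (hx : x ∈ K) :
    inner ℝ (chordB K α θ) (slopeNormal θ k) ≤ inner ℝ x (slopeNormal θ k) := by
  rw [inner_chordB_slopeNormal, inner_slopeNormal]
  have hcr := hK.crosses_secOffset hα θ
  rcases le_total (secOffset K α θ) (inner ℝ x (nrm θ)) with h | h
  · linarith [hK.le_inner_of_le_slopeL_add_pi hcr h2 hx h]
  · linarith [hK.le_inner_of_slopeR_add_pi_le hcr h1 hx h]

/-- Unit normals of strips: if chords do not increase from the `α`-section on, the part of `K` on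
its left lies in a strip based on its chord. -/
lemma IsPlanarBody.exists_left_strip (hK : IsPlanarBody K) {α : ℝ} (hα : α ∈ Ioo (0 : ℝ) 1) {θ : ℝ}
    (h : slopeR K θ (secOffset K α θ) ≤ slopeL K (θ + π) (-secOffset K α θ)) :
    ∃ N : Plane, ‖N‖ = 1 ∧ (∀ x ∈ K, secOffset K α θ ≤ inner ℝ x (nrm θ) →
        inner ℝ (chordB K α θ) N ≤ inner ℝ x N ∧ inner ℝ x N ≤ inner ℝ (chordC K α θ) N) ∧
      (slopeR K θ (secOffset K α θ) < slopeL K (θ + π) (-secOffset K α θ) →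
        ∀ x ∈ K, secOffset K α θ < inner ℝ x (nrm θ) →
          inner ℝ (chordB K α θ) N < inner ℝ x N) := by
  set k := slopeR K θ (secOffset K α θ) with hk
  set v := slopeNormal θ k
  have hcr := hK.crosses_secOffset hα θ
  have hv : 0 < ‖v‖ := norm_pos_iff.2 (slopeNormal_ne_zero θ k)
  have hin : ∀ x y : Plane, inner ℝ x (‖v‖⁻¹ • v) ≤ inner ℝ y (‖v‖⁻¹ • v) ↔
      inner ℝ x v ≤ inner ℝ y v := fun x y => by
    rw [inner_smul_right, inner_smul_right, mul_le_mul_iff_right₀ (inv_pos.2 hv)]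
  refine ⟨‖v‖⁻¹ • v, ?_, fun x hx hxt => ⟨(hin _ _).2 ?_, (hin _ _).2 ?_⟩, fun hlt x hx hxt => ?_⟩
  · rw [norm_smul, norm_inv, norm_norm, inv_mul_cancel₀ hv.ne']
  · rw [inner_chordB_slopeNormal, inner_slopeNormal]
    linarith [hK.le_inner_of_le_slopeL_add_pi hcr h hx hxt]
  · rw [inner_chordC_slopeNormal, inner_slopeNormal]
    linarith [hK.inner_le_of_slopeR_le hcr hk.ge hx hxt]
  · refine not_le.1 fun hle => ?_
    rw [hin, inner_chordB_slopeNormal, inner_slopeNormal] at hle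
    have := hK.le_inner_of_le_slopeL_add_pi hcr le_rfl hx hxt.le
    nlinarith

/-- If `0` is a velocity, `K` lies in a strip based on the chord. -/
lemma IsPlanarBody.exists_strip_of_mem_zeros (hK : IsPlanarBody K) {α : ℝ} (hα : α ∈ Ioo (0 : ℝ) 1)
    {θ : ℝ} (h : θ ∈ zeros K α) : ∃ N : Plane, ‖N‖ = 1 ∧ ∀ x ∈ K,
      inner ℝ (chordB K α θ) N ≤ inner ℝ x N ∧ inner ℝ x N ≤ inner ℝ (chordC K α θ) N := by
  rw [mem_zeros_iff, ← not_lt, ← not_lt, ← not_lt, ← not_lt, hK.velL_pos_iff hα, hK.velR_pos_iff hα,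
    hK.velL_neg_iff hα, hK.velR_neg_iff hα, not_lt, not_lt, not_lt, not_lt] at h
  have a1 := hK.slopeR_le_slopeL_secOffset hα θ
  have a2 := hK.slopeR_le_slopeL_secOffset_add_pi hα θ
  obtain ⟨k, h1, h2, h3, h4⟩ : ∃ k, slopeR K θ (secOffset K α θ) ≤ k ∧
      k ≤ slopeL K θ (secOffset K α θ) ∧ slopeR K (θ + π) (-secOffset K α θ) ≤ k ∧
      k ≤ slopeL K (θ + π) (-secOffset K α θ) := by
    refine ⟨max (slopeR K θ (secOffset K α θ)) (slopeR K (θ + π) (-secOffset K α θ)),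
      le_max_left _ _, max_le a1 ?_, le_max_right _ _, max_le ?_ a2⟩
    · rcases h.2 with h | h <;> linarith
    · rcases h.1 with h | h <;> linarith
  set v := slopeNormal θ k
  have hv : 0 < ‖v‖ := norm_pos_iff.2 (slopeNormal_ne_zero θ k)
  have hin : ∀ x y : Plane, inner ℝ x (‖v‖⁻¹ • v) ≤ inner ℝ y (‖v‖⁻¹ • v) ↔
      inner ℝ x v ≤ inner ℝ y v := fun x y => by
    rw [inner_smul_right, inner_smul_right, mul_le_mul_iff_right₀ (inv_pos.2 hv)]
  refine ⟨‖v‖⁻¹ • v, ?_, fun x hx => ⟨(hin _ _).2 ?_, (hin _ _).2 ?_⟩⟩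
  · rw [norm_smul, norm_inv, norm_norm, inv_mul_cancel₀ hv.ne']
  · exact hK.chordB_le_inner_slopeNormal hα h3 h4 hx
  · exact hK.inner_slopeNormal_le_chordC hα h1 h2 hx

/-! ### Limits of strips for small areas -/

lemma inner_chordB_nrm (K : Set Plane) (α θ : ℝ) :
    inner ℝ (chordB K α θ) (nrm θ) = secOffset K α θ := by rw [chordB_eq, inner_frame_nrm]

lemma inner_chordC_nrm_self (K : Set Plane) (α θ : ℝ) :
    inner ℝ (chordC K α θ) (nrm θ) = secOffset K α θ := by rw [chordC_eq, inner_frame_nrm]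

lemma IsPlanarBody.forall_mem_of_interior (hK : IsPlanarBody K) {S : Set Plane} (hS : IsClosed S)
    (h : interior K ⊆ S) : K ⊆ S := by
  rw [← hK.closure_interior]; exact closure_minimal h hS

lemma IsPlanarBody.tendsto_area (hK : IsPlanarBody K) {ι : Type*} {l : Filter ι} {f g : ι → ℝ}
    {θ t : ℝ} (hf : Tendsto f l (𝓝 θ)) (hg : Tendsto g l (𝓝 t)) :
    Tendsto (fun n => area K (f n) (g n)) l (𝓝 (area K θ t)) :=
  Tendsto.comp (g := fun p : ℝ × ℝ => area K p.1 p.2) (f := fun n => (f n, g n))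
    (hK.continuous_area.tendsto (θ, t)) (hf.prodMk_nhds hg)

/-- Directions, endpoints and unit normals range over compact sets. The limit line cuts off area
`0`, so it supports `K`. An interior point of `K` is strictly on its left, hence eventually on the
left of the sections, where the strip bounds hold; closure extends them to `K`. -/
lemma IsPlanarBody.exists_limit_strip (hK : IsPlanarBody K) {α θ : ℕ → ℝ} {B C N : ℕ → Plane}
    (hα : ∀ n, α n ∈ Ioo (0 : ℝ) 1) (hlim : Tendsto α atTop (𝓝 0))
    (hθ : ∀ n, θ n ∈ Icc 0 (2 * π)) (hB : B = fun n => chordB K (α n) (θ n))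
    (hC : C = fun n => chordC K (α n) (θ n)) (hN : ∀ n, ‖N n‖ = 1)
    (hs : ∀ n, ∀ x ∈ K, secOffset K (α n) (θ n) ≤ inner ℝ x (nrm (θ n)) →
      inner ℝ (B n) (N n) ≤ inner ℝ x (N n) ∧ inner ℝ x (N n) ≤ inner ℝ (C n) (N n)) :
    ∃ (φ : ℕ → ℕ) (θ₀ : ℝ) (b c N₀ : Plane), Tendsto (θ ∘ φ) atTop (𝓝 θ₀) ∧
      Tendsto (B ∘ φ) atTop (𝓝 b) ∧ Tendsto (C ∘ φ) atTop (𝓝 c) ∧ N₀ ≠ 0 ∧ b ∈ K ∧ c ∈ K ∧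
      K ⊆ leftHalf θ₀ (inner ℝ b (nrm θ₀)) ∧ inner ℝ c (nrm θ₀) = inner ℝ b (nrm θ₀) ∧
      ∀ x ∈ K, inner ℝ b N₀ ≤ inner ℝ x N₀ ∧ inner ℝ x N₀ ≤ inner ℝ c N₀ := by
  have hcomp : IsCompact ((Icc 0 (2 * π)) ×ˢ (K ×ˢ (K ×ˢ Metric.sphere (0 : Plane) 1))) :=
    isCompact_Icc.prod (hK.isCompact.prod (hK.isCompact.prod (isCompact_sphere _ _)))
  obtain ⟨⟨θ₀, b, c, N₀⟩, hmem, φ, hφ, htend⟩ := hcomp.tendsto_subseq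
    (x := fun n => (θ n, B n, C n, N n)) fun n => ⟨hθ n, by rw [hB]; exact hK.chordB_mem (hα n) _,
      by rw [hC]; exact hK.chordC_mem (hα n) _, by simp [hN n]⟩
  obtain ⟨-, hb, hc, hN0⟩ := hmem
  have hN0 : ‖N₀‖ = 1 := by simpa using hN0
  have t1 : Tendsto (θ ∘ φ) atTop (𝓝 θ₀) := (continuous_fst.tendsto _).comp htend
  have t2 : Tendsto (B ∘ φ) atTop (𝓝 b) :=
    ((continuous_fst.comp continuous_snd).tendsto _).comp htend
  have t3 : Tendsto (C ∘ φ) atTop (𝓝 c) :=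
    ((continuous_fst.comp (continuous_snd.comp continuous_snd)).tendsto _).comp htend
  have t4 : Tendsto (N ∘ φ) atTop (𝓝 N₀) :=
    ((continuous_snd.comp (continuous_snd.comp continuous_snd)).tendsto _).comp htend
  have tn : Tendsto (fun n => nrm (θ (φ n))) atTop (𝓝 (nrm θ₀)) :=
    (continuous_nrm.tendsto _).comp t1
  have e1 : ∀ n, inner ℝ (B n) (nrm (θ n)) = secOffset K (α n) (θ n) := fun n => by
    rw [hB, inner_chordB_nrm]
  have e2 : ∀ n, inner ℝ (C n) (nrm (θ n)) = secOffset K (α n) (θ n) := fun n => by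
    rw [hC, inner_chordC_nrm_self]
  have tB : Tendsto (fun n => secOffset K (α (φ n)) (θ (φ n))) atTop (𝓝 (inner ℝ b (nrm θ₀))) := by
    refine (t2.inner tn).congr fun n => e1 (φ n)
  have tC : Tendsto (fun n => secOffset K (α (φ n)) (θ (φ n))) atTop (𝓝 (inner ℝ c (nrm θ₀))) := by
    refine (t3.inner tn).congr fun n => e2 (φ n)
  have harea : area K θ₀ (inner ℝ b (nrm θ₀)) = 0 := by
    have h1 : Tendsto (fun n => area K (θ (φ n)) (secOffset K (α (φ n)) (θ (φ n)))) atTop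
        (𝓝 (area K θ₀ (inner ℝ b (nrm θ₀)))) :=
      hK.tendsto_area t1 tB
    have h2 : Tendsto (fun n => area K (θ (φ n)) (secOffset K (α (φ n)) (θ (φ n)))) atTop
        (𝓝 (0 * volume.real K)) :=
      ((hlim.comp hφ.tendsto_atTop).mul_const (volume.real K)).congr fun n =>
        (hK.area_secOffset (hα (φ n)) _).symm
    rw [tendsto_nhds_unique h1 h2, zero_mul]
  have hleft := hK.subset_leftHalf harea
  refine ⟨φ, θ₀, b, c, N₀, t1, t2, t3, norm_ne_zero_iff.1 (by rw [hN0]; norm_num), hb, hc, hleft,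
    tendsto_nhds_unique tC tB, ?_⟩
  have key : ∀ x ∈ interior K, inner ℝ b N₀ ≤ inner ℝ x N₀ ∧ inner ℝ x N₀ ≤ inner ℝ c N₀ := by
    intro x hx
    have hlt : inner ℝ b (nrm θ₀) < inner ℝ x (nrm θ₀) := by
      obtain ⟨ε, hε, h⟩ := exists_add_smul_mem_interior hx (nrm θ₀)
      have h1 : inner ℝ b (nrm θ₀) ≤ inner ℝ (x + (-ε) • nrm θ₀) (nrm θ₀) :=
        hleft (interior_subset (h (-ε) (by rw [abs_neg, abs_of_pos hε])))
      rw [inner_add_left, inner_smul_left, inner_nrm_nrm] at h1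
      simp only [conj_trivial] at h1
      linarith
    have hev : ∀ᶠ n in atTop, secOffset K (α (φ n)) (θ (φ n)) < inner ℝ x (nrm (θ (φ n))) :=
      tB.eventually_lt (tendsto_const_nhds.inner tn) hlt
    refine ⟨le_of_tendsto_of_tendsto (t2.inner t4) (tendsto_const_nhds.inner t4) ?_,
      le_of_tendsto_of_tendsto (tendsto_const_nhds.inner t4) (t3.inner t4) ?_⟩
    · filter_upwards [hev] with n hn using (hs (φ n) x (interior_subset hx) hn.le).1
    · filter_upwards [hev] with n hn using (hs (φ n) x (interior_subset hx) hn.le).2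
  intro x hx
  have := hK.forall_mem_of_interior (S := {x | inner ℝ b N₀ ≤ inner ℝ x N₀} ∩
    {x | inner ℝ x N₀ ≤ inner ℝ c N₀})
    ((isClosed_le continuous_const (by fun_prop)).inter (isClosed_le (by fun_prop) continuous_const))
    (fun x hx => key x hx) hx
  exact this

lemma IsPlanarBody.exists_supporting_of_strip (hK : IsPlanarBody K) {b c N : Plane} {θ : ℝ}
    (hN : N ≠ 0) (hb : b ∈ K) (hc : c ∈ K) (hleft : K ⊆ leftHalf θ (inner ℝ b (nrm θ)))
    (hcb : inner ℝ c (nrm θ) = inner ℝ b (nrm θ))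
    (h : ∀ x ∈ K, inner ℝ b N ≤ inner ℝ x N ∧ inner ℝ x N ≤ inner ℝ c N) :
    b ≠ c ∧ segment ℝ b c ⊆ frontier K ∧
      IsSupportingLineAt K {x | inner ℝ x N = inner ℝ b N} b ∧
      IsSupportingLineAt K {x | inner ℝ x N = inner ℝ c N} c ∧
      AreDistinctParallel {x : Plane | inner ℝ x N = inner ℝ b N}
        {x : Plane | inner ℝ x N = inner ℝ c N} := by
  have hlt := hK.inner_lt_inner_of_strip hN h
  have hn : nrm θ ≠ 0 := norm_ne_zero_iff.1 (by rw [norm_nrm]; norm_num)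
  exact ⟨fun e => hlt.ne (by rw [e]), segment_subset_frontier hK hn hb hc rfl hcb hleft,
    isSupportingLineAt_setOf hN hb fun x hx => (h x hx).1,
    isSupportingLineAt_setOf' hN hc fun x hx => (h x hx).2, areDistinctParallel_setOf hN hlt.ne⟩

lemma exists_seq_small : ∃ α : ℕ → ℝ, (∀ n, α n ∈ Ioo (0 : ℝ) 1) ∧ Tendsto α atTop (𝓝 0) := by
  refine ⟨fun n => 1 / ((n : ℝ) + 2), fun n => ⟨by positivity, ?_⟩, ?_⟩
  · rw [div_lt_one (by positivity)]
    have : (0 : ℝ) ≤ n := n.cast_nonneg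
    linarith
  · have h1 : Tendsto (fun n : ℕ => (n : ℝ) + 2) atTop atTop :=
      tendsto_natCast_atTop_atTop.atTop_add tendsto_const_nhds
    exact (tendsto_inv_atTop_zero.comp h1).congr fun n => by simp

lemma IsPlanarBody.exists_segment_of_alphaZ_eq_zero (hK : IsPlanarBody K) (h : alphaZ K = 0) :
    ∃ b c : Plane, b ≠ c ∧ segment ℝ b c ⊆ frontier K ∧
      ∃ D D' : Set Plane, IsSupportingLineAt K D b ∧ IsSupportingLineAt K D' c ∧
        AreDistinctParallel D D' := by
  rw [hK.alphaZ_eq_zero_iff] at h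
  obtain ⟨α, hα, hlim⟩ := exists_seq_small
  have hex : ∀ n, ∃ θ ∈ Icc 0 (2 * π), slopeR K θ (secOffset K (α n) θ) ≤
      slopeL K (θ + π) (-secOffset K (α n) θ) := by
    intro n
    have h1 := h (α n) (hα n)
    simp only [IsForward, not_forall, not_and_or] at h1
    obtain ⟨θ, hθ⟩ := h1
    obtain ⟨k, hk⟩ := exists_mem_Icc_add_two_pi_mul θ
    rw [← hK.velL_add_two_pi_mul (hα n) θ k, ← hK.velR_add_two_pi_mul (hα n) θ k] at hθ
    refine ⟨_, hk, ?_⟩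
    rw [hK.velL_pos_iff (hα n), hK.velR_pos_iff (hα n), not_lt, not_lt] at hθ
    have a1 := hK.slopeR_le_slopeL_secOffset (hα n) (θ + k * (2 * π))
    have a2 := hK.slopeR_le_slopeL_secOffset_add_pi (hα n) (θ + k * (2 * π))
    rcases hθ with hθ | hθ <;> linarith
  choose θ hθ hsl using hex
  choose N hN hs _ using fun n => hK.exists_left_strip (hα n) (hsl n)
  obtain ⟨φ, θ₀, b, c, N₀, -, -, -, hN0, hb, hc, hleft, hcb, hstrip⟩ :=
    hK.exists_limit_strip hα hlim hθ rfl rfl hN hs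
  obtain ⟨h1, h2, h3, h4, h5⟩ := hK.exists_supporting_of_strip hN0 hb hc hleft hcb hstrip
  exact ⟨b, c, h1, h2, _, _, h3, h4, h5⟩

/-! ### The case `α_B = 0` -/

/-- In the strip between two parallel lines `b + ℝ d` and `c + ℝ d`, points of `K` near the base
`[b, c]` may be translated by `d / 2` inside `K`. -/
lemma add_half_smul_mem (hK : Convex ℝ K) {b c d z : Plane} (hb : b ∈ K) (hc : c ∈ K)
    (hbd : b + d ∈ K) (hcd : c + d ∈ K) {x y : ℝ} (hx : x ∈ Icc (0 : ℝ) 1) (hy : 0 ≤ y)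
    (hy' : y ≤ 1 / 2) (hz : z = b + x • (c - b) + y • d) : z + (1 / 2 : ℝ) • d ∈ K := by
  have h1 : b + (y + 1 / 2) • d ∈ K := by
    have := hK hb hbd (by linarith : 0 ≤ 1 - (y + 1 / 2)) (by linarith : 0 ≤ y + 1 / 2) (by ring)
    convert! this using 1; module
  have h2 : c + (y + 1 / 2) • d ∈ K := by
    have := hK hc hcd (by linarith : 0 ≤ 1 - (y + 1 / 2)) (by linarith : 0 ≤ y + 1 / 2) (by ring)
    convert! this using 1; module
  have := hK h1 h2 (by linarith [hx.2] : 0 ≤ 1 - x) hx.1 (by ring)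
  rw [hz]
  convert! this using 1; module

/-- The limit strip is obtained as for `α_Z`. If both of its sides met `K` in a second point, `K`
would contain a parallelogram on the base and fill the strip near it. Small chords could then be
pushed along the sides inside `K`, which the strictly narrowing strips forbid. -/
lemma IsPlanarBody.exists_segment_of_alphaB_eq_zero (hK : IsPlanarBody K) (h : alphaB K = 0) :
    ∃ b c : Plane, b ≠ c ∧ segment ℝ b c ⊆ frontier K ∧
      ∃ D D' : Set Plane, IsSupportingLineAt K D b ∧ IsSupportingLineAt K D' c ∧
        AreDistinctParallel D D' ∧
        ((∃ p, D ∩ frontier K = {p}) ∨ (∃ p, D' ∩ frontier K = {p})) := by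
  obtain ⟨α, hα, hlim⟩ := exists_seq_small
  have hex : ∀ n, ∃ θ ∈ Icc 0 (2 * π), slopeR K θ (secOffset K (α n) θ) <
      slopeL K (θ + π) (-secOffset K (α n) θ) := by
    intro n
    have h1 : α n ∈ setIB K := by rw [hK.setIB_eq, h]; exact hα n
    obtain ⟨-, θ, hθ⟩ := h1
    rw [mem_backwards_iff] at hθ
    obtain ⟨k, hk⟩ := exists_mem_Icc_add_two_pi_mul θ
    rw [← hK.velL_add_two_pi_mul (hα n) θ k, ← hK.velR_add_two_pi_mul (hα n) θ k] at hθ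
    refine ⟨_, hk, ?_⟩
    rw [hK.velL_neg_iff (hα n), hK.velR_neg_iff (hα n)] at hθ
    have a1 := hK.slopeR_le_slopeL_secOffset (hα n) (θ + k * (2 * π))
    have a2 := hK.slopeR_le_slopeL_secOffset_add_pi (hα n) (θ + k * (2 * π))
    rcases hθ with hθ | hθ <;> linarith
  choose θ hθ hsl using hex
  choose N hN hs hstrict using fun n => hK.exists_left_strip (hα n) (hsl n).le
  obtain ⟨φ, θ₀, b, c, N₀, t1, t2, t3, hN0, hb, hc, hleft, hcb, hstrip⟩ :=
    hK.exists_limit_strip hα hlim hθ rfl rfl hN hs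
  obtain ⟨h1, h2, h3, h4, h5⟩ := hK.exists_supporting_of_strip hN0 hb hc hleft hcb hstrip
  have hlt := hK.inner_lt_inner_of_strip hN0 hstrip
  refine ⟨b, c, h1, h2, _, _, h3, h4, h5, ?_⟩
  by_contra! hcon
  have hsecond : ∀ p ∈ K, p ∈ frontier K → (∃ q, q ∈ K ∧ q ≠ p ∧ inner ℝ q N₀ = inner ℝ p N₀) ∨
      {x | inner ℝ x N₀ = inner ℝ p N₀} ∩ frontier K = {p} := by
    intro p hp hpf
    by_cases hq : ∃ q, q ∈ K ∧ q ≠ p ∧ inner ℝ q N₀ = inner ℝ p N₀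
    · exact Or.inl hq
    · refine Or.inr (eq_singleton_iff_unique_mem.2 ⟨⟨rfl, hpf⟩, fun q hq' => ?_⟩)
      by_contra hne
      exact hq ⟨q, hK.frontier_subset hq'.2, hne, hq'.1⟩
  obtain ⟨b', hb', hbne, hbN⟩ := (hsecond b hb (h2 (left_mem_segment ℝ b c))).resolve_right
    (hcon.1 b)
  obtain ⟨c', hc', hcne, hcN⟩ := (hsecond c hc (h2 (right_mem_segment ℝ b c))).resolve_right
    (hcon.2 c)
  have hcbu : inner ℝ (c - b) (nrm θ₀) = 0 := by rw [inner_sub_left, hcb, sub_self]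
  have hcbN : inner ℝ (c - b) (dir θ₀) * inner ℝ N₀ (dir θ₀) = inner ℝ c N₀ - inner ℝ b N₀ := by
    rw [← inner_sub_left, inner_frame θ₀ (c - b) N₀, hcbu]; ring
  have hNu : inner ℝ N₀ (dir θ₀) ≠ 0 := fun h0 => by rw [h0] at hcbN; linarith
  have hcbd : inner ℝ (c - b) (dir θ₀) ≠ 0 := fun h0 => by rw [h0] at hcbN; linarith
  have hpos : ∀ p q : Plane, q ∈ K → inner ℝ p (nrm θ₀) = inner ℝ b (nrm θ₀) → q ≠ p →
      inner ℝ q N₀ = inner ℝ p N₀ → 0 < inner ℝ (q - p) (nrm θ₀) := by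
    intro p q hq hp hne hqN
    have h6 : inner ℝ b (nrm θ₀) ≤ inner ℝ q (nrm θ₀) := hleft hq
    rw [inner_sub_left]
    refine lt_of_le_of_ne (by linarith) fun h0 => hne ?_
    refine frame_ext θ₀ (mul_right_cancel₀ hNu ?_) (by linarith)
    rw [inner_frame θ₀ q, inner_frame θ₀ p] at hqN
    rw [show inner ℝ q (nrm θ₀) = inner ℝ p (nrm θ₀) by linarith] at hqN
    linarith
  have hβ := hpos b b' hb' rfl hbne hbN
  have hγ := hpos c c' hc' hcb hcne hcN
  set β := inner ℝ (b' - b) (nrm θ₀) with hβdef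
  set γ := inner ℝ (c' - c) (nrm θ₀) with hγdef
  have hzero : ∀ v w : Plane, inner ℝ v N₀ = inner ℝ w N₀ → inner ℝ v (nrm θ₀) = inner ℝ w (nrm θ₀) →
      v = w := by
    intro v w h6 h7
    refine frame_ext θ₀ (mul_right_cancel₀ hNu ?_) h7
    rw [inner_frame θ₀ v, inner_frame θ₀ w, h7] at h6
    linarith
  have hpar : β • (c' - c) = γ • (b' - b) := by
    apply hzero
    · rw [inner_smul_left, inner_smul_left, inner_sub_left, inner_sub_left, hbN, hcN]; simp
    · rw [inner_smul_left, inner_smul_left, ← hβdef, ← hγdef]; simp [mul_comm]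
  -- The smaller of the two heights makes both translates `b + d` and `c + d` lie in `K`.
  set δ := min β γ with hδdef
  have hδ : 0 < δ := lt_min hβ hγ
  set d := (δ / β) • (b' - b) with hd
  have hd' : d = (δ / γ) • (c' - c) := by
    have : c' - c = (γ / β) • (b' - b) := by
      rw [div_eq_inv_mul, mul_smul, ← hpar, smul_smul, inv_mul_cancel₀ hβ.ne', one_smul]
    rw [this, smul_smul, hd]
    congr 1; field_simp
  have hbd : b + d ∈ K := by
    have h6 : δ / β ≤ 1 := (div_le_one hβ).2 (min_le_left _ _)
    have h7 : 0 ≤ δ / β := by positivity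
    have := hK.convex hb hb' (by linarith : 0 ≤ 1 - δ / β) h7 (by ring)
    convert! this using 1; rw [hd]; module
  have hcd : c + d ∈ K := by
    have h6 : δ / γ ≤ 1 := (div_le_one hγ).2 (min_le_right _ _)
    have h7 : 0 ≤ δ / γ := by positivity
    have := hK.convex hc hc' (by linarith : 0 ≤ 1 - δ / γ) h7 (by ring)
    convert! this using 1; rw [hd']; module
  have hdN : inner ℝ d N₀ = 0 := by
    rw [hd, inner_smul_left, inner_sub_left, hbN]; simp
  have hdn : inner ℝ d (nrm θ₀) = δ := by
    rw [hd, inner_smul_left, ← hβdef]; simp; field_simp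
  have hshift : ∀ z ∈ K, inner ℝ z (nrm θ₀) - inner ℝ b (nrm θ₀) < δ / 2 →
      z + (1 / 2 : ℝ) • d ∈ K := by
    intro z hz hzn
    have h6 : inner ℝ b (nrm θ₀) ≤ inner ℝ z (nrm θ₀) := hleft hz
    have h7 := hstrip z hz
    refine add_half_smul_mem hK.convex hb hc hbd hcd
      (x := (inner ℝ z N₀ - inner ℝ b N₀) / (inner ℝ c N₀ - inner ℝ b N₀))
      (y := (inner ℝ z (nrm θ₀) - inner ℝ b (nrm θ₀)) / δ) ⟨?_, ?_⟩ ?_ ?_ ?_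
    · exact div_nonneg (by linarith) (by linarith)
    · rw [div_le_one (by linarith)]; linarith
    · exact div_nonneg (by linarith) hδ.le
    · rw [div_le_iff₀ hδ]; linarith
    · have h8 : inner ℝ c N₀ - inner ℝ b N₀ ≠ 0 := by linarith
      apply hzero
      · rw [inner_add_left, inner_add_left, inner_smul_left, inner_smul_left, hdN, inner_sub_left]
        simp only [conj_trivial]; field_simp; ring
      · rw [inner_add_left, inner_add_left, inner_smul_left, inner_smul_left, hdn, hcbu]
        simp only [conj_trivial]; field_simp; ring
  have tn : Tendsto (fun n => nrm (θ (φ n))) atTop (𝓝 (nrm θ₀)) :=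
    (continuous_nrm.tendsto _).comp t1
  have ev1 : ∀ᶠ n in atTop, inner ℝ (chordB K (α (φ n)) (θ (φ n))) (nrm θ₀) <
      inner ℝ b (nrm θ₀) + δ / 2 :=
    (t2.inner tendsto_const_nhds).eventually_lt tendsto_const_nhds (by linarith)
  have ev2 : ∀ᶠ n in atTop, inner ℝ (chordC K (α (φ n)) (θ (φ n))) (nrm θ₀) <
      inner ℝ b (nrm θ₀) + δ / 2 :=
    (t3.inner tendsto_const_nhds).eventually_lt tendsto_const_nhds (by rw [hcb]; linarith)
  have ev3 : ∀ᶠ n in atTop, 0 < inner ℝ d (nrm (θ (φ n))) :=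
    tendsto_const_nhds.eventually_lt (tendsto_const_nhds.inner tn) (by rw [hdn]; exact hδ)
  obtain ⟨n, hn1, hn2, hn3⟩ := (ev1.and (ev2.and ev3)).exists
  have hBm := hshift _ (hK.chordB_mem (hα (φ n)) (θ (φ n))) (by linarith)
  have hCm := hshift _ (hK.chordC_mem (hα (φ n)) (θ (φ n))) (by linarith)
  -- With normal `N (φ n)`, the shift by `d / 2` strictly raises the value at the first endpoint but
  -- cannot raise it at the last one, although both change by the same amount.
  have i1 := hstrict (φ n) (hsl (φ n)) _ hBm (by
    rw [inner_add_left, inner_chordB_nrm, inner_smul_left]; simp only [conj_trivial]; linarith)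
  have i2 := (hs (φ n) _ hCm (by
    rw [inner_add_left, inner_chordC_nrm_self, inner_smul_left]
    simp only [conj_trivial]; linarith)).2
  rw [inner_add_left] at i1 i2
  linarith

/-! ### From a segment with parallel supporting lines to velocities -/

lemma line_eq_line {φ τ ψ p : ℝ} (h : line φ τ = line ψ p) :
    nrm φ = nrm ψ ∨ nrm φ = -nrm ψ := by
  have m0 : (0 : ℝ) • dir ψ + p • nrm ψ ∈ line φ τ := by rw [h]; exact inner_frame_nrm _ _ _
  have m1 : (1 : ℝ) • dir ψ + p • nrm ψ ∈ line φ τ := by rw [h]; exact inner_frame_nrm _ _ _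
  have e0 : inner ℝ ((0 : ℝ) • dir ψ + p • nrm ψ) (nrm φ) = τ := m0
  have e1 : inner ℝ ((1 : ℝ) • dir ψ + p • nrm ψ) (nrm φ) = τ := m1
  rw [inner_add_left, zero_smul, inner_zero_left] at e0
  rw [inner_add_left, one_smul] at e1
  have e2 : inner ℝ (nrm φ) (dir ψ) = 0 := by rw [real_inner_comm]; linarith
  have e3 := inner_frame ψ (nrm φ) (nrm φ)
  rw [inner_nrm_nrm, e2] at e3
  have e4 := frame_expand ψ (nrm φ)
  rw [e2, zero_smul, zero_add] at e4
  have e5 : (inner ℝ (nrm φ) (nrm ψ) - 1) * (inner ℝ (nrm φ) (nrm ψ) + 1) = 0 := by linarith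
  rcases mul_eq_zero.1 e5 with e | e
  · left; rw [e4, show inner ℝ (nrm φ) (nrm ψ) = 1 by linarith, one_smul]
  · right; rw [e4, show inner ℝ (nrm φ) (nrm ψ) = -1 by linarith, neg_smul, one_smul]

/-- Two distinct parallel supporting lines bound a strip. -/
lemma exists_strip_of_supporting {b c : Plane} {D D' : Set Plane} (h1 : IsSupportingLineAt K D b)
    (h2 : IsSupportingLineAt K D' c) (h3 : AreDistinctParallel D D') :
    ∃ M : Plane, D = {x | inner ℝ x M = inner ℝ b M} ∧ D' = {x | inner ℝ x M = inner ℝ c M} ∧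
      (∀ x ∈ K, inner ℝ b M ≤ inner ℝ x M ∧ inner ℝ x M ≤ inner ℝ c M) ∧
      inner ℝ b M < inner ℝ c M := by
  obtain ⟨hb, hbD, φ, τ, rfl, hφ⟩ := h1
  obtain ⟨hc, hcD, φ', τ', rfl, hφ'⟩ := h2
  obtain ⟨hne, ψ, p, q, hp, hq⟩ := h3
  have hτ : inner ℝ b (nrm φ) = τ := hbD
  have hτ' : inner ℝ c (nrm φ') = τ' := hcD
  have hcle : τ ≤ inner ℝ c (nrm φ) := hφ hc
  have hble : τ' ≤ inner ℝ b (nrm φ') := hφ' hb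
  have hor : nrm φ' = nrm φ ∨ nrm φ' = -nrm φ := by
    rcases line_eq_line hp with e | e <;> rcases line_eq_line hq with e' | e' <;> rw [e, e'] <;>
      simp
  rcases hor with e | e
  -- With the same inner normal, each line has the contact point of the other on its left, so the
  -- two lines coincide.
  · exfalso
    rw [e] at hτ' hble
    apply hne
    have : τ = τ' := by linarith
    rw [line, line, e, this]
  · rw [e, inner_neg_right] at hτ' hble
    have hD' : line φ' τ' = {x | inner ℝ x (nrm φ) = inner ℝ c (nrm φ)} := by
      ext x
      rw [line, mem_ofPred_eq, mem_ofPred_eq, e, inner_neg_right]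
      constructor <;> intro h <;> linarith
    have hD : line φ τ = {x | inner ℝ x (nrm φ) = inner ℝ b (nrm φ)} := by rw [hτ]; rfl
    refine ⟨nrm φ, hD, hD', fun x hx => ⟨?_, ?_⟩, lt_of_le_of_ne (by linarith) fun h => hne ?_⟩
    · rw [hτ]; exact hφ hx
    · have : τ' ≤ inner ℝ x (nrm φ') := hφ' hx
      rw [e, inner_neg_right] at this
      linarith
    · rw [hD, hD', h]

/-- A segment of the boundary lies on a supporting line. -/
lemma IsPlanarBody.exists_leftHalf_of_segment (hK : IsPlanarBody K) {b c : Plane}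
    (h : segment ℝ b c ⊆ frontier K) :
    ∃ θ t : ℝ, K ⊆ leftHalf θ t ∧ inner ℝ b (nrm θ) = t ∧ inner ℝ c (nrm θ) = t := by
  have hb := hK.frontier_subset (h (left_mem_segment ℝ b c))
  have hc := hK.frontier_subset (h (right_mem_segment ℝ b c))
  have hp := h (midpoint_mem_segment (𝕜 := ℝ) b c)
  -- Separating at the midpoint makes `f` maximal there over `K`; its values at `b` and `c`, which
  -- average to this maximum, must then be equal.
  obtain ⟨f, hf⟩ := geometric_hahn_banach_open_point hK.convex.interior isOpen_interior hp.2
  set w := (InnerProductSpace.toDual ℝ Plane).symm f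
  have hw : ∀ x, f x = inner ℝ w x := fun x => (InnerProductSpace.toDual_symm_apply).symm
  have hw0 : -w ≠ 0 := fun h0 => by
    obtain ⟨x, hx⟩ := hK.nonempty_interior
    have := hf x hx
    rw [hw, hw, neg_eq_zero.1 h0] at this
    simp at this
  obtain ⟨θ, hθ⟩ := exists_eq_smul_nrm (-w)
  have hpos : 0 < ‖-w‖ := norm_pos_iff.2 hw0
  have hfx : ∀ x, f x = -(‖-w‖ * inner ℝ x (nrm θ)) := fun x => by
    rw [hw, ← inner_smul_right, ← hθ, inner_neg_right, neg_neg, real_inner_comm]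
  have hle : ∀ x ∈ K, f x ≤ f (midpoint ℝ b c) := fun x hx =>
    hK.forall_mem_of_interior (S := {x | f x ≤ f (midpoint ℝ b c)})
      (isClosed_le f.continuous continuous_const) (fun y hy => (hf y hy).le) hx
  have hmid : f (midpoint ℝ b c) = (f b + f c) / 2 := by
    rw [midpoint_eq_smul_add, map_smul, map_add, smul_eq_mul, invOf_eq_inv]; ring
  have h1 := hle b hb
  have h2 := hle c hc
  have h3 : f b = f c := by linarith
  refine ⟨θ, inner ℝ b (nrm θ), fun x hx => ?_, rfl, ?_⟩
  · have h4 := hle x hx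
    have h5 : f x ≤ f b := by linarith
    rw [hfx, hfx, neg_le_neg_iff, mul_le_mul_iff_right₀ hpos] at h5
    exact h5
  · rw [hfx, hfx, neg_inj] at h3
    exact (mul_left_cancel₀ hpos.ne' h3).symm

/-- Above a base `[b, c]` of a strip containing `K`, chords do not increase. -/
lemma IsPlanarBody.slopeL_le_of_base (hK : IsPlanarBody K) {b c M : Plane} {θ t₀ : ℝ}
    (hleft : K ⊆ leftHalf θ t₀) (hb : b ∈ K) (hc : c ∈ K) (hbt : inner ℝ b (nrm θ) = t₀)
    (hct : inner ℝ c (nrm θ) = t₀)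
    (hM : ∀ x ∈ K, inner ℝ b M ≤ inner ℝ x M ∧ inner ℝ x M ≤ inner ℝ c M)
    (hμ : 0 < inner ℝ (dir θ) M) {α : ℝ} (hα : α ∈ Ioo (0 : ℝ) 1) :
    slopeL K θ (secOffset K α θ) ≤ slopeR K (θ + π) (-secOffset K α θ) ∧
      ((∀ x ∈ K, inner ℝ x M = inner ℝ b M → x = b) ∨
        (∀ x ∈ K, inner ℝ x M = inner ℝ c M → x = c) →
      slopeL K θ (secOffset K α θ) < slopeR K (θ + π) (-secOffset K α θ)) := by
  set t := secOffset K α θ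
  have hcr : Crosses K θ t := hK.crosses_secOffset hα θ
  have hlt : t₀ < t := by
    by_contra! hle
    have h1 := hK.area_eq_zero fun x hx => hle.trans (hleft hx : t₀ ≤ _)
    rw [hK.area_secOffset hα] at h1
    have := mul_pos hα.1 hK.volume_pos
    linarith
  have e : ∀ x : Plane, inner ℝ x M =
      inner ℝ x (dir θ) * inner ℝ (dir θ) M + inner ℝ x (nrm θ) * inner ℝ (nrm θ) M := fun x => by
    rw [inner_frame θ x M, real_inner_comm M (dir θ), real_inner_comm M (nrm θ)]
  set μ := inner ℝ (dir θ) M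
  set ν := inner ℝ (nrm θ) M
  have hCm := hK.hi_mem hcr.mem_shadow
  have hBm := hK.lo_mem hcr.mem_shadow
  have hC := (hM _ hCm).2
  have hB := (hM _ hBm).1
  have hC1 := e (hi K θ t • dir θ + t • nrm θ)
  have hB1 := e (lo K θ t • dir θ + t • nrm θ)
  rw [inner_frame_dir, inner_frame_nrm] at hC1 hB1
  have hcM := e c
  have hbM := e b
  rw [hct] at hcM
  rw [hbt] at hbM
  have h1 := hK.inner_le_of_le_slopeL hcr le_rfl hc (by rw [hct]; exact hlt.le)
  have h2 := hK.le_inner_of_slopeR_add_pi_le hcr le_rfl hb (by rw [hbt]; exact hlt.le)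
  rw [hct] at h1
  rw [hbt] at h2
  -- The tangents at height `t` are compared with the points `c` and `b` of the base; the strip then
  -- orders the displacements of the two chord ends from the base.
  have h3 : slopeL K θ t * (t - t₀) ≤ hi K θ t - inner ℝ c (dir θ) := by linarith
  have h4 : lo K θ t - inner ℝ b (dir θ) ≤ slopeR K (θ + π) (-t) * (t - t₀) := by linarith
  have h5 : (hi K θ t - inner ℝ c (dir θ)) * μ ≤ -(ν * (t - t₀)) := by linarith
  have h6 : -(ν * (t - t₀)) ≤ (lo K θ t - inner ℝ b (dir θ)) * μ := by linarith
  have h7 : 0 < t - t₀ := by linarith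
  constructor
  · have h8 := le_of_mul_le_mul_right (h5.trans h6) hμ
    exact le_of_mul_le_mul_right (h3.trans (h8.trans h4)) h7
  · intro hor
    have hne : ∀ s : ℝ, ∀ x : Plane, inner ℝ x (nrm θ) = t₀ → s • dir θ + t • nrm θ ≠ x := by
      rintro s x hx rfl
      rw [inner_frame_nrm] at hx
      exact hlt.ne' hx
    -- A chord end at height `t > t₀` is not on the base, so uniqueness of contact on one side makes
    -- that strip bound strict.
    have h8 : hi K θ t - inner ℝ c (dir θ) < lo K θ t - inner ℝ b (dir θ) := by
      refine lt_of_mul_lt_mul_right ?_ hμ.le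
      rcases hor with hor | hor
      · have : inner ℝ b M < inner ℝ (lo K θ t • dir θ + t • nrm θ) M :=
          lt_of_le_of_ne hB fun heq => hne _ b hbt (hor _ hBm heq.symm)
        linarith
      · have : inner ℝ (hi K θ t • dir θ + t • nrm θ) M < inner ℝ c M :=
          lt_of_le_of_ne hC fun heq => hne _ c hct (hor _ hCm heq)
        linarith
    exact lt_of_mul_lt_mul_right (h3.trans_lt (h8.trans_le h4)) h7.le

/-- A boundary segment whose endpoints admit distinct parallel supporting lines gives a direction
in which no velocity is positive. -/
lemma IsPlanarBody.exists_slopeL_le (hK : IsPlanarBody K) {b c : Plane} {D D' : Set Plane}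
    (hseg : segment ℝ b c ⊆ frontier K) (h1 : IsSupportingLineAt K D b)
    (h2 : IsSupportingLineAt K D' c) (h3 : AreDistinctParallel D D') :
    ∃ θ, ∀ α ∈ Ioo (0 : ℝ) 1,
      slopeL K θ (secOffset K α θ) ≤ slopeR K (θ + π) (-secOffset K α θ) ∧
      ((∃ p, D ∩ frontier K = {p}) ∨ (∃ p, D' ∩ frontier K = {p}) →
      slopeL K θ (secOffset K α θ) < slopeR K (θ + π) (-secOffset K α θ)) := by
  obtain ⟨M, rfl, rfl, hM, hlt⟩ := exists_strip_of_supporting h1 h2 h3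
  obtain ⟨θ, t₀, hleft, hbt, hct⟩ := hK.exists_leftHalf_of_segment hseg
  have hb := h1.1
  have hc := h2.1
  have hM0 : M ≠ 0 := fun h0 => by rw [h0] at hlt; simp at hlt
  have hnM0 : -M ≠ 0 := neg_ne_zero.2 hM0
  have huniq : ∀ p ∈ K, p ∈ frontier K → (∀ x ∈ K, inner ℝ x M = inner ℝ p M → x ∈ frontier K) →
      (∃ q, {x | inner ℝ x M = inner ℝ p M} ∩ frontier K = {q}) →
      ∀ x ∈ K, inner ℝ x M = inner ℝ p M → x = p := by
    rintro p hp hpf hfr ⟨q, hq⟩ x hx hxM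
    have m1 : p ∈ ({q} : Set Plane) := by rw [← hq]; exact ⟨rfl, hpf⟩
    have m2 : x ∈ ({q} : Set Plane) := by rw [← hq]; exact ⟨hxM, hfr x hx hxM⟩
    rw [mem_singleton_iff.1 m1, mem_singleton_iff.1 m2]
  have hub := huniq b hb (hseg (left_mem_segment ℝ b c)) fun x hx hxM =>
    mem_frontier_of_mem_of_le hM0 hx fun y hy => by rw [hxM]; exact (hM y hy).1
  have huc := huniq c hc (hseg (right_mem_segment ℝ b c)) fun x hx hxM =>
    mem_frontier_of_mem_of_le hnM0 hx fun y hy => by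
      rw [inner_neg_right, inner_neg_right, hxM]; exact neg_le_neg (hM y hy).2
  have hprod : 0 < inner ℝ (c - b) (dir θ) * inner ℝ (dir θ) M := by
    have h4 := inner_frame θ (c - b) M
    rw [inner_sub_left, inner_sub_left _ _ (nrm θ), hbt, hct, real_inner_comm _ M] at h4
    linarith
  refine ⟨θ, fun α hα => ?_⟩
  rcases lt_or_ge 0 (inner ℝ (dir θ) M) with hμ | hμ
  · have := hK.slopeL_le_of_base hleft hb hc hbt hct hM hμ hα
    exact ⟨this.1, fun h => this.2 (h.imp hub huc)⟩
  · have hμ' : 0 < inner ℝ (dir θ) (-M) := by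
      rw [inner_neg_right]
      refine neg_pos.2 (lt_of_le_of_ne hμ fun h0 => ?_)
      rw [h0] at hprod; simp at hprod
    have := hK.slopeL_le_of_base (M := -M) hleft hc hb hct hbt (fun x hx => by
      simp only [inner_neg_right, neg_le_neg_iff]; exact ⟨(hM x hx).2, (hM x hx).1⟩) hμ' hα
    refine ⟨this.1, fun h => this.2 ?_⟩
    simp only [inner_neg_right, neg_inj]
    exact (h.imp hub huc).symm

lemma IsPlanarBody.alphaZ_eq_zero_of_segment (hK : IsPlanarBody K) {b c : Plane} {D D' : Set Plane}
    (hseg : segment ℝ b c ⊆ frontier K) (h1 : IsSupportingLineAt K D b)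
    (h2 : IsSupportingLineAt K D' c) (h3 : AreDistinctParallel D D') : alphaZ K = 0 := by
  obtain ⟨θ, hθ⟩ := hK.exists_slopeL_le hseg h1 h2 h3
  rw [hK.alphaZ_eq_zero_iff]
  intro α hα hf
  have h4 := (hK.velL_pos_iff hα θ).1 (hf θ).1
  linarith [(hθ α hα).1, hK.slopeR_le_slopeL_secOffset_add_pi hα θ]

lemma IsPlanarBody.alphaB_eq_zero_of_segment (hK : IsPlanarBody K) {b c : Plane} {D D' : Set Plane}
    (hseg : segment ℝ b c ⊆ frontier K) (h1 : IsSupportingLineAt K D b)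
    (h2 : IsSupportingLineAt K D' c) (h3 : AreDistinctParallel D D')
    (h4 : (∃ p, D ∩ frontier K = {p}) ∨ (∃ p, D' ∩ frontier K = {p})) : alphaB K = 0 := by
  obtain ⟨θ, hθ⟩ := hK.exists_slopeL_le hseg h1 h2 h3
  refine le_antisymm (not_lt.1 fun hpos => ?_) (alphaB_nonneg K)
  have hhalf := hK.alphaB_le_half
  -- The strict inequality holds for every area, in particular at `α_B` itself, which the open
  -- interval `I_B` omits.
  have hα : alphaB K ∈ Ioo (0 : ℝ) 1 := ⟨hpos, by linarith⟩
  have : alphaB K ∈ setIB K := by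
    refine ⟨hα, θ, (mem_backwards_iff K _ θ).2 (Or.inl ((hK.velL_neg_iff hα θ).2 ?_))⟩
    linarith [(hθ _ hα).2 h4, hK.slopeR_le_slopeL_secOffset_add_pi hα θ]
  rw [hK.setIB_eq] at this
  exact lt_irrefl _ this.1

/-! ### Bodies with `C¹` boundary -/

/-- A supporting functional has a local minimum at `p` along the boundary curve, so it kills the
velocity of the parametrization. One vector thus serves all supporting lines at `p`. -/
lemma IsPlanarBody.exists_tangent (hK : IsPlanarBody K) (hC : IsC1Curve (frontier K)) {p : Plane}
    (hp : p ∈ frontier K) : ∃ v : Plane, v ≠ 0 ∧ ∀ M : Plane,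
      (∀ x ∈ K, inner ℝ p M ≤ inner ℝ x M) → inner ℝ v M = 0 := by
  obtain ⟨U, -, -, ε, hε, γ, hγ, hγ0, hd, -, him⟩ := hC p hp
  have h0 : (0 : ℝ) ∈ Ioo (-ε) ε := ⟨by linarith, hε⟩
  refine ⟨deriv γ 0, hd 0 h0, fun M hM => ?_⟩
  have hdiff : DifferentiableAt ℝ γ 0 :=
    (hγ.differentiableOn (by norm_num)).differentiableAt (Ioo_mem_nhds h0.1 h0.2)
  have hder : HasDerivAt (fun s => inner ℝ (γ s) M) (inner ℝ (deriv γ 0) M) 0 := by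
    have := hdiff.hasDerivAt.inner ℝ (hasDerivAt_const (0 : ℝ) M)
    rwa [inner_zero_right, zero_add] at this
  refine IsLocalMin.hasDerivAt_eq_zero ?_ hder
  filter_upwards [Ioo_mem_nhds h0.1 h0.2] with s hs
  rw [hγ0]
  have : γ s ∈ frontier K ∩ U := by rw [← him]; exact mem_image_of_mem _ hs
  exact hM _ (hK.frontier_subset this.1)

/-- If `α_Z` vanished, the line of the boundary segment and the side of the strip would both support
`K` at `b`. Having the same tangent there they would coincide, but `M` separates `b` from `c`. -/
lemma IsPlanarBody.alphaZ_pos_of_isC1Curve (hK : IsPlanarBody K) (hC : IsC1Curve (frontier K)) :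
    0 < alphaZ K := by
  refine lt_of_le_of_ne (alphaZ_nonneg K) fun h => ?_
  obtain ⟨b, c, hne, hseg, D, D', h1, h2, h3⟩ := hK.exists_segment_of_alphaZ_eq_zero h.symm
  obtain ⟨M, -, -, hM, hlt⟩ := exists_strip_of_supporting h1 h2 h3
  obtain ⟨θ, t₀, hleft, hbt, hct⟩ := hK.exists_leftHalf_of_segment hseg
  obtain ⟨v, hv0, hv⟩ := hK.exists_tangent hC (hseg (left_mem_segment ℝ b c))
  have hv1 := hv M fun x hx => (hM x hx).1
  have hv2 := hv (nrm θ) fun x hx => by rw [hbt]; exact hleft hx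
  have hvd : inner ℝ v (dir θ) ≠ 0 := fun h0 => hv0 (frame_ext θ (by simpa using h0) (by simpa using hv2))
  rw [inner_frame θ v M, hv2, zero_mul, add_zero] at hv1
  have hMd := (mul_eq_zero.1 hv1).resolve_left hvd
  rw [inner_frame θ b M, inner_frame θ c M, hMd, hbt, hct] at hlt
  simp at hlt

lemma IsPlanarBody.chordC_mem_frontier (hK : IsPlanarBody K) {α : ℝ} (hα : α ∈ Ioo (0 : ℝ) 1)
    (θ : ℝ) : chordC K α θ ∈ frontier K :=
  ⟨subset_closure (hK.chordC_mem hα θ), hK.hi_notMem_interior _ _⟩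

lemma IsPlanarBody.chordB_mem_frontier (hK : IsPlanarBody K) {α : ℝ} (hα : α ∈ Ioo (0 : ℝ) 1)
    (θ : ℝ) : chordB K α θ ∈ frontier K := by
  rw [hK.chordB_eq_chordC hα]; exact hK.chordC_mem_frontier (one_sub_mem_Ioo hα) _

/-- Two normals orthogonal to the same nonzero vector are parallel; the resulting slope depends only
on `N` and `θ`. -/
lemma slope_eq_of_inner_eq_zero {θ k : ℝ} {v N : Plane} (hv : v ≠ 0) (hN : N ≠ 0)
    (h1 : inner ℝ v (slopeNormal θ k) = 0) (h2 : inner ℝ v N = 0) :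
    k = -inner ℝ N (nrm θ) / inner ℝ N (dir θ) := by
  rw [inner_slopeNormal] at h1
  have hvn : inner ℝ v (nrm θ) ≠ 0 := fun h0 => by
    rw [h0, mul_zero, sub_zero] at h1
    exact hv (frame_ext θ (by simpa using h1) (by simpa using h0))
  rw [inner_frame θ v N, show inner ℝ v (dir θ) = k * inner ℝ v (nrm θ) by linarith] at h2
  have h3 : inner ℝ v (nrm θ) * (k * inner ℝ N (dir θ) + inner ℝ N (nrm θ)) = 0 := by linarith
  have h4 := (mul_eq_zero.1 h3).resolve_left hvn
  have hNd : inner ℝ N (dir θ) ≠ 0 := fun h0 => by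
    rw [h0, mul_zero, zero_add] at h4
    exact hN (frame_ext θ (by simpa using h0) (by simpa using h4))
  rw [eq_div_iff hNd]; linarith

/-- Zeros at areas tending to `α_Z` put `K` in strips based on chords, and since `α_Z > 0` these
converge to a strip based on an `α_Z`-chord. Uniqueness of the tangent at each end gives every
supporting slope there the common slope of the strip, so the velocity vanishes. -/
lemma IsPlanarBody.alphaZ_mem_setIZ_of_isC1Curve (hK : IsPlanarBody K)
    (hC : IsC1Curve (frontier K)) : alphaZ K ∈ setIZ K := by
  have hpos := hK.alphaZ_pos_of_isC1Curve hC
  have hα : alphaZ K ∈ Ioo (0 : ℝ) 1 := ⟨hpos, by linarith [hK.alphaZ_le_half]⟩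
  obtain ⟨α, -, hlim, hαZ⟩ := exists_seq_tendsto_sInf ⟨_, hK.half_mem_setIZ⟩ (bddBelow_setIZ K)
  have hex : ∀ n, ∃ θ ∈ Icc 0 (2 * π), θ ∈ zeros K (α n) := by
    intro n
    obtain ⟨hn, θ, hθ⟩ := hαZ n
    obtain ⟨k, hk⟩ := exists_mem_Icc_add_two_pi_mul θ
    refine ⟨_, hk, ?_⟩
    rw [mem_zeros_iff] at hθ ⊢
    rwa [hK.velL_add_two_pi_mul hn, hK.velR_add_two_pi_mul hn]
  choose θ hθ hz using hex
  choose N hN hs using fun n => hK.exists_strip_of_mem_zeros (hαZ n).1 (hz n)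
  have hcomp : IsCompact ((Icc 0 (2 * π)) ×ˢ Metric.sphere (0 : Plane) 1) :=
    isCompact_Icc.prod (isCompact_sphere _ _)
  obtain ⟨⟨θ₀, N₀⟩, ⟨-, hN0⟩, φ, hφ, htend⟩ := hcomp.tendsto_subseq
    (x := fun n => (θ n, N n)) fun n => ⟨hθ n, by simp [hN n]⟩
  have hN0 : N₀ ≠ 0 := norm_ne_zero_iff.1 (by
    have : ‖N₀‖ = 1 := by simpa using hN0
    rw [this]; norm_num)
  have t1 : Tendsto (θ ∘ φ) atTop (𝓝 θ₀) := (continuous_fst.tendsto _).comp htend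
  have t2 : Tendsto (N ∘ φ) atTop (𝓝 N₀) := (continuous_snd.tendsto _).comp htend
  have t3 : Tendsto (fun n => (α (φ n), θ (φ n))) atTop (𝓝 (alphaZ K, θ₀)) :=
    (hlim.comp hφ.tendsto_atTop).prodMk_nhds t1
  have tB : Tendsto (fun n => chordB K (α (φ n)) (θ (φ n))) atTop (𝓝 (chordB K (alphaZ K) θ₀)) :=
    Tendsto.comp (g := fun p : ℝ × ℝ => chordB K p.1 p.2)
      (f := fun n => (α (φ n), θ (φ n))) (hK.continuousAt_chordB hα θ₀) t3
  have tC : Tendsto (fun n => chordC K (α (φ n)) (θ (φ n))) atTop (𝓝 (chordC K (alphaZ K) θ₀)) :=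
    Tendsto.comp (g := fun p : ℝ × ℝ => chordC K p.1 p.2)
      (f := fun n => (α (φ n), θ (φ n))) (hK.continuousAt_chordC hα θ₀) t3
  have hstrip : ∀ x ∈ K, inner ℝ (chordB K (alphaZ K) θ₀) N₀ ≤ inner ℝ x N₀ ∧
      inner ℝ x N₀ ≤ inner ℝ (chordC K (alphaZ K) θ₀) N₀ := fun x hx =>
    ⟨le_of_tendsto_of_tendsto' (tB.inner t2) (tendsto_const_nhds.inner t2)
      fun n => (hs (φ n) x hx).1,
    le_of_tendsto_of_tendsto' (tendsto_const_nhds.inner t2) (tC.inner t2)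
      fun n => (hs (φ n) x hx).2⟩
  obtain ⟨v, hv0, hv⟩ := hK.exists_tangent hC (hK.chordC_mem_frontier hα θ₀)
  obtain ⟨w, hw0, hw⟩ := hK.exists_tangent hC (hK.chordB_mem_frontier hα θ₀)
  have hvN : inner ℝ v N₀ = 0 := by
    have := hv (-N₀) fun x hx => by
      rw [inner_neg_right, inner_neg_right]; exact neg_le_neg (hstrip x hx).2
    rwa [inner_neg_right, neg_eq_zero] at this
  have hwN : inner ℝ w N₀ = 0 := hw N₀ fun x hx => (hstrip x hx).1
  have a1 := hK.slopeR_le_slopeL_secOffset hα θ₀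
  have a2 := hK.slopeR_le_slopeL_secOffset_add_pi hα θ₀
  have hc : ∀ k, slopeR K θ₀ (secOffset K (alphaZ K) θ₀) ≤ k →
      k ≤ slopeL K θ₀ (secOffset K (alphaZ K) θ₀) →
        k = -inner ℝ N₀ (nrm θ₀) / inner ℝ N₀ (dir θ₀) := fun k h1 h2 => by
    refine slope_eq_of_inner_eq_zero hv0 hN0 ?_ hvN
    have := hv (-slopeNormal θ₀ k) fun x hx => by
      rw [inner_neg_right, inner_neg_right]
      exact neg_le_neg (hK.inner_slopeNormal_le_chordC hα h1 h2 hx)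
    rwa [inner_neg_right, neg_eq_zero] at this
  have hb : ∀ k, slopeR K (θ₀ + π) (-secOffset K (alphaZ K) θ₀) ≤ k →
      k ≤ slopeL K (θ₀ + π) (-secOffset K (alphaZ K) θ₀) →
        k = -inner ℝ N₀ (nrm θ₀) / inner ℝ N₀ (dir θ₀) := fun k h1 h2 =>
    slope_eq_of_inner_eq_zero hw0 hN0
      (hw _ fun x hx => hK.chordB_le_inner_slopeNormal hα h1 h2 hx) hwN
  refine ⟨hα, θ₀, (mem_zeros_iff K _ θ₀).2 ⟨Or.inl ?_, Or.inl ?_⟩⟩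
  · rw [hK.velL_eq hα, velocityL, hc _ a1 le_rfl, hb _ a2 le_rfl]; simp
  · rw [hK.velL_eq hα, velocityL, hc _ a1 le_rfl, hb _ a2 le_rfl]; simp

end AlphaSec


theorem theoremt2 (K : Set Plane) (hK : IsPlanarBody K) :
    -- the shape of the three sets of parameters
    (setIB K = Set.Ioo (alphaB K) 1 ∧
      setIF K = Set.Ioo 0 (1 - alphaB K) ∧
      (IsC1Curve (frontier K) → setIZ K = Set.Icc (alphaZ K) (1 - alphaZ K)) ∧
      (setIZ K = Set.Icc (alphaZ K) (1 - alphaZ K) ∨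
        setIZ K = Set.Ioo (alphaZ K) (1 - alphaZ K))) ∧
    -- comparison of the two critical values
    (alphaZ K ≤ alphaB K ∧ alphaB K ≤ 1 / 2 ∧
      (alphaZ K ≠ alphaB K → HasParallelSegments (frontier K))) ∧
    -- the extreme cases
    ((alphaB K = 1 / 2 ↔ IsCentrallySymmetric K) ∧
      (alphaZ K = 0 ↔
        ∃ b c : Plane, b ≠ c ∧ segment ℝ b c ⊆ frontier K ∧
          ∃ D D' : Set Plane, IsSupportingLineAt K D b ∧ IsSupportingLineAt K D' c ∧
            AreDistinctParallel D D') ∧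
      (alphaB K = 0 ↔
        ∃ b c : Plane, b ≠ c ∧ segment ℝ b c ⊆ frontier K ∧
          ∃ D D' : Set Plane, IsSupportingLineAt K D b ∧ IsSupportingLineAt K D' c ∧
            AreDistinctParallel D D' ∧
            ((∃ p, D ∩ frontier K = {p}) ∨ (∃ p, D' ∩ frontier K = {p})))) := by
  refine ⟨⟨hK.setIB_eq, hK.setIF_eq,
      fun hC => hK.setIZ_eq_Icc (hK.alphaZ_mem_setIZ_of_isC1Curve hC), ?_⟩,
    ⟨hK.alphaZ_le_alphaB, hK.alphaB_le_half, hK.hasParallelSegments_of_alphaZ_ne⟩,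
    hK.alphaB_eq_half_iff, ⟨hK.exists_segment_of_alphaZ_eq_zero, ?_⟩,
    ⟨hK.exists_segment_of_alphaB_eq_zero, ?_⟩⟩
  · by_cases h : alphaZ K ∈ setIZ K
    · exact Or.inl (hK.setIZ_eq_Icc h)
    · exact Or.inr (hK.setIZ_eq_Ioo h)
  · rintro ⟨b, c, -, hseg, D, D', h1, h2, h3⟩
    exact hK.alphaZ_eq_zero_of_segment hseg h1 h2 h3
  · rintro ⟨b, c, -, hseg, D, D', h1, h2, h3, h4⟩
    exact hK.alphaB_eq_zero_of_segment hseg h1 h2 h3 h4
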